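/- A diagram of degree $n$ with support $\mathbb R$ is a finite graph without loops or double edges, with $2n$ vertices, each univalent ($U$) or trivalent ($T$), each connected component of which meets $U$, together with an isotopy class of injections $U\to\mathbb R$. Write $E$ for the set of its edges and $|\Gamma|$ for the number of automorphisms of a diagram $\Gamma$. An orientation of a diagram is a cyclic order of the three edges at each trivalent vertex and a local orientation of $\mathbb R$ at each univalent vertex. Let $\mathcal A_n(\mathbb R)$ be the real vector space generated by the oriented diagrams of degree $n$ up to isomorphism, modulo the relations AS (reversing the orientation of one vertex changes the sign), IHX ($I=H-X$) and STU ($T=U-S$: a trivalent vertex joined to a univalent vertex is resolved into two consecutive univalent vertices, $S$ being the crossed resolution), and let $[\Gamma]$ be the class of $\Gamma$. For a connected diagram $\Gamma$ and $s\in S^2$, let $W_s(\Gamma)$ be the space of the maps from the vertices of $\Gamma$ to $\mathbb R^3$ that send the ends of each edge to different points and that send the univalent vertices to the axis $l_s$ through $0$ with direction $s$, by $u\mapsto i(u)s$ with $i$ in the given isotopy class, modulo the translations along $s$ and the dilations of positive ratio preserving $l_s$. Let $W(\Gamma)=\bigcup_{s\in S^2}W_s(\Gamma)$. Direct the edges of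 $\Gamma$; let $\Psi_\Gamma:W(\Gamma)\to(S^2)^E$ map a configuration to the directions of its edges, and let $\Omega$ be the product of the volume forms of total mass $1$ of the spheres. For an oriented $\Gamma$, the maps with axis $l_s$ are oriented by labelling local coordinates by the half-edges (the position on the oriented axis $l_s$ for a univalent vertex, its sign being that of the orientation of the vertex; the three standard components for a trivalent vertex, attributed to its half-edges according to its cyclic order), ordered edge by edge, from source to target; $W_s(\Gamma)$ has the quotient orientation, the group being oriented by (translation along $s$, growing dilation), and $W(\Gamma)$ the one deduced with the standard orientation of $S^2$. Put $$f_\Gamma=\int_{W(\Gamma)}\Psi_\Gamma^*\Omega ,$$ and define the anomaly as $$\alpha=\sum_\Gamma\frac{f_\Gamma}{2|\Gamma|}[\Gamma]\in\mathcal A(\mathbb R)=\prod_n\mathcal A_n(\mathbb R),$$ where $\Gamma$ runs over the isomorphism classes of connected diagrams with support $\mathbb R$, each with an arbitrary orientation. Proposition. For every connected diagram $\Gamma$ of degree $3$ the integral $f_\Gamma$ converges absolutely, and, for any choice of the orientations, the degree $3$ part of the anomaly vanishes: $\alpha_3=0$ in $\mathcal A_3(\mathbb R)$. -/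

import Mathlib

namespace ConfInt

/-! ### Diagrams with support the real line -/

/-- Two injections of a finite set into the line are isotopic (joined by a path of injections)
iff they put the set in the same order. So an isotopy class of injections `U → ℝ` is the same
thing as a strict total order on `U`, and it consists of the maps that are increasing for it. -/
theorem isotopic_iff_same_order {U : Type*} [Finite U] {i j : U → ℝ}
    (hi : Function.Injective i) (_ : Function.Injective j) :
    JoinedIn {k : U → ℝ | Function.Injective k} i j ↔ ∀ a b, i a < i b ↔ j a < j b := by
  constructor
  · rintro ⟨γ, hγ⟩
    have key : ∀ a b, i a < i b → j a < j b := by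
      intro a b hab
      by_contra hcon
      have hc : Continuous fun t => γ t b - γ t a := by fun_prop
      have h0 : 0 < γ 0 b - γ 0 a := by simpa using hab
      have h1 : γ 1 b - γ 1 a ≤ 0 := by simpa using hcon
      obtain ⟨t, ht⟩ := intermediate_value_univ (1 : unitInterval) 0 hc ⟨h1, h0.le⟩
      have hba : b = a := hγ t (by simpa [sub_eq_zero] using ht)
      simp [hba] at hab
    intro a b
    refine ⟨key a b, fun h => ?_⟩
    by_contra hcon
    rcases lt_or_eq_of_le (not_lt.1 hcon) with h' | h'
    · exact lt_asymm h (key b a h')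
    · rw [hi h'] at h
      exact lt_irrefl _ h
  · intro h
    refine JoinedIn.of_segment_subset ?_
    rintro k ⟨s, t, hs, ht, hst, rfl⟩
    intro a b hab
    simp only [Pi.add_apply, Pi.smul_apply, smul_eq_mul] at hab
    by_contra hne
    have key : ∀ c d, i c < i d → s * i c + t * j c < s * i d + t * j d := by
      intro c d hcd
      have hcd' := (h c d).1 hcd
      rcases eq_or_lt_of_le hs with h0 | h0
      · have ht1 : t = 1 := by linarith
        rw [← h0, ht1]
        linarith
      · have h1 := mul_lt_mul_of_pos_left hcd h0
        have h2 := mul_le_mul_of_nonneg_left hcd'.le ht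
        linarith
    rcases lt_or_gt_of_ne (fun e => hne (hi e)) with h' | h'
    · exact (key a b h').ne hab
    · exact (key b a h').ne hab.symm

/-- A diagram of degree `n` with support the line, on the vertex set `Fin (2 * n)`: a graph
without loops or double edges, all of whose vertices are univalent or trivalent and all of whose
components contain a univalent vertex, with an isotopy class of injections of the set of
univalent vertices into the line, given as a strict total order `lt` on that set. -/
structure Diagram (n : ℕ) where
  graph : SimpleGraph (Fin (2 * n))
  valency : ∀ v, (graph.neighborSet v).ncard = 1 ∨ (graph.neighborSet v).ncard = 3
  meets : ∀ v, ∃ u, graph.Reachable v u ∧ (graph.neighborSet u).ncard = 1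
  lt : Fin (2 * n) → Fin (2 * n) → Prop
  lt_univalent : ∀ a b, lt a b →
    (graph.neighborSet a).ncard = 1 ∧ (graph.neighborSet b).ncard = 1
  lt_irrefl : ∀ a, ¬ lt a a
  lt_trans : ∀ a b c, lt a b → lt b c → lt a c
  lt_total : ∀ a b, (graph.neighborSet a).ncard = 1 → (graph.neighborSet b).ncard = 1 →
    a ≠ b → lt a b ∨ lt b a

namespace Diagram

variable {n : ℕ}

/-- `v` is a univalent vertex. -/
def IsUni (D : Diagram n) (v : Fin (2 * n)) : Prop := (D.graph.neighborSet v).ncard = 1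

/-- `v` is a trivalent vertex. -/
def IsTri (D : Diagram n) (v : Fin (2 * n)) : Prop := (D.graph.neighborSet v).ncard = 3

/-- The bijection `σ` of the vertices is an isomorphism from `D` to `D'`. -/
def IsIso (D D' : Diagram n) (σ : Equiv.Perm (Fin (2 * n))) : Prop :=
  (∀ a b, D'.graph.Adj (σ a) (σ b) ↔ D.graph.Adj a b) ∧ ∀ a b, D'.lt (σ a) (σ b) ↔ D.lt a b

/-- The number `|Γ|` of automorphisms. -/
noncomputable def numAut (D : Diagram n) : ℕ :=
  Nat.card {σ : Equiv.Perm (Fin (2 * n)) // D.IsIso D σ}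

instance : Finite (Diagram n) := by
  refine Finite.of_injective (fun D : Diagram n => (D.graph, D.lt)) ?_
  rintro ⟨⟩ ⟨⟩ h
  simp only [Prod.mk.injEq] at h
  obtain ⟨rfl, rfl⟩ := h
  rfl

/-- A connected diagram has a first univalent vertex. -/
theorem exists_first (D : Diagram n) (hD : D.graph.Connected) :
    ∃ u, D.IsUni u ∧ ∀ w, ¬ D.lt w u := by
  obtain ⟨v⟩ := hD.nonempty
  obtain ⟨u, -, hu⟩ := D.meets v
  have : IsTrans (Fin (2 * n)) D.lt := ⟨D.lt_trans⟩
  have : Std.Irrefl D.lt := ⟨D.lt_irrefl⟩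
  obtain ⟨m, hm, hmin⟩ :=
    (Finite.wellFounded_of_trans_of_irrefl D.lt).has_min {w | D.IsUni w} ⟨u, hu⟩
  exact ⟨m, hm, fun w hw => hmin w (D.lt_univalent w m hw).1 hw⟩

end Diagram

/-- An oriented diagram. At a trivalent vertex `t`, the values `cyc t x` at the three neighbours
`x` of `t` are distinct and represent the cyclic order (increasing modulo 3) of the three edges
`{t, x}`; they are relevant only up to a common shift. At a univalent vertex `u`, `sgn u = 1` is
the standard local orientation of the line, and `sgn u = -1` the opposite one. The other values
of `cyc` and `sgn` are irrelevant. -/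
structure OrientedDiagram (n : ℕ) extends Diagram n where
  cyc : Fin (2 * n) → Fin (2 * n) → Fin 3
  cyc_injOn : ∀ t, toDiagram.IsTri t → Set.InjOn (cyc t) (graph.neighborSet t)
  sgn : Fin (2 * n) → ℤˣ

namespace OrientedDiagram

variable {n : ℕ}

/-- The vertex `v` of `Γ` and the vertex `v'` of `Γ'` have the same orientation, when the
neighbours of `v` are identified with those of `v'` through `ρ`. -/
def SameOr (Γ Γ' : OrientedDiagram n) (v v' : Fin (2 * n)) (ρ : Equiv.Perm (Fin (2 * n))) : Prop :=
  (Γ.IsUni v → Γ'.sgn v' = Γ.sgn v) ∧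
  (Γ.IsTri v → ∃ k : Fin 3, ∀ x, Γ.graph.Adj v x → Γ'.cyc v' (ρ x) = Γ.cyc v x + k)

/-- The vertex `v` has opposite orientations in `Γ` and `Γ'` (which have the same graph). -/
def OppositeOr (Γ Γ' : OrientedDiagram n) (v : Fin (2 * n)) : Prop :=
  (Γ.IsUni v → Γ'.sgn v = - Γ.sgn v) ∧
  (Γ.IsTri v → ∃ k : Fin 3, ∀ x, Γ.graph.Adj v x → Γ'.cyc v x = - Γ.cyc v x + k)

/-- The edges from `t` to `p`, `q`, `r` are in this cyclic order at `t`. -/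
def CycAt (Γ : OrientedDiagram n) (t p q r : Fin (2 * n)) : Prop :=
  Γ.cyc t q = Γ.cyc t p + 1 ∧ Γ.cyc t r = Γ.cyc t p + 2

/-- `Γ` and `Γ'` are isomorphic as oriented diagrams. -/
def Isomorphic (Γ Γ' : OrientedDiagram n) : Prop :=
  ∃ σ : Equiv.Perm (Fin (2 * n)), Γ.IsIso Γ'.toDiagram σ ∧ ∀ v, Γ.SameOr Γ' v (σ v) σ

/-- `Γ` and `Γ'` differ by the orientation of exactly one vertex. -/
def AS (Γ Γ' : OrientedDiagram n) : Prop :=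
  Γ'.toDiagram = Γ.toDiagram ∧
  ∃ v, Γ.OppositeOr Γ' v ∧ ∀ w, w ≠ v → Γ.SameOr Γ' w w 1

/-- The three diagrams of an IHX relation. With the four ends `a, b, c, d` at the upper left,
upper right, lower left and lower right: in `ΓI` the edge `{x, y}` is vertical, `x` being above;
in `ΓH` it is horizontal, `x` being on the left and joined to `a` and `c`; `ΓX` is obtained from
the picture of `ΓH` by crossing the two lower legs, so that `x` is joined to `a` and `d`.
All vertices are oriented counterclockwise. -/
def IHX (ΓI ΓH ΓX : OrientedDiagram n) : Prop :=
  ∃ x y a b c d : Fin (2 * n),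
    [x, y, a, b, c, d].Nodup ∧ ΓI.IsTri x ∧ ΓI.IsTri y ∧
    ΓI.graph.Adj x y ∧ ΓI.graph.Adj x a ∧ ΓI.graph.Adj x b ∧
    ΓI.graph.Adj y c ∧ ΓI.graph.Adj y d ∧
    (∀ p q, ΓH.graph.Adj p q ↔
      (ΓI.graph.Adj p q ∧ s(p, q) ≠ s(x, b) ∧ s(p, q) ≠ s(y, c)) ∨
        s(p, q) = s(x, c) ∨ s(p, q) = s(y, b)) ∧
    (∀ p q, ΓX.graph.Adj p q ↔
      (ΓI.graph.Adj p q ∧ s(p, q) ≠ s(x, b) ∧ s(p, q) ≠ s(y, d)) ∨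
        s(p, q) = s(x, d) ∨ s(p, q) = s(y, b)) ∧
    ΓH.lt = ΓI.lt ∧ ΓX.lt = ΓI.lt ∧
    ΓI.CycAt x y b a ∧ ΓI.CycAt y x c d ∧
    ΓH.CycAt x y a c ∧ ΓH.CycAt y x d b ∧
    ΓX.CycAt x y a d ∧ ΓX.CycAt y x c b ∧
    ∀ v, v ≠ x → v ≠ y →
      ΓI.SameOr ΓH v v (if v = b ∨ v = c then Equiv.swap x y else 1) ∧
      ΓI.SameOr ΓX v v (if v = b ∨ v = d then Equiv.swap x y else 1)

/-- `Γ'` is obtained from `Γ` by removing the edges at the univalent vertex `u` and from its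
neighbour `t` to `p`, and joining `u` to `p`, where `t` becomes the univalent vertex that
immediately follows `u` on the line, both with the standard orientation of the line. -/
def Resolves (Γ Γ' : OrientedDiagram n) (u t p : Fin (2 * n)) : Prop :=
  (∀ v w, Γ'.graph.Adj v w ↔
    (Γ.graph.Adj v w ∧ s(v, w) ≠ s(u, t) ∧ s(v, w) ≠ s(t, p)) ∨ s(v, w) = s(u, p)) ∧
  (∀ v w, v ≠ t → w ≠ t → (Γ'.lt v w ↔ Γ.lt v w)) ∧
  Γ'.lt u t ∧
  (∀ v, v ≠ t → v ≠ u → (Γ'.lt v t ↔ Γ.lt v u) ∧ (Γ'.lt t v ↔ Γ.lt u v)) ∧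
  Γ'.sgn u = 1 ∧ Γ'.sgn t = 1 ∧
  ∀ v, v ≠ u → v ≠ t → Γ.SameOr Γ' v v (if v = p then Equiv.swap t u else 1)

/-- The three diagrams of an STU relation. In `ΓT` the univalent vertex `u`, with the standard
orientation of the line (drawn horizontally, from left to right), is joined to the trivalent
vertex `t` above it, which is joined to the ends `a` on the left and `b` on the right. In `ΓU` the
ends `a` and `b` go down to two consecutive points of the line without crossing; in `ΓS` they
cross. -/
def STU (ΓT ΓU ΓS : OrientedDiagram n) : Prop :=
  ∃ u t a b : Fin (2 * n),
    [u, t, a, b].Nodup ∧ ΓT.IsUni u ∧ ΓT.IsTri t ∧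
    ΓT.graph.Adj u t ∧ ΓT.graph.Adj t a ∧ ΓT.graph.Adj t b ∧
    ΓT.sgn u = 1 ∧ ΓT.CycAt t u b a ∧
    ΓT.Resolves ΓU u t a ∧ ΓT.Resolves ΓS u t b

end OrientedDiagram

/-! ### The spaces of diagrams -/

/-- The subspace generated by the relations in degree `n`. -/
noncomputable def relations (n : ℕ) : Submodule ℝ (OrientedDiagram n →₀ ℝ) :=
  Submodule.span ℝ
    ({w | ∃ Γ Γ' : OrientedDiagram n, Γ.Isomorphic Γ' ∧
        w = Finsupp.single Γ' 1 - Finsupp.single Γ 1} ∪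
     {w | ∃ Γ Γ' : OrientedDiagram n, Γ.AS Γ' ∧
        w = Finsupp.single Γ' 1 + Finsupp.single Γ 1} ∪
     {w | ∃ ΓI ΓH ΓX : OrientedDiagram n, ΓI.IHX ΓH ΓX ∧
        w = Finsupp.single ΓI 1 - (Finsupp.single ΓH 1 - Finsupp.single ΓX 1)} ∪
     {w | ∃ ΓT ΓU ΓS : OrientedDiagram n, ΓT.STU ΓU ΓS ∧
        w = Finsupp.single ΓT 1 - (Finsupp.single ΓU 1 - Finsupp.single ΓS 1)})

/-- The space `𝒜ₙ(ℝ)`: the real vector space generated by the oriented diagrams of degree `n` up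
to isomorphism, modulo the AS, IHX and STU relations. -/
abbrev DiagramSpace (n : ℕ) : Type := (OrientedDiagram n →₀ ℝ) ⧸ relations n

/-- The class `[Γ]` of an oriented diagram. -/
noncomputable def OrientedDiagram.cls {n : ℕ} (Γ : OrientedDiagram n) : DiagramSpace n :=
  (relations n).mkQ (Finsupp.single Γ 1)

/-! ### Configuration spaces and their integrals -/

/-- Euclidean 3-space. -/
abbrev E3 : Type := EuclideanSpace ℝ (Fin 3)

/-- The standard measure of the unit sphere of a Euclidean space. -/
noncomputable abbrev sphereMeasure (ι : Type) [Fintype ι] :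
    MeasureTheory.Measure (Metric.sphere (0 : EuclideanSpace ℝ ι) 1) :=
  (MeasureTheory.volume : MeasureTheory.Measure (EuclideanSpace ℝ ι)).toSphere

/-- A connected oriented diagram of degree `n`. -/
structure ConnOriented (n : ℕ) extends OrientedDiagram n where
  connected : graph.Connected

namespace ConnOriented

variable {n : ℕ} (Γ : ConnOriented n)

/-- The edges, each directed from its vertex with the smaller label to the other one. -/
def Edge : Type := {p : Fin (2 * n) × Fin (2 * n) // p.1 < p.2 ∧ Γ.graph.Adj p.1 p.2}

/-- The half-edges `(v, x)`: the half at `v` of the edge `{v, x}`. -/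
def HalfEdge : Type := {p : Fin (2 * n) × Fin (2 * n) // Γ.graph.Adj p.1 p.2}

instance : DecidableEq Γ.Edge := inferInstanceAs (DecidableEq (Subtype (α := Fin (2 * n) × Fin (2 * n)) _))

instance : DecidableEq Γ.HalfEdge :=
  inferInstanceAs (DecidableEq (Subtype (α := Fin (2 * n) × Fin (2 * n)) _))

noncomputable instance : Fintype Γ.Edge :=
  haveI : Finite Γ.Edge := inferInstanceAs (Finite (Subtype (α := Fin (2 * n) × Fin (2 * n)) _))
  Fintype.ofFinite _

noncomputable instance : Fintype Γ.HalfEdge :=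
  haveI : Finite Γ.HalfEdge := inferInstanceAs (Finite (Subtype (α := Fin (2 * n) × Fin (2 * n)) _))
  Fintype.ofFinite _

/-- The half of the directed edge `e` at its source. -/
def Edge.src {Γ : ConnOriented n} (e : Γ.Edge) : Γ.HalfEdge := ⟨e.1, e.2.2⟩

/-- The half of the directed edge `e` at its target. -/
def Edge.tgt {Γ : ConnOriented n} (e : Γ.Edge) : Γ.HalfEdge := ⟨e.1.swap, e.2.2.symm⟩

/-- The vector of `ℝ³` along which the coordinate labelled by the half-edge `h = (v, x)` moves the
vertex `v`, when the axis has direction `s`: the vector `s` if `v` is univalent, and the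
`cyc v x`-th standard basis vector if `v` is trivalent. -/
noncomputable def frame (s : E3) (h : Γ.HalfEdge) : E3 :=
  open Classical in
  if Γ.IsUni h.1.1 then s else EuclideanSpace.single (Γ.cyc h.1.1 h.1.2) 1

/-- The position of the vertex `v` in the map `V → ℝ³` with axis `s` and coordinates `c` (labelled
by the half-edges): the univalent vertices are on the axis, `c h` being the position on it of the
univalent vertex of `h`; the three coordinates at a trivalent vertex are its components. -/
noncomputable def position (s : E3) (c : Γ.HalfEdge → ℝ) (v : Fin (2 * n)) : E3 :=
  ∑ h : Γ.HalfEdge, if h.1.1 = v then c h • Γ.frame s h else 0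

/-- The vectors from the source to the target of the edges. The canonical map `Ψ` to `(S²)^E` takes
their directions. -/
noncomputable def displacement (p : E3 × (Γ.HalfEdge → ℝ)) : Γ.Edge → E3 :=
  fun e => Γ.position p.1 p.2 e.1.2 - Γ.position p.1 p.2 e.1.1

/-- The first univalent vertex on the line. -/
noncomputable def base : Fin (2 * n) := (Γ.toDiagram.exists_first Γ.connected).choose

/-- The half-edges not at the first univalent vertex. -/
def FreeHalfEdge : Type := {h : Γ.HalfEdge // h.1.1 ≠ Γ.base}

noncomputable instance : Fintype Γ.FreeHalfEdge :=
  haveI : Finite Γ.FreeHalfEdge := inferInstanceAs (Finite {h : Γ.HalfEdge // h.1.1 ≠ Γ.base})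
  Fintype.ofFinite _

/-- The coordinates extended by `0` to the first univalent vertex. -/
noncomputable def extend (y : Γ.FreeHalfEdge → ℝ) : Γ.HalfEdge → ℝ :=
  fun h => if hb : h.1.1 ≠ Γ.base then y ⟨h, hb⟩ else 0

/-- The unit vectors `s` of `ℝ³`, together with the unit vectors in the space of coordinates of the
maps that put the first univalent vertex at the origin. Any non-constant map with the
univalent vertices on the axis with direction `s` has exactly one representative here modulo the
translations and the dilations that preserve this axis. -/
abbrev Normalized : Type :=
  Metric.sphere (0 : E3) 1 × Metric.sphere (0 : EuclideanSpace ℝ Γ.FreeHalfEdge) 1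

/-- The axis and the coordinates of an element of `Normalized`. -/
noncomputable def coords (p : Γ.Normalized) : E3 × (Γ.HalfEdge → ℝ) :=
  (p.1.1, Γ.extend (fun h => p.2.1 h))

/-- The space `W(Γ)`, identified with an open subset of `Normalized`: the normalized maps that are
configurations, i.e. place the univalent vertices on the axis in the order of the diagram,
and do not send the two ends of any edge to the same point. -/
def W : Set Γ.Normalized :=
  {p | (∀ h h' : Γ.HalfEdge, Γ.lt h.1.1 h'.1.1 → (Γ.coords p).2 h < (Γ.coords p).2 h') ∧
    ∀ e, Γ.displacement (Γ.coords p) e ≠ 0}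

/-- The index set of a square matrix: three indices for each edge, and three more. -/
abbrev Index : Type := Γ.Edge × Fin 3 ⊕ Fin 3

/-- The standard basis vectors of the space `ℝ³ × ℝ^(half-edges)`: the indices `1` and `2` at an
edge stand for its source half and its target half. (The index `0` at an edge stands for no such
vector.) -/
noncomputable def basisVec : Γ.Index → E3 × (Γ.HalfEdge → ℝ)
  | Sum.inl (e, k) => if k = 0 then 0 else if k = 1 then (0, Pi.single e.src 1)
      else (0, Pi.single e.tgt 1)
  | Sum.inr j => (EuclideanSpace.single j 1, 0)

/-- The matrix for the volume form of `(S²)^E`. The upper rows are the components of the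
displacements of the edges, the lower rows the unit covectors that are conormal to `Normalized`:
the one normal to the sphere of the `s`, then that for the translations (the coordinate of the
first univalent vertex), then that for the dilations (radial). The column `(e, 0)` is the
displacement of `e`, normal to the sphere of `e`; every other column is the image of the standard
basis vector with that index, under the differential of `displacement` and under the conormals. -/
noncomputable def formMatrix (p : E3 × (Γ.HalfEdge → ℝ)) : Matrix Γ.Index Γ.Index ℝ :=
  fun r k => match r with
  | Sum.inl (e, i) =>
      (if k = Sum.inl (e, 0) then Γ.displacement p e i else 0)
        + fderiv ℝ Γ.displacement p (Γ.basisVec k) e i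
  | Sum.inr i =>
      if i = 0 then inner ℝ p.1 (Γ.basisVec k).1
      else if i = 1 then ∑ h, if h.1.1 = Γ.base then (Γ.basisVec k).2 h else 0
      else ∑ h, p.2 h * (Γ.basisVec k).2 h

/-- The density, with respect to the standard measure of the product of the two spheres, of the
form `Ψ^* Ω`, where `Ω` is the product of the normalized volume forms of the spheres of the edges.
Indeed the pull-back of the normalized volume form of `S²` by `d ↦ d / ‖d‖` takes the value
`det (d, w, w') / (4 π ‖d‖³)` on `(w, w')`; so `Ψ^* Ω` is given on `w₁, …, w_{2E}` by the
determinant, divided by `(4 π)^E ∏ ‖d_e‖³`, of the displacements `d_e` (each in its copy of `ℝ³`)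
followed by the images of the `wᵢ`. The bordered determinant below is the value of this
on the orthonormal bases of the tangent spaces of `Normalized` which, put after the three unit
normals in the order above, are positively oriented for the coordinates of `s` followed by those
labelled by the half-edges. This is the orientation of `W(Γ)` given by that of `S²` and by the one
of the configurations on the axis, quotiented by the group with oriented basis
(translation along `s`, growing dilation), when the univalent vertices have the standard
orientation. -/
noncomputable def density (p : Γ.Normalized) : ℝ :=
  (Γ.formMatrix (Γ.coords p)).det /
    ∏ e, (4 * Real.pi * ‖Γ.displacement (Γ.coords p) e‖ ^ 3)

/-- The product of the two sphere measures. -/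
noncomputable def normalizedMeasure : MeasureTheory.Measure Γ.Normalized :=
  (sphereMeasure (Fin 3)).prod (sphereMeasure Γ.FreeHalfEdge)

/-- The product of the orientations of the univalent vertices. -/
noncomputable def uniSign : ℤˣ :=
  open Classical in
  ∏ v, if Γ.IsUni v then Γ.sgn v else 1

/-- Absolute convergence of the integral of `Ψ^* Ω` over `W(Γ)`. -/
def Converges : Prop :=
  MeasureTheory.IntegrableOn Γ.density Γ.W Γ.normalizedMeasure

/-- The integral `f_Γ` of `Ψ^* Ω` over the oriented space `W(Γ)`. -/
noncomputable def f : ℝ :=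
  ((Γ.uniSign : ℤ) : ℝ) * ∫ p in Γ.W, Γ.density p ∂Γ.normalizedMeasure

end ConnOriented

/-! ### The anomaly -/

/-- A connected diagram of degree `n`. -/
structure ConnDiagram (n : ℕ) extends Diagram n where
  connected : graph.Connected

/-- Isomorphism of connected diagrams. -/
instance connDiagramSetoid (n : ℕ) : Setoid (ConnDiagram n) where
  r D D' := ∃ σ, D.IsIso D'.toDiagram σ
  iseqv :=
    { refl := fun D => ⟨1, fun _ _ => Iff.rfl, fun _ _ => Iff.rfl⟩
      symm := by
        rintro D D' ⟨σ, h1, h2⟩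
        exact ⟨σ⁻¹, fun a b => by simpa using (h1 (σ⁻¹ a) (σ⁻¹ b)).symm,
          fun a b => by simpa using (h2 (σ⁻¹ a) (σ⁻¹ b)).symm⟩
      trans := by
        rintro D D' D'' ⟨σ, h1, h2⟩ ⟨τ, k1, k2⟩
        exact ⟨τ * σ, fun a b => (k1 (σ a) (σ b)).trans (h1 a b),
          fun a b => (k2 (σ a) (σ b)).trans (h2 a b)⟩ }

/-- The set of the isomorphism classes of the connected diagrams of degree `n`. -/
abbrev DW (n : ℕ) : Type := Quotient (connDiagramSetoid n)

instance (n : ℕ) : Finite (ConnDiagram n) := by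
  refine Finite.of_injective (fun D : ConnDiagram n => D.toDiagram) ?_
  rintro ⟨⟩ ⟨⟩ h
  simpa using h

noncomputable instance (n : ℕ) : Fintype (DW n) := Fintype.ofFinite _

/-- The isomorphism class of the underlying unoriented diagram. -/
def ConnOriented.isoClass {n : ℕ} (Γ : ConnOriented n) : DW n :=
  Quotient.mk _ ⟨Γ.toDiagram, Γ.connected⟩

/-- A choice, for every isomorphism class of connected diagrams, of a representative and
of an orientation of it. -/
structure Choice where
  rep : ∀ n : ℕ, DW n → ConnOriented n
  isoClass_rep : ∀ n c, (rep n c).isoClass = c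

/-- Such choices exist. -/
theorem Choice.nonempty : Nonempty Choice := by
  have h : ∀ (n : ℕ) (c : DW n), ∃ Γ : ConnOriented n, Γ.isoClass = c := by
    intro n c
    induction c using Quotient.inductionOn with
    | h D =>
      have key : ∀ t, ∃ g : Fin (2 * n) → Fin 3,
          D.IsTri t → Set.InjOn g (D.graph.neighborSet t) := by
        intro t
        by_cases ht : D.IsTri t
        · obtain ⟨g, -, hg⟩ := Set.Finite.exists_injOn_of_encard_le
            (Set.toFinite (D.graph.neighborSet t)) (t := (Set.univ : Set (Fin 3))) (by
              rw [← (Set.toFinite (D.graph.neighborSet t)).cast_ncard_eq, show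
                (D.graph.neighborSet t).ncard = 3 from ht]
              simp)
          exact ⟨g, fun _ => hg⟩
        · exact ⟨fun _ => 0, fun h => absurd h ht⟩
      choose g hg using key
      exact ⟨⟨⟨D.toDiagram, g, hg, fun _ => 1⟩, D.connected⟩, rfl⟩
  choose r hr using h
  exact ⟨⟨r, hr⟩⟩

/-- The anomaly `α = ∑ f_Γ / (2 |Γ|) [Γ]` in `𝒜(ℝ) = ∏ₙ 𝒜ₙ(ℝ)`, the sum being over the
isomorphism classes of connected diagrams, represented and oriented by the choice `r`. -/
noncomputable def anomaly (r : Choice) : (n : ℕ) → DiagramSpace n :=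
  fun n => ∑ c : DW n,
    ((r.rep n c).f / (2 * ((r.rep n c).numAut : ℝ))) • (r.rep n c).cls

end ConfInt

/-!
A connected diagram of degree three either contains a triangle or is the tree with two trivalent
vertices and four legs.

If there is a triangle, its three edges are coplanar and their displacements sum to zero, so a
normal to their plane, put at the three edges, is killed by the differential of the map to the
directions: the form vanishes identically (`ConnOriented.det_formMatrix_of_triangle`).

Let `a`, `b` be the univalent vertices at one end of a tree and `c`, `d` those at the other one.
One may assume that `a` is the first of the four on the line and that `c` precedes `d`. This leaves
three trees, with the orders `a < b < c < d` (separated), `a < c < b < d` (crossed) and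
`a < c < d < b` (nested). Two STU relations, which resolve the same leg-decorated triangle in two
ways, and the IHX relation at the interior edge of the separated tree give `[crossed] = 0`
(`cls_crossed`) and `[separated] = -[nested]` (`cls_separated`). A tree has no nontrivial
automorphism, and the signs coming from its orientation cancel in `f • [Γ]`. So it remains to prove
that the integrals of the separated and of the nested tree converge and are equal.

The determinant defining the form is computed in `treeMatrix_det`; up to a sign that does not depend
on the order of the legs, it is nonnegative on the configurations of each tree. The map to the
directions of the five edges is injective where the form does not vanish, so that the integral is
proportional to the volume of the image of this set. To stay with Lebesgue measures, the spheres are replaced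
by spherical shells: integrating the indicator function of the shell `1 < ‖v‖ < 2` along a ray
produces the factor `‖v‖⁻³` of the form, and the integral becomes the volume `dirVolume` of a set of
quintuples of vectors in the shell (`lintegral_normalized`). This volume is finite, whence the
absolute convergence. Finally the image is described by the signs of some determinants of triples
of edges (`treeRegion_separated_iff`, `treeRegion_nested_iff`), and the two lists of signs are
exchanged by a permutation of the five vectors together with two reflections
(`nestedSigns_iff_separatedSigns`). So the two volumes are the same (`dirVolume_nested`), and the two
nonzero terms of the anomaly cancel.
-/

namespace ConfInt

section Determinant

open Matrix
open scoped Kronecker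

/-! ### The determinant of the tree with four legs -/

/-- The rows of the matrix of a tree: the components of the displacements of the five edges (the
four legs, and the edge between the trivalent vertices), then the three conormals. -/
abbrev TreeRow : Type := Fin 5 × Fin 3 ⊕ Fin 3

/-- The columns of the matrix of a tree: the lengths of the five edges, the abscissas of the four
univalent vertices, and the components of three vectors, namely the positions of the two trivalent
vertices and the direction of the axis. -/
abbrev TreeCol : Type := (Fin 5 ⊕ Fin 4) ⊕ Fin 3 × Fin 3

/-- The coordinates, with respect to the vectors `s`, `p`, `q`, of the edges of the tree with axis
directed by `s`, univalent vertices at the abscissas `0`, `xb` (joined to `p`), `xc`, `xd` (joined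
to `q`) and trivalent vertices at `p`, `q`. -/
def treeEdgeCoord (xb xc xd : ℝ) : Fin 5 → Fin 3 → ℝ :=
  ![![0, -1, 0], ![xb, -1, 0], ![xc, 0, -1], ![xd, 0, -1], ![0, -1, 1]]

/-- The coefficients with which the velocities of `p`, `q` and `s` enter those of the edges. -/
def treeIncidence (xb xc xd : ℝ) : Matrix (Fin 5) (Fin 3) ℝ :=
  Matrix.of ![![-1, 0, 0], ![-1, 0, xb], ![0, -1, xc], ![0, -1, xd], ![-1, 1, 0]]

/-- The columns of the lengths and of the abscissas, in the coordinates with respect to `s`, `p`,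
`q`. -/
def treeScaleLeg (xb xc xd : ℝ) : Matrix (Fin 5 × Fin 3) (Fin 5 ⊕ Fin 4) ℝ :=
  Matrix.of fun r c => Sum.elim (fun k => if r.1 = k then treeEdgeCoord xb xc xd r.1 r.2 else 0)
    (fun l => if r.1 = l.castSucc ∧ r.2 = 0 then 1 else 0) c

/-- The three conormals on the lengths and the abscissas: the normal to the sphere of the axes,
the position of the first univalent vertex, the radial covector. -/
def treeBottomLeft (xb xc xd : ℝ) : Matrix (Fin 3) (Fin 5 ⊕ Fin 4) ℝ :=
  Matrix.of ![Sum.elim 0 0, Sum.elim 0 ![1, 0, 0, 0], Sum.elim 0 ![0, xb, xc, xd]]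

/-- The three conormals on the velocities of `p`, `q` and `s`. -/
def treeBottomRight (s p q : Fin 3 → ℝ) : Matrix (Fin 3) (Fin 3 × Fin 3) ℝ :=
  Matrix.of ![fun c => ![0, 0, s] c.1 c.2, 0, fun c => ![p, q, 0] c.1 c.2]

/-- The matrix with columns `s`, `p`, `q`. -/
def treeFrame (s p q : Fin 3 → ℝ) : Matrix (Fin 3) (Fin 3) ℝ := (Matrix.of ![s, p, q])ᵀ

/-- The bordered matrix of the volume form for a tree. -/
def treeMatrix (xb xc xd : ℝ) (s p q : Fin 3 → ℝ) : Matrix TreeRow TreeCol ℝ :=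
  fromBlocks (((1 : Matrix (Fin 5) (Fin 5) ℝ) ⊗ₖ treeFrame s p q) * treeScaleLeg xb xc xd)
    (treeIncidence xb xc xd ⊗ₖ (1 : Matrix (Fin 3) (Fin 3) ℝ))
    (treeBottomLeft xb xc xd) (treeBottomRight s p q)

/-- The matrix of a tree, with all displacements and velocities expressed in the basis `s`, `p`,
`q`. -/
def treeReduced (xb xc xd : ℝ) (s p q : Fin 3 → ℝ) : Matrix TreeRow TreeCol ℝ :=
  fromBlocks (treeScaleLeg xb xc xd)
    (treeIncidence xb xc xd ⊗ₖ (1 : Matrix (Fin 3) (Fin 3) ℝ))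
    (treeBottomLeft xb xc xd)
    (treeBottomRight s p q * ((1 : Matrix (Fin 3) (Fin 3) ℝ) ⊗ₖ treeFrame s p q))

theorem treeMatrix_mul_frame (xb xc xd : ℝ) (s p q : Fin 3 → ℝ) :
    treeMatrix xb xc xd s p q *
        (fromBlocks 1 0 0 ((1 : Matrix (Fin 3) (Fin 3) ℝ) ⊗ₖ treeFrame s p q) :
          Matrix TreeCol TreeCol ℝ) =
      (fromBlocks ((1 : Matrix (Fin 5) (Fin 5) ℝ) ⊗ₖ treeFrame s p q) 0 0 1 :
          Matrix TreeRow TreeRow ℝ) * treeReduced xb xc xd s p q := by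
  rw [treeMatrix, treeReduced, fromBlocks_multiply, fromBlocks_multiply, ← mul_kronecker_mul,
    ← mul_kronecker_mul]
  simp

theorem treeMatrix_det_frame (e : TreeCol ≃ TreeRow) (xb xc xd : ℝ) (s p q : Fin 3 → ℝ)
    (hD : (treeFrame s p q).det ≠ 0) :
    ((treeMatrix xb xc xd s p q).submatrix id e.symm).det =
      (treeFrame s p q).det ^ 2 * ((treeReduced xb xc xd s p q).submatrix id e.symm).det := by
  have h : Matrix.det (Matrix.submatrix _ id e.symm) = Matrix.det (Matrix.submatrix _ id e.symm) :=
    congrArg (fun M => (M.submatrix id e.symm).det) (treeMatrix_mul_frame xb xc xd s p q)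
  rw [← submatrix_mul_equiv _ _ id e.symm e.symm, ← submatrix_mul_equiv _ _ id (Equiv.refl _) e.symm,
    det_mul, det_mul, det_submatrix_equiv_self] at h
  simp only [Equiv.coe_refl, submatrix_id_id, det_fromBlocks_zero₂₁, det_one, det_kronecker,
    one_pow, one_mul, mul_one, Fintype.card_fin] at h
  have h3 : (treeFrame s p q).det ^ 3 ≠ 0 := pow_ne_zero _ hD
  apply mul_right_cancel₀ h3
  rw [h]; ring

/-- An order of the columns suited to Gaussian elimination. -/
def treeColPos : TreeCol → Fin 18
  | Sum.inl (Sum.inl k) => ![3, 4, 5, 6, 17] k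
  | Sum.inl (Sum.inr l) => ![16, 0, 1, 2] l
  | Sum.inr (j, m) => ![![10, 7, 11], ![9, 12, 8], ![15, 13, 14]] j m

/-- An order of the rows suited to Gaussian elimination. -/
def treeRowPos : TreeRow → Fin 18
  | Sum.inl (k, m) => ![![10, 3, 11], ![0, 4, 14], ![1, 12, 5], ![2, 13, 6], ![9, 7, 8]] k m
  | Sum.inr i => ![15, 16, 17] i

/-- The bijection `treeColPos`. -/
noncomputable def treeColEquiv : TreeCol ≃ Fin 18 := Equiv.ofBijective treeColPos (by decide)

/-- The bijection `treeRowPos`. -/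
noncomputable def treeRowEquiv : TreeRow ≃ Fin 18 := Equiv.ofBijective treeRowPos (by decide)

/-- The Gaussian elimination of the reduced matrix: row `j` contains the coefficients of a
combination of the columns of the reduced matrix that vanishes on the rows before `j`. -/
def treeElim (xb xc xd : ℝ) : Matrix (Fin 18) (Fin 18) ℝ := Matrix.of <|
   ![![1, 0, 0, 0, 0, 0, 0, 0, 0, 0, 0, 0, 0, 0, 0, 0, 0, 0],
    ![0, 1, 0, 0, 0, 0, 0, 0, 0, 0, 0, 0, 0, 0, 0, 0, 0, 0],
    ![0, 0, 1, 0, 0, 0, 0, 0, 0, 0, 0, 0, 0, 0, 0, 0, 0, 0],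
    ![0, 0, 0, 1, 0, 0, 0, 0, 0, 0, 0, 0, 0, 0, 0, 0, 0, 0],
    ![-xb, 0, 0, 0, 1, 0, 0, 0, 0, 0, 0, 0, 0, 0, 0, 0, 0, 0],
    ![0, -xc, 0, 0, 0, 1, 0, 0, 0, 0, 0, 0, 0, 0, 0, 0, 0, 0],
    ![0, 0, -xd, 0, 0, 0, 1, 0, 0, 0, 0, 0, 0, 0, 0, 0, 0, 0],
    ![xb, 0, 0, -1, -1, 0, 0, 1, 0, 0, 0, 0, 0, 0, 0, 0, 0, 0],
    ![0, xc, xd, 0, 0, -1, -1, 0, 1, 0, 0, 0, 0, 0, 0, 0, 0, 0],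
    ![0, 1, 1, 0, 0, 0, 0, 0, 0, 1, 0, 0, 0, 0, 0, 0, 0, 0],
    ![1, 1, 1, 0, 0, 0, 0, 0, 0, 1, 1, 0, 0, 0, 0, 0, 0, 0],
    ![0, xc, xd, 0, 0, -1, -1, 0, 1, 0, 0, 1, 0, 0, 0, 0, 0, 0],
    ![xb, 0, 0, -1, -1, 0, 0, 1, 0, 0, 0, 0, 1, 0, 0, 0, 0, 0],
    ![-xb*xb+xb*xc, 0, 0, -xc, xb-xc, 0, 0, xc, 0, 0, 0, 0, xc, 1, 0, 0, 0, 0],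
    ![0, -xc*xc, -xd*xd, 0, 0, xc, xd, 0, 0, 0, 0, 0, 0, 0, 1, 0, 0, 0],
    ![-xb, -xc, -xd, 0, 0, 0, 0, 0, 0, 0, 0, 0, 0, 0, 0, 1, 0, 0],
    ![1, 1, 1, 0, 0, 0, 0, 0, 0, 1, 1, 0, 0, 0, 0, 0, 1, 0],
    ![xb, xc, xd, -1, -1, -1, -1, 1, 1, 0, 0, 0, 0, 0, 0, 0, 0, -1]]

theorem treeElim_det (xb xc xd : ℝ) : (treeElim xb xc xd).det = -1 := by
  rw [det_of_isLowerTriangular]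
  · simp [treeElim, Fin.prod_univ_succ]
  · intro i j h
    have h' : i < j := h
    clear h
    fin_cases i <;> fin_cases j <;> first | rfl | (exact absurd h' (by decide))

theorem treeReduced_mulVec_top (xb xc xd : ℝ) (s p q : Fin 3 → ℝ) (z : TreeCol → ℝ) (k : Fin 5)
    (m : Fin 3) :
    (treeReduced xb xc xd s p q *ᵥ z) (Sum.inl (k, m)) =
      treeEdgeCoord xb xc xd k m * z (Sum.inl (Sum.inl k)) +
        (if m = 0 then ![z (Sum.inl (Sum.inr 0)), z (Sum.inl (Sum.inr 1)), z (Sum.inl (Sum.inr 2)),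
          z (Sum.inl (Sum.inr 3)), 0] k else 0) +
        ∑ j, treeIncidence xb xc xd k j * z (Sum.inr (j, m)) := by
  have h : ∀ w : Fin 4 → ℝ, ∑ l : Fin 4, (if k = l.castSucc then w l else 0) =
      ![w 0, w 1, w 2, w 3, 0] k := by
    intro w
    rw [Fin.sum_univ_four]
    fin_cases k <;> simp [Fin.ext_iff]
  rw [← h fun l => z (Sum.inl (Sum.inr l))]
  simp [treeReduced, mulVec, dotProduct, treeScaleLeg, fromBlocks, Fintype.sum_prod_type,
    kroneckerMap_apply, Matrix.one_apply, ite_and, ite_mul, mul_ite, Finset.sum_ite_eq]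
  split_ifs <;> simp

theorem treeReduced_mulVec_bottom (xb xc xd : ℝ) (s p q : Fin 3 → ℝ) (z : TreeCol → ℝ)
    (i : Fin 3) :
    (treeReduced xb xc xd s p q *ᵥ z) (Sum.inr i) =
      ![0, z (Sum.inl (Sum.inr 0)), xb * z (Sum.inl (Sum.inr 1)) + xc * z (Sum.inl (Sum.inr 2)) +
          xd * z (Sum.inl (Sum.inr 3))] i +
        ∑ m, ![(s ⬝ᵥ ![s, p, q] m) * z (Sum.inr (2, m)), 0,
          (p ⬝ᵥ ![s, p, q] m) * z (Sum.inr (0, m)) + (q ⬝ᵥ ![s, p, q] m) * z (Sum.inr (1, m))] i := by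
  fin_cases i <;>
  simp [treeReduced, mulVec, dotProduct, fromBlocks, Fintype.sum_prod_type, treeBottomLeft,
    treeBottomRight, treeFrame, Matrix.vecMul, kroneckerMap_apply, Matrix.one_apply,
    Fin.sum_univ_succ] <;> ring

set_option maxHeartbeats 2000000 in
theorem treeReduced_elim_top (xb xc xd : ℝ) (s p q : Fin 3 → ℝ) (k : Fin 5) (m : Fin 3)
    (j : Fin 18) (h : treeRowPos (Sum.inl (k, m)) < j) :
    (treeReduced xb xc xd s p q *ᵥ fun c => treeElim xb xc xd j (treeColPos c))
      (Sum.inl (k, m)) = 0 := by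
  rw [treeReduced_mulVec_top]
  fin_cases k <;> fin_cases m <;> fin_cases j <;>
  first
  | exact absurd h (by decide)
  | (simp [treeEdgeCoord, treeIncidence, treeElim, treeColPos, Fin.sum_univ_succ]; done)
  | (simp [treeEdgeCoord, treeIncidence, treeElim, treeColPos, Fin.sum_univ_succ]; ring1)

theorem treeReduced_elim_bottom (xb xc xd : ℝ) (s p q : Fin 3 → ℝ) (i : Fin 3)
    (j : Fin 18) (h : treeRowPos (Sum.inr i) < j) :
    (treeReduced xb xc xd s p q *ᵥ fun c => treeElim xb xc xd j (treeColPos c)) (Sum.inr i) = 0 := by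
  rw [treeReduced_mulVec_bottom]
  fin_cases i <;> fin_cases j <;>
  first
  | exact absurd h (by decide)
  | simp [treeElim, treeColPos, Fin.sum_univ_succ]

theorem treeReduced_elim_diag (xb xc xd : ℝ) (s p q : Fin 3 → ℝ) (r : TreeRow) :
    (treeReduced xb xc xd s p q *ᵥ fun c => treeElim xb xc xd (treeRowPos r) (treeColPos c)) r =
      Sum.elim (fun r => ![![-1, -1, -1], ![1, -1, xb], ![1, -1, -1], ![1, xd - xc, -1],
        ![1, -1, 1]] r.1 r.2)
        ![s ⬝ᵥ s, 1, xb ^ 2 + xc ^ 2 + xd ^ 2 + p ⬝ᵥ p + q ⬝ᵥ q] r := by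
  rcases r with ⟨k, m⟩ | i
  · rw [treeReduced_mulVec_top]
    fin_cases k <;> fin_cases m <;>
    first
    | (simp [treeEdgeCoord, treeIncidence, treeElim, treeColPos, treeRowPos, Fin.sum_univ_succ]; done)
    | (simp [treeEdgeCoord, treeIncidence, treeElim, treeColPos, treeRowPos, Fin.sum_univ_succ]; ring1)
  · rw [treeReduced_mulVec_bottom]
    fin_cases i <;> simp [treeElim, treeColPos, treeRowPos, Fin.sum_univ_succ]
    ring

theorem treeReduced_det (xb xc xd : ℝ) (s p q : Fin 3 → ℝ) :
    ((treeReduced xb xc xd s p q).submatrix treeRowEquiv.symm treeColEquiv.symm).det =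
      - (xb * (xd - xc) * (s ⬝ᵥ s) * (xb ^ 2 + xc ^ 2 + xd ^ 2 + p ⬝ᵥ p + q ⬝ᵥ q)) := by
  have hK : ∀ r j, ((treeReduced xb xc xd s p q).submatrix treeRowEquiv.symm treeColEquiv.symm *
      (treeElim xb xc xd)ᵀ) (treeRowEquiv r) j =
      (treeReduced xb xc xd s p q *ᵥ fun c => treeElim xb xc xd j (treeColPos c)) r := by
    intro r j
    simp only [Matrix.mul_apply, submatrix_apply, Equiv.symm_apply_apply, transpose_apply, mulVec,
      dotProduct]
    exact Fintype.sum_equiv treeColEquiv.symm _ _ fun i => by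
      rw [show treeColPos (treeColEquiv.symm i) = i from treeColEquiv.apply_symm_apply i]
  have h : ((treeReduced xb xc xd s p q).submatrix treeRowEquiv.symm treeColEquiv.symm *
      (treeElim xb xc xd)ᵀ).det =
      xb * (xd - xc) * (s ⬝ᵥ s) * (xb ^ 2 + xc ^ 2 + xd ^ 2 + p ⬝ᵥ p + q ⬝ᵥ q) := by
    rw [det_of_isLowerTriangular, ← treeRowEquiv.prod_comp]
    · simp only [hK]
      simp_rw [show ∀ r, treeRowEquiv r = treeRowPos r from fun _ => rfl, treeReduced_elim_diag]
      simp [Fintype.prod_sum_type, Fintype.prod_prod_type, Fin.prod_univ_succ]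
      ring
    · intro i j hij
      obtain ⟨r, rfl⟩ := treeRowEquiv.surjective i
      rw [hK]
      rcases r with ⟨k, m⟩ | i
      · exact treeReduced_elim_top _ _ _ _ _ _ _ _ _ hij
      · exact treeReduced_elim_bottom _ _ _ _ _ _ _ _ hij
  rw [det_mul, det_transpose, treeElim_det] at h
  linarith

/-- When `s`, `p`, `q` are coplanar, weights on the edges that are in equilibrium at the trivalent
vertices and on the axis, multiplied by a normal to the plane, give a vector in the kernel of the
transpose. -/
theorem treeMatrix_det_of_frame_singular (e : TreeCol ≃ TreeRow) (xb xc xd : ℝ) (hb : xb ≠ 0)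
    (s p q : Fin 3 → ℝ) (hD : (treeFrame s p q).det = 0) :
    ((treeMatrix xb xc xd s p q).submatrix id e.symm).det = 0 := by
  obtain ⟨ν, hν0, hν⟩ := Matrix.exists_vecMul_eq_zero_iff.2 hD
  obtain ⟨m, hm⟩ := Function.ne_iff.1 hν0
  set θ : Fin 5 → ℝ := ![-(xd - xc), xd - xc, xb, -xb, 0] with hθ
  set v : TreeRow → ℝ := Sum.elim (fun r => θ r.1 * ν r.2) 0 with hv
  have key : v ᵥ* treeMatrix xb xc xd s p q = 0 := by
    have h1 : (fun r : Fin 5 × Fin 3 => θ r.1 * ν r.2) ᵥ*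
        ((1 : Matrix (Fin 5) (Fin 5) ℝ) ⊗ₖ treeFrame s p q) = 0 := by
      ext ⟨k, j⟩
      have := congrFun hν j
      simp only [vecMul, dotProduct, Pi.zero_apply] at this
      simp [vecMul, dotProduct, Fintype.sum_prod_type, kroneckerMap_apply, Matrix.one_apply,
        mul_assoc, ← Finset.mul_sum, this]
    have h2 : (fun r : Fin 5 × Fin 3 => θ r.1 * ν r.2) ᵥ*
        (treeIncidence xb xc xd ⊗ₖ (1 : Matrix (Fin 3) (Fin 3) ℝ)) = 0 := by
      ext ⟨k, j⟩
      simp [vecMul, dotProduct, Fintype.sum_prod_type, kroneckerMap_apply, Matrix.one_apply]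
      fin_cases k <;> simp [Fin.sum_univ_succ, treeIncidence, hθ] <;> ring
    rw [hv, treeMatrix, vecMul_fromBlocks, ← vecMul_vecMul]
    simp only [Sum.elim_comp_inl, Sum.elim_comp_inr]
    rw [h1, h2]
    simp
  refine Matrix.exists_vecMul_eq_zero_iff.1 ⟨v, fun h => ?_, ?_⟩
  · have := congrFun h (Sum.inl (2, m))
    simp [hv, hθ, hb] at this
    exact hm this
  · ext r
    exact congrFun key (e.symm r)

/-- The bijection between the columns and the rows given by the elimination orders. -/
noncomputable def treeMatching : TreeCol ≃ TreeRow := treeColEquiv.trans treeRowEquiv.symm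

theorem treeMatrix_det (xb xc xd : ℝ) (hb : xb ≠ 0) (s p q : Fin 3 → ℝ) :
    ((treeMatrix xb xc xd s p q).submatrix id treeMatching.symm).det =
      - (xb * (xd - xc) * (treeFrame s p q).det ^ 2 * (s ⬝ᵥ s) *
        (xb ^ 2 + xc ^ 2 + xd ^ 2 + p ⬝ᵥ p + q ⬝ᵥ q)) := by
  by_cases hD : (treeFrame s p q).det = 0
  · rw [treeMatrix_det_of_frame_singular _ _ _ _ hb _ _ _ hD, hD]
    ring
  · rw [treeMatrix_det_frame _ _ _ _ _ _ _ hD]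
    have h := treeReduced_det xb xc xd s p q
    rw [← det_submatrix_equiv_self treeRowEquiv] at h
    have h2 : ((treeReduced xb xc xd s p q).submatrix treeRowEquiv.symm treeColEquiv.symm).submatrix
        treeRowEquiv treeRowEquiv = (treeReduced xb xc xd s p q).submatrix id treeMatching.symm := by
      ext i j
      simp [treeMatching]
    rw [h2] at h
    rw [h]
    ring

end Determinant

open MeasureTheory Set
open scoped ENNReal

/-! ### Radial integrals -/

/-- The indicator function of the spherical shell `1 < ‖v‖ < 2`. -/
noncomputable def shell (v : E3) : ℝ≥0∞ := open Classical in if 1 < ‖v‖ ∧ ‖v‖ < 2 then 1 else 0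

/-- The inverse cube `‖v‖⁻³` of the norm, with the value `0` at `v = 0`. -/
noncomputable def invCube (v : E3) : ℝ≥0∞ := ENNReal.ofReal (‖v‖ ^ 3)⁻¹

/-- The determinant of three vectors. -/
noncomputable def triple (u v w : E3) : ℝ := (treeFrame u v w).det

theorem triple_eq (u v w : E3) : triple u v w =
    u 0 * (v 1 * w 2 - v 2 * w 1) - u 1 * (v 0 * w 2 - v 2 * w 0) + u 2 * (v 0 * w 1 - v 1 * w 0) := by
  rw [triple, treeFrame, Matrix.det_transpose, Matrix.det_fin_three]
  simp
  ring

@[fun_prop]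
theorem measurable_triple {α : Type*} [MeasurableSpace α] {f g h : α → E3} (hf : Measurable f)
    (hg : Measurable g) (hh : Measurable h) : Measurable fun x => triple (f x) (g x) (h x) := by
  simp only [triple_eq]
  fun_prop

@[fun_prop]
theorem measurable_shell : Measurable shell := by
  unfold shell
  refine Measurable.ite ?_ measurable_const measurable_const
  exact (measurableSet_lt measurable_const measurable_norm).inter
    (measurableSet_lt measurable_norm measurable_const)

@[fun_prop]
theorem measurable_invCube : Measurable invCube := by
  unfold invCube
  fun_prop

/-- The integral of `t ^ 2` over the interval `(1, 2)`. -/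
noncomputable def shellMass : ℝ≥0∞ := ENNReal.ofReal (7 / 3)

theorem shellMass_ne_zero : shellMass ≠ 0 := by simp [shellMass]

theorem shellMass_ne_top : shellMass ≠ ∞ := by simp [shellMass]

/-- The mass that the shell puts on a ray is a multiple of the inverse cube: this is how the factors
of the volume forms of the spheres of directions are replaced by Lebesgue measures. -/
theorem lintegral_shell_smul (v : E3) :
    ∫⁻ t in Ioi (0 : ℝ), ENNReal.ofReal (t ^ 2) * shell (t • v) = shellMass * invCube v := by
  by_cases hv : v = 0
  · simp [hv, shell, invCube, show ¬ ((1 : ℝ) < 0) by norm_num]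
  have hn : 0 < ‖v‖ := norm_pos_iff.2 hv
  have h1 : ∀ t ∈ Ioi (0 : ℝ), ENNReal.ofReal (t ^ 2) * shell (t • v) =
      (Ioo (1 / ‖v‖) (2 / ‖v‖)).indicator (fun t => ENNReal.ofReal (t ^ 2)) t := by
    intro t ht
    have ht : 0 < t := ht
    simp only [shell, norm_smul, Real.norm_eq_abs, abs_of_pos ht, indicator, mem_Ioo,
      div_lt_iff₀ hn, lt_div_iff₀ hn]
    split_ifs <;> simp
  rw [setLIntegral_congr_fun measurableSet_Ioi h1, setLIntegral_indicator measurableSet_Ioo,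
    inter_eq_left.2 (show Ioo (1 / ‖v‖) (2 / ‖v‖) ⊆ Ioi 0 from
      fun t ht => lt_trans (by positivity) ht.1)]
  have hle : 1 / ‖v‖ ≤ 2 / ‖v‖ := by gcongr; norm_num
  rw [← ofReal_integral_eq_lintegral_ofReal
    (((continuous_pow 2).integrableOn_Icc).mono_set Ioo_subset_Icc_self)
    (Filter.Eventually.of_forall fun t => sq_nonneg t), ← integral_Ioc_eq_integral_Ioo,
    ← intervalIntegral.integral_of_le hle, integral_pow, shellMass, invCube,
    ← ENNReal.ofReal_mul (by norm_num), div_pow, div_pow]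
  congr 1
  field_simp
  ring

/-- The same integral as `lintegral_shell_smul`, after `t ↦ t⁻¹`. -/
theorem lintegral_shell_inv_smul (v : E3) :
    ∫⁻ t in Ioi (0 : ℝ), ENNReal.ofReal (t ^ 4)⁻¹ * shell (t⁻¹ • v) = shellMass * invCube v := by
  by_cases hv : v = 0
  · simp [hv, shell, invCube, show ¬ ((1 : ℝ) < 0) by norm_num]
  have hn : 0 < ‖v‖ := norm_pos_iff.2 hv
  have h1 : ∀ t ∈ Ioi (0 : ℝ), ENNReal.ofReal (t ^ 4)⁻¹ * shell (t⁻¹ • v) =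
      (Ioo (‖v‖ / 2) ‖v‖).indicator (fun t => ENNReal.ofReal (t ^ 4)⁻¹) t := by
    intro t ht
    have ht : 0 < t := ht
    have e : ‖t⁻¹ • v‖ = ‖v‖ / t := by
      rw [norm_smul, norm_inv, Real.norm_eq_abs, abs_of_pos ht]; field_simp
    simp only [shell, e, indicator, mem_Ioo, lt_div_iff₀ ht, div_lt_iff₀ ht, one_mul,
      div_lt_iff₀ (zero_lt_two' ℝ), mul_comm t 2, and_comm]
    split_ifs <;> simp
  rw [setLIntegral_congr_fun measurableSet_Ioi h1, setLIntegral_indicator measurableSet_Ioo,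
    inter_eq_left.2 (show Ioo (‖v‖ / 2) ‖v‖ ⊆ Ioi 0 from
      fun t ht => lt_trans (by positivity) ht.1)]
  have hle : ‖v‖ / 2 ≤ ‖v‖ := by linarith
  have hc : ContinuousOn (fun t : ℝ => (t ^ 4)⁻¹) (Icc (‖v‖ / 2) ‖v‖) := by
    refine ContinuousOn.inv₀ (by fun_prop) fun t ht => ?_
    have : 0 < t := lt_of_lt_of_le (by positivity) ht.1
    positivity
  have hint : ∫ t in (‖v‖ / 2)..‖v‖, (t ^ 4)⁻¹ = 7 / 3 * (‖v‖ ^ 3)⁻¹ := by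
    have h0 : (0 : ℝ) ∉ uIcc (‖v‖ / 2) ‖v‖ := by
      rw [uIcc_of_le hle]
      intro h
      have := h.1
      linarith
    have := integral_zpow (a := ‖v‖ / 2) (b := ‖v‖) (n := -4) (Or.inr ⟨by norm_num, h0⟩)
    have e : ∀ t : ℝ, (t ^ 4)⁻¹ = t ^ (-4 : ℤ) := fun t => by
      rw [zpow_neg]; norm_cast
    simp only [e]
    rw [this]
    have e3 : ∀ t : ℝ, t ^ (-4 + 1 : ℤ) = (t ^ 3)⁻¹ := fun t => by
      rw [show (-4 + 1 : ℤ) = -3 by norm_num, zpow_neg]; norm_cast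
    rw [e3, e3]
    field_simp
    norm_num
  rw [← ofReal_integral_eq_lintegral_ofReal
    ((hc.integrableOn_Icc).mono_set Ioo_subset_Icc_self)
    (Filter.Eventually.of_forall fun t => by positivity), ← integral_Ioc_eq_integral_Ioo,
    ← intervalIntegral.integral_of_le hle, hint, shellMass, invCube,
    ← ENNReal.ofReal_mul (by norm_num)]

/-- Integration in polar coordinates. -/
theorem lintegral_polar {ι : Type} [Fintype ι] [Nonempty ι]
    (f : EuclideanSpace ℝ ι → ℝ≥0∞) (hf : Measurable f) :
    ∫⁻ x, f x = ∫⁻ s, ∫⁻ r in Ioi (0 : ℝ),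
      ENNReal.ofReal (r ^ (Fintype.card ι - 1)) * f (r • (s : EuclideanSpace ℝ ι)) ∂volume
        ∂(sphereMeasure ι) := by
  have hm := (volume : Measure (EuclideanSpace ℝ ι)).measurePreserving_homeomorphUnitSphereProd
  have h0 : MeasurableSet ({0}ᶜ : Set (EuclideanSpace ℝ ι)) := (measurableSet_singleton _).compl
  calc ∫⁻ x, f x = ∫⁻ x in ({0}ᶜ : Set (EuclideanSpace ℝ ι)), f x := by
        rw [restrict_compl_singleton]
    _ = ∫⁻ x : ({0}ᶜ : Set (EuclideanSpace ℝ ι)), f x ∂(volume.comap Subtype.val) :=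
        (lintegral_subtype_comap h0 f).symm
    _ = ∫⁻ p, f ((p.2 : ℝ) • (p.1 : EuclideanSpace ℝ ι))
          ∂((sphereMeasure ι).prod (Measure.volumeIoiPow (Module.finrank ℝ (EuclideanSpace ℝ ι) - 1))) := by
        rw [← hm.lintegral_comp_emb (Homeomorph.measurableEmbedding _)]
        refine lintegral_congr fun x => ?_
        congr 1
        conv_lhs => rw [← (homeomorphUnitSphereProd (EuclideanSpace ℝ ι)).symm_apply_apply x]
        simp [smul_inv_smul₀ (norm_ne_zero_iff.2 x.2)]
    _ = _ := by
        rw [lintegral_prod _ (by fun_prop)]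
        refine lintegral_congr fun s => ?_
        rw [Measure.volumeIoiPow, lintegral_withDensity_eq_lintegral_mul _ (by fun_prop) (by fun_prop)]
        simp only [Pi.mul_apply, finrank_euclideanSpace]
        exact lintegral_subtype_comap measurableSet_Ioi (fun r : ℝ =>
          ENNReal.ofReal (r ^ (Fintype.card ι - 1)) * f (r • (s : EuclideanSpace ℝ ι)))

/-! ### The coefficients of the last two legs -/

theorem lintegral_fin_succ {X : Type*} [MeasureSpace X] [SigmaFinite (volume : Measure X)] {n : ℕ}
    (F : (Fin (n + 1) → X) → ℝ≥0∞) (hF : Measurable F) :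
    ∫⁻ y, F y = ∫⁻ x : X, ∫⁻ y : Fin n → X, F (Fin.cons x y) := by
  have h := (volume_preserving_piFinSuccAbove (fun _ : Fin (n + 1) => X) 0).symm
  rw [← h.lintegral_comp_emb (MeasurableEquiv.measurableEmbedding _), Measure.volume_eq_prod,
    lintegral_prod _ (by fun_prop)]
  simp only [MeasurableEquiv.piFinSuccAbove_symm_apply, Fin.insertNthEquiv_zero]
  rfl

theorem lintegral_fin_zero {X : Type*} [MeasureSpace X] [SigmaFinite (volume : Measure X)]
    (F : (Fin 0 → X) → ℝ≥0∞) : ∫⁻ y, F y = F ![] := by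
  rw [volume_pi, Measure.pi_of_empty _ ![], lintegral_dirac]

theorem lintegral_fin_three (F : (Fin 3 → ℝ) → ℝ≥0∞) (hF : Measurable F) :
    ∫⁻ y, F y = ∫⁻ a, ∫⁻ b, ∫⁻ c, F ![a, b, c] := by
  rw [lintegral_fin_succ F hF]
  refine lintegral_congr fun a => ?_
  rw [lintegral_fin_succ _ (by fun_prop)]
  refine lintegral_congr fun b => ?_
  rw [lintegral_fin_succ _ (by fun_prop)]
  refine lintegral_congr fun c => ?_
  rw [lintegral_fin_zero]
  rfl

theorem lintegral_fin_four (F : (Fin 4 → ℝ) → ℝ≥0∞) (hF : Measurable F) :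
    ∫⁻ y, F y = ∫⁻ a, ∫⁻ b, ∫⁻ c, ∫⁻ d, F ![a, b, c, d] := by
  rw [lintegral_fin_succ F hF]
  refine lintegral_congr fun a => ?_
  rw [lintegral_fin_three _ (by fun_prop)]
  rfl

/-- Let `a`, `b`, `e` be vectors, and consider the tree with the first univalent vertex at the
origin, the trivalent vertices at `p = -α a` and `p + e`, and the second univalent vertex at
`p + β b`, whose abscissa is taken as the unit. The vector from `p + e` to the point of the axis
with abscissa `u` is `α (1 - u) a + β u b - e`. This map takes `(α, β, u, v)` to the coefficients
of `a` and `b` in that vector for `u`, and then for `v`. -/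
def chordMap (y : Fin 4 → ℝ) : Fin 4 → ℝ :=
  ![y 0 * (1 - y 2), y 1 * y 2, y 0 * (1 - y 3), y 1 * y 3]

/-- The Jacobian matrix of `chordMap`. -/
def chordJacobian (y : Fin 4 → ℝ) : Matrix (Fin 4) (Fin 4) ℝ :=
  Matrix.of ![![1 - y 2, 0, - y 0, 0], ![0, y 2, y 1, 0], ![1 - y 3, 0, 0, - y 0], ![0, y 3, 0, y 1]]

theorem det_chordJacobian (y : Fin 4 → ℝ) : (chordJacobian y).det = y 0 * y 1 * (y 2 - y 3) := by
  simp [chordJacobian, Matrix.det_succ_row_zero, Fin.sum_univ_succ, Fin.succAbove]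
  ring

theorem hasFDerivAt_chordMap (y : Fin 4 → ℝ) :
    HasFDerivAt chordMap (LinearMap.toContinuousLinearMap (Matrix.toLin' (chordJacobian y))) y := by
  rw [hasFDerivAt_pi']
  have h : ∀ i : Fin 4, HasFDerivAt (fun z : Fin 4 → ℝ => z i)
      (ContinuousLinearMap.proj (R := ℝ) (φ := fun _ : Fin 4 => ℝ) i) y := fun i => hasFDerivAt_apply i y
  intro i
  fin_cases i
  · refine ((h 0).mul ((hasFDerivAt_const (1 : ℝ) y).sub (h 2))).congr_fderiv ?_
    ext v
    simp [chordJacobian, Matrix.toLin'_apply, dotProduct, Fin.sum_univ_succ]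
    ring
  · refine ((h 1).mul (h 2)).congr_fderiv ?_
    ext v
    simp [chordJacobian, Matrix.toLin'_apply, dotProduct, Fin.sum_univ_succ]
    ring
  · refine ((h 0).mul ((hasFDerivAt_const (1 : ℝ) y).sub (h 3))).congr_fderiv ?_
    ext v
    simp [chordJacobian, Matrix.toLin'_apply, dotProduct, Fin.sum_univ_succ]
    ring
  · refine ((h 1).mul (h 3)).congr_fderiv ?_
    ext v
    simp [chordJacobian, Matrix.toLin'_apply, dotProduct, Fin.sum_univ_succ]
    ring

/-- The parameters `(α, β, u, v)` with `α`, `β` positive and `(u, v)` in `O`. -/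
def chordDomain (O : Set (ℝ × ℝ)) : Set (Fin 4 → ℝ) :=
  {y | 0 < y 0 ∧ 0 < y 1 ∧ (y 2, y 3) ∈ O}

theorem measurableSet_chordDomain {O : Set (ℝ × ℝ)} (hO : MeasurableSet O) :
    MeasurableSet (chordDomain O) := by
  have h2 : Measurable fun y : Fin 4 → ℝ => (y 2, y 3) := by fun_prop
  exact (measurableSet_lt measurable_const (measurable_pi_apply 0)).inter
    ((measurableSet_lt measurable_const (measurable_pi_apply 1)).inter (h2 hO))

theorem injOn_chordMap {O : Set (ℝ × ℝ)} (hO : ∀ u ∈ O, u.1 < u.2) :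
    InjOn chordMap (chordDomain O) := by
  rintro y ⟨hy0, hy1, hy⟩ z ⟨hz0, hz1, hz⟩ h
  have hyu := hO _ hy
  have hzu := hO _ hz
  simp only at hyu hzu
  have h0 : y 0 * (1 - y 2) = z 0 * (1 - z 2) := congrFun h 0
  have h1 : y 1 * y 2 = z 1 * z 2 := congrFun h 1
  have h2 : y 0 * (1 - y 3) = z 0 * (1 - z 3) := congrFun h 2
  have h3 : y 1 * y 3 = z 1 * z 3 := congrFun h 3
  have ha : y 0 * (y 3 - y 2) = z 0 * (z 3 - z 2) := by linarith
  have hb : y 1 * (y 3 - y 2) = z 1 * (z 3 - z 2) := by linarith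
  have hc : y 0 * y 1 * (y 3 - y 2) = z 0 * z 1 * (z 3 - z 2) := by
    have e1 : y 0 * y 1 * (y 3 - y 2) = (y 0 * (1 - y 2)) * (y 1 * y 3) - (y 0 * (1 - y 3)) * (y 1 * y 2) := by
      ring
    have e2 : z 0 * z 1 * (z 3 - z 2) = (z 0 * (1 - z 2)) * (z 1 * z 3) - (z 0 * (1 - z 3)) * (z 1 * z 2) := by
      ring
    rw [e1, e2, h0, h1, h2, h3]
  have e1 : y 1 = z 1 := by
    have : z 0 * (z 3 - z 2) * y 1 = z 0 * (z 3 - z 2) * z 1 := by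
      linear_combination hc - y 1 * ha
    exact mul_left_cancel₀ (mul_pos hz0 (sub_pos.2 hzu)).ne' this
  have e0 : y 0 = z 0 := by
    have : z 1 * (z 3 - z 2) * y 0 = z 1 * (z 3 - z 2) * z 0 := by
      linear_combination hc - y 0 * hb
    exact mul_left_cancel₀ (mul_pos hz1 (sub_pos.2 hzu)).ne' this
  rw [e1] at h1 h3
  have e2 := mul_left_cancel₀ hz1.ne' h1
  have e3 := mul_left_cancel₀ hz1.ne' h3
  ext i
  fin_cases i <;> assumption

/-- The image of `chordDomain O` under `chordMap`. -/
def chordImage (O : Set (ℝ × ℝ)) : Set (Fin 4 → ℝ) := chordMap '' chordDomain O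

theorem measurableSet_chordImage {O : Set (ℝ × ℝ)} (hO : MeasurableSet O)
    (hlt : ∀ u ∈ O, u.1 < u.2) : MeasurableSet (chordImage O) :=
  measurable_image_of_fderivWithin (measurableSet_chordDomain hO)
    (fun y _ => (hasFDerivAt_chordMap y).hasFDerivWithinAt) (injOn_chordMap hlt)

theorem lintegral_chordImage {O : Set (ℝ × ℝ)} (hO : MeasurableSet O)
    (hlt : ∀ u ∈ O, u.1 < u.2) (F : (Fin 4 → ℝ) → ℝ≥0∞) :
    ∫⁻ x in chordImage O, F x =
      ∫⁻ y in chordDomain O, ENNReal.ofReal (y 0 * y 1 * (y 3 - y 2)) * F (chordMap y) := by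
  rw [chordImage, lintegral_image_eq_lintegral_abs_det_fderiv_mul _ (measurableSet_chordDomain hO)
    (fun y _ => (hasFDerivAt_chordMap y).hasFDerivWithinAt) (injOn_chordMap hlt)]
  refine setLIntegral_congr_fun (measurableSet_chordDomain hO) fun y hy => ?_
  have : |(LinearMap.toContinuousLinearMap (Matrix.toLin' (chordJacobian y))).det| =
      y 0 * y 1 * (y 3 - y 2) := by
    rw [LinearMap.det_toContinuousLinearMap, LinearMap.det_toLin', det_chordJacobian,
      show y 0 * y 1 * (y 2 - y 3) = - (y 0 * y 1 * (y 3 - y 2)) by ring, abs_neg, abs_of_pos]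
    exact mul_pos (mul_pos hy.1 hy.2.1) (sub_pos.2 (hlt _ hy.2.2))
  simp only [this]

/-! ### Scalings and linear changes of variables -/

theorem lintegral_mul_left {a : ℝ} (ha : 0 < a) (f : ℝ → ℝ≥0∞) :
    ∫⁻ x, f x = ENNReal.ofReal a * ∫⁻ x, f (a * x) := by
  conv_lhs => rw [← Real.smul_map_volume_mul_left ha.ne']
  rw [lintegral_smul_measure, abs_of_pos ha, smul_eq_mul]
  congr 1
  exact (Homeomorph.mulLeft₀ a ha.ne').measurableEmbedding.lintegral_map f

theorem lintegral_smul_E3 {a : ℝ} (ha : 0 < a) (f : E3 → ℝ≥0∞) :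
    ∫⁻ x, f x = ENNReal.ofReal (a ^ 3) * ∫⁻ x, f (a • x) := by
  have h := Measure.map_addHaar_smul (volume : Measure E3) ha.ne'
  have h2 : ∫⁻ x, f (a • x) = ∫⁻ x, f x ∂(Measure.map (a • ·) (volume : Measure E3)) :=
    ((Homeomorph.smulOfNeZero a ha.ne').measurableEmbedding.lintegral_map f).symm
  rw [h2, h, lintegral_smul_measure, smul_eq_mul, ← mul_assoc, ← ENNReal.ofReal_mul (by positivity)]
  simp [abs_of_pos ha, ha.ne']

theorem lintegral_neg_E3 (f : E3 → ℝ≥0∞) : ∫⁻ x, f x = ∫⁻ x, f (-x) :=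
  ((Measure.measurePreserving_neg (volume : Measure E3)).lintegral_comp_emb
    (MeasurableEquiv.neg E3).measurableEmbedding f).symm

/-- Integration in the coordinates of a basis. -/
theorem lintegral_basis {u v w : E3} (h : triple u v w ≠ 0) (f : E3 → ℝ≥0∞) :
    ∫⁻ x, f x = ENNReal.ofReal |triple u v w| *
      ∫⁻ y : Fin 3 → ℝ, f (y 0 • u + y 1 • v + y 2 • w) := by
  have h1 := (EuclideanSpace.volume_preserving_symm_measurableEquiv_toLp (Fin 3)).symm
  have h2 := Real.map_matrix_volume_pi_eq_smul_volume_pi h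
  have h3 : ∫⁻ y : Fin 3 → ℝ, f (y 0 • u + y 1 • v + y 2 • w) =
      ∫⁻ y, f (WithLp.toLp 2 y) ∂(Measure.map (Matrix.toLin' (treeFrame u v w)) volume) := by
    have hme : MeasurableEmbedding (Matrix.toLin' (treeFrame u v w)) := by
      have := (LinearEquiv.ofIsUnitDet (f := Matrix.toLin' (treeFrame u v w))
        (v := Pi.basisFun ℝ (Fin 3)) (v' := Pi.basisFun ℝ (Fin 3))
        (by simpa [LinearMap.toMatrix_eq_toMatrix', LinearMap.toMatrix'_toLin', triple] using h)).toContinuousLinearEquiv.toHomeomorph.measurableEmbedding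
      exact this
    rw [hme.lintegral_map]
    refine lintegral_congr fun y => congrArg f ?_
    ext i
    simp [Matrix.toLin'_apply, Matrix.mulVec, dotProduct, treeFrame, Fin.sum_univ_succ]
    ring
  rw [h3, h2, lintegral_smul_measure, smul_eq_mul, ← mul_assoc, ← ENNReal.ofReal_mul (abs_nonneg _),
    abs_inv, show (treeFrame u v w).det = triple u v w from rfl,
    mul_inv_cancel₀ (abs_ne_zero.2 h), ENNReal.ofReal_one, one_mul]
  exact (h1.lintegral_comp_emb (MeasurableEquiv.measurableEmbedding _) f).symm

/-- Integration over the vectors with a positive coefficient on `-w`, in polar form: the shell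
becomes the inverse cube of the vector with that coefficient equal to one. -/
theorem lintegral_cone (u v w : E3) (φ : ℝ × ℝ → ℝ≥0∞) (hφ : Measurable φ) :
    ∫⁻ y : Fin 3 → ℝ, (if 0 < y 0 then
      shell (y 0 • (-w) + y 1 • u + y 2 • v) * φ (y 1 / y 0, y 2 / y 0) else 0) =
      shellMass * ∫⁻ p : ℝ × ℝ, φ p * invCube (p.1 • u + p.2 • v - w) := by
  have hpos : MeasurableSet {y : Fin 3 → ℝ | 0 < y 0} :=
    measurableSet_lt measurable_const (measurable_pi_apply 0)
  rw [lintegral_fin_three _ (Measurable.ite hpos (by fun_prop) measurable_const)]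
  have h1 : ∀ z : ℝ, ∫⁻ a, ∫⁻ b, (if 0 < (![z, a, b] : Fin 3 → ℝ) 0 then
      shell ((![z, a, b] : Fin 3 → ℝ) 0 • (-w) + (![z, a, b] : Fin 3 → ℝ) 1 • u +
        (![z, a, b] : Fin 3 → ℝ) 2 • v) * φ ((![z, a, b] : Fin 3 → ℝ) 1 / (![z, a, b] : Fin 3 → ℝ) 0,
          (![z, a, b] : Fin 3 → ℝ) 2 / (![z, a, b] : Fin 3 → ℝ) 0) else 0) =
      (Ioi (0 : ℝ)).indicator (fun z => ∫⁻ p : ℝ × ℝ,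
        φ p * (ENNReal.ofReal (z ^ 2) * shell (z • (p.1 • u + p.2 • v - w)))) z := by
    intro z
    by_cases hz : 0 < z
    · rw [indicator_of_mem (mem_Ioi.2 hz), Measure.volume_eq_prod, lintegral_prod _ (by fun_prop),
        lintegral_mul_left hz, ← lintegral_const_mul' _ _ ENNReal.ofReal_ne_top]
      refine lintegral_congr fun a => ?_
      rw [lintegral_mul_left hz, ← mul_assoc, ← ENNReal.ofReal_mul hz.le,
        ← lintegral_const_mul' _ _ ENNReal.ofReal_ne_top]
      refine lintegral_congr fun b => ?_
      have e : z • (-w) + (z * a) • u + (z * b) • v = z • (a • u + b • v - w) := by module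
      rw [if_pos (show 0 < (![z, z * a, z * b] : Fin 3 → ℝ) 0 from hz)]
      simp only [Matrix.cons_val_zero, Matrix.cons_val_one, Matrix.cons_val]
      rw [e, mul_div_cancel_left₀ _ hz.ne', mul_div_cancel_left₀ _ hz.ne', sq]
      ring
    · rw [indicator_of_notMem (by simpa using hz)]
      simp [hz]
  simp_rw [h1]
  rw [lintegral_indicator measurableSet_Ioi, lintegral_lintegral_swap (by fun_prop),
    ← lintegral_const_mul _ (by fun_prop)]
  refine lintegral_congr fun p => ?_
  rw [lintegral_const_mul _ (by fun_prop), lintegral_shell_smul]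
  ring

/-! ### Directions of the edges of the tree -/

theorem triple_cone (a b e : E3) (y : Fin 3 → ℝ) :
    -triple a b (y 0 • (-e) + y 1 • a + y 2 • b) = y 0 * triple a b e ∧
      triple (y 0 • (-e) + y 1 • a + y 2 • b) b e = y 1 * triple a b e ∧
      triple a (y 0 • (-e) + y 1 • a + y 2 • b) e = y 2 * triple a b e := by
  simp only [triple_eq, PiLp.add_apply, PiLp.smul_apply, PiLp.neg_apply, smul_eq_mul]
  refine ⟨?_, ?_, ?_⟩ <;> ring

/-- The linearly independent vectors `a`, `b`, `e` and the vectors `c`, `d` are, up to positive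
factors, the displacements of the edges of a tree whose last two univalent vertices have abscissas
in `O` when the first two have abscissas `0` and `1`. The edge `e` goes from the first trivalent
vertex to the second one, `a` and `b` go from the first trivalent vertex to the first two
univalent vertices, `c` and `d` from the second trivalent vertex to the last two. By Cramer's rule
the conditions are on the coordinates of `c` and `d` with respect to `a`, `b`, `e`. -/
def treeRegion (O : Set (ℝ × ℝ)) (a b e c d : E3) : Prop :=
  triple a b e ≠ 0 ∧ 0 < -triple a b c / triple a b e ∧ 0 < -triple a b d / triple a b e ∧
    ![triple c b e / -triple a b c, triple a c e / -triple a b c,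
      triple d b e / -triple a b d, triple a d e / -triple a b d] ∈ chordImage O

/-- The indicator function of `treeRegion`. -/
noncomputable def treeDensity (O : Set (ℝ × ℝ)) (a b e c d : E3) : ℝ≥0∞ := open Classical in
  if treeRegion O a b e c d then 1 else 0

theorem measurable_treeDensity {O : Set (ℝ × ℝ)} (hO : MeasurableSet O)
    (hlt : ∀ u ∈ O, u.1 < u.2) {α : Type*} [MeasurableSpace α] {a b e c d : α → E3}
    (ha : Measurable a) (hb : Measurable b) (he : Measurable e) (hc : Measurable c)
    (hd : Measurable d) :
    Measurable fun x => treeDensity O (a x) (b x) (e x) (c x) (d x) := by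
  have h1 : Measurable fun x => triple (a x) (b x) (e x) := by fun_prop
  have h2 : Measurable fun x => -triple (a x) (b x) (c x) / triple (a x) (b x) (e x) := by fun_prop
  have h3 : Measurable fun x => -triple (a x) (b x) (d x) / triple (a x) (b x) (e x) := by fun_prop
  refine Measurable.ite ?_ measurable_const measurable_const
  refine ((measurableSet_eq_fun h1 measurable_const).compl).inter
    ((measurableSet_lt measurable_const h2).inter ((measurableSet_lt measurable_const h3).inter
      ((measurableSet_chordImage hO hlt).preimage ?_)))
  refine measurable_pi_iff.2 fun i => ?_
  fin_cases i <;> simp <;> fun_prop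

theorem treeDensity_comb {O : Set (ℝ × ℝ)} {a b e : E3} (h : triple a b e ≠ 0)
    (y z : Fin 3 → ℝ) :
    treeDensity O a b e (y 0 • (-e) + y 1 • a + y 2 • b) (z 0 • (-e) + z 1 • a + z 2 • b) =
      if 0 < y 0 then (if 0 < z 0 then (chordImage O).indicator 1
        ![y 1 / y 0, y 2 / y 0, z 1 / z 0, z 2 / z 0] else 0) else 0 := by
  have hiff : treeRegion O a b e (y 0 • (-e) + y 1 • a + y 2 • b)
      (z 0 • (-e) + z 1 • a + z 2 • b) ↔ 0 < y 0 ∧ 0 < z 0 ∧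
        ![y 1 / y 0, y 2 / y 0, z 1 / z 0, z 2 / z 0] ∈ chordImage O := by
    obtain ⟨h1, h2, h3⟩ := triple_cone a b e y
    obtain ⟨k1, k2, k3⟩ := triple_cone a b e z
    rw [treeRegion, h1, h2, h3, k1, k2, k3]
    simp only [mul_div_cancel_right₀ _ h, mul_div_mul_right _ _ h, ne_eq, h, not_false_eq_true,
      true_and]
  simp only [treeDensity, indicator, Pi.one_apply]
  split_ifs with h1 <;> first | rfl | (exfalso; rw [hiff] at h1; tauto)

/-- Integration over the last two edges, the other three being fixed: in the coordinates with respect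
to these three vectors, the integral is over the image of `chordMap`. -/
theorem lintegral_treeDensity_slice {O : Set (ℝ × ℝ)} (hO : MeasurableSet O)
    (hlt : ∀ u ∈ O, u.1 < u.2) (a b e : E3) :
    ∫⁻ c, ∫⁻ d, shell c * shell d * treeDensity O a b e c d =
      shellMass ^ 2 * ∫⁻ y in chordDomain O, ENNReal.ofReal (triple a b e ^ 2) *
        ENNReal.ofReal (y 0 * y 1 * (y 3 - y 2)) *
        invCube (chordMap y 0 • a + chordMap y 1 • b - e) *
        invCube (chordMap y 2 • a + chordMap y 3 • b - e) := by
  by_cases h : triple a b e = 0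
  · simp [treeDensity, treeRegion, h]
  have h' : triple (-e) a b ≠ 0 := by
    have : triple (-e) a b = - triple a b e := by
      simp only [triple_eq, PiLp.neg_apply]; ring
    rw [this]; simpa using h
  have habs : |triple (-e) a b| = |triple a b e| := by
    rw [← abs_neg]; congr 1
    simp only [triple_eq, PiLp.neg_apply]; ring
  set φ : (Fin 4 → ℝ) → ℝ≥0∞ := (chordImage O).indicator 1 with hφ
  have hφm : Measurable φ := measurable_one.indicator (measurableSet_chordImage hO hlt)
  have hφm' : ∀ {α : Type} [MeasurableSpace α] {p q r s : α → ℝ}, Measurable p → Measurable q →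
      Measurable r → Measurable s → Measurable fun x => φ ![p x, q x, r x, s x] := by
    intro α _ p q r s hp hq hr hs
    refine hφm.comp (measurable_pi_iff.2 fun i => ?_)
    fin_cases i <;> simpa
  have hd : ∀ y : Fin 3 → ℝ, ∫⁻ d, shell d *
      treeDensity O a b e (y 0 • (-e) + y 1 • a + y 2 • b) d =
      if 0 < y 0 then ENNReal.ofReal |triple a b e| * (shellMass * ∫⁻ p : ℝ × ℝ,
        φ ![y 1 / y 0, y 2 / y 0, p.1, p.2] * invCube (p.1 • a + p.2 • b - e)) else 0 := by
    intro y
    rw [lintegral_basis h', habs]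
    simp only [treeDensity_comb h]
    split_ifs with hy
    · congr 1
      rw [← lintegral_cone a b e (fun p => φ ![y 1 / y 0, y 2 / y 0, p.1, p.2])
        (hφm' (by fun_prop) (by fun_prop) (by fun_prop) (by fun_prop))]
      refine lintegral_congr fun z => ?_
      split_ifs <;> simp [hφ]
    · simp
  have hc : ∫⁻ c, ∫⁻ d, shell c * shell d * treeDensity O a b e c d =
      ENNReal.ofReal |triple a b e| * (ENNReal.ofReal |triple a b e| * (shellMass * (shellMass *
        ∫⁻ q : ℝ × ℝ, (∫⁻ p : ℝ × ℝ,
        φ ![q.1, q.2, p.1, p.2] * invCube (p.1 • a + p.2 • b - e)) *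
          invCube (q.1 • a + q.2 • b - e)))) := by
    have hmeas : Measurable fun q : ℝ × ℝ => ∫⁻ p : ℝ × ℝ,
        φ ![q.1, q.2, p.1, p.2] * invCube (p.1 • a + p.2 • b - e) := by
      refine Measurable.lintegral_prod_right' (f := fun x : (ℝ × ℝ) × (ℝ × ℝ) =>
        φ ![x.1.1, x.1.2, x.2.1, x.2.2] * invCube (x.2.1 • a + x.2.2 • b - e)) ?_
      exact (hφm' (by fun_prop) (by fun_prop) (by fun_prop) (by fun_prop)).mul (by fun_prop)
    rw [lintegral_basis h', habs]
    congr 1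
    rw [← lintegral_cone a b e _ hmeas, ← lintegral_const_mul' _ _ shellMass_ne_top,
      ← lintegral_const_mul' _ _ ENNReal.ofReal_ne_top]
    refine lintegral_congr fun y => ?_
    simp only [mul_assoc]
    rw [lintegral_const_mul' _ _ (by unfold shell; split_ifs <;> simp), hd]
    split_ifs
    · ring
    · simp
  have h4 : ∫⁻ q : ℝ × ℝ, (∫⁻ p : ℝ × ℝ,
        φ ![q.1, q.2, p.1, p.2] * invCube (p.1 • a + p.2 • b - e)) *
          invCube (q.1 • a + q.2 • b - e) = ∫⁻ x in chordImage O,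
          invCube (x 0 • a + x 1 • b - e) * invCube (x 2 • a + x 3 • b - e) := by
    rw [← lintegral_indicator (measurableSet_chordImage hO hlt), lintegral_fin_four _
      ((by fun_prop : Measurable fun x : Fin 4 → ℝ => invCube (x 0 • a + x 1 • b - e) *
        invCube (x 2 • a + x 3 • b - e)).indicator (measurableSet_chordImage hO hlt)),
      Measure.volume_eq_prod, lintegral_prod]
    · refine lintegral_congr fun q1 => lintegral_congr fun q2 => ?_
      rw [lintegral_prod, ← lintegral_mul_const' _ _ (by simp [invCube])]
      · refine lintegral_congr fun p1 => ?_
        rw [← lintegral_mul_const' _ _ (by simp [invCube])]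
        refine lintegral_congr fun p2 => ?_
        simp only [hφ, indicator]
        split_ifs <;> simp
        ring
      · exact ((hφm' (by fun_prop) (by fun_prop) (by fun_prop) (by fun_prop)).mul
          (by fun_prop)).aemeasurable
    · refine (Measurable.mul ?_ (by fun_prop)).aemeasurable
      refine Measurable.lintegral_prod_right' (f := fun x : (ℝ × ℝ) × (ℝ × ℝ) =>
        φ ![x.1.1, x.1.2, x.2.1, x.2.2] * invCube (x.2.1 • a + x.2.2 • b - e)) ?_
      exact (hφm' (by fun_prop) (by fun_prop) (by fun_prop) (by fun_prop)).mul (by fun_prop)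
  rw [hc, h4, lintegral_chordImage hO hlt]
  have e2 : ENNReal.ofReal (triple a b e ^ 2) =
      ENNReal.ofReal |triple a b e| * ENNReal.ofReal |triple a b e| := by
    rw [← ENNReal.ofReal_mul (abs_nonneg _), abs_mul_abs_self, sq]
  simp only [mul_assoc]
  rw [lintegral_const_mul' _ _ ENNReal.ofReal_ne_top, e2]
  ring

theorem lintegral_swap_triple {Y : Type*} [MeasurableSpace Y] (μ : Measure Y) [SFinite μ]
    (F : E3 → E3 → E3 → Y → ℝ≥0∞)
    (hF : Measurable fun x : (E3 × E3 × E3) × Y => F x.1.1 x.1.2.1 x.1.2.2 x.2) :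
    ∫⁻ a, ∫⁻ b, ∫⁻ e, ∫⁻ y, F a b e y ∂μ = ∫⁻ y, ∫⁻ a, ∫⁻ b, ∫⁻ e, F a b e y ∂volume ∂volume ∂volume ∂μ := by
  have h1 : ∀ g : E3 × E3 × E3 → ℝ≥0∞, Measurable g →
      ∫⁻ a, ∫⁻ b, ∫⁻ e, g (a, b, e) = ∫⁻ x, g x := by
    intro g hg
    rw [Measure.volume_eq_prod, lintegral_prod _ hg.aemeasurable]
    refine lintegral_congr fun a => ?_
    rw [Measure.volume_eq_prod, lintegral_prod _ (by fun_prop)]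
  have h2 : ∫⁻ y, ∫⁻ a, ∫⁻ b, ∫⁻ e, F a b e y ∂volume ∂volume ∂volume ∂μ =
      ∫⁻ y, ∫⁻ x : E3 × E3 × E3, F x.1 x.2.1 x.2.2 y ∂volume ∂μ := by
    refine lintegral_congr fun y => ?_
    exact h1 (fun x => F x.1 x.2.1 x.2.2 y) (hF.comp (by fun_prop : Measurable fun x => (x, y)))
  have h3 : ∫⁻ a, ∫⁻ b, ∫⁻ e, ∫⁻ y, F a b e y ∂μ =
      ∫⁻ x : E3 × E3 × E3, ∫⁻ y, F x.1 x.2.1 x.2.2 y ∂μ :=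
    h1 (fun x => ∫⁻ y, F x.1 x.2.1 x.2.2 y ∂μ) hF.lintegral_prod_right'
  rw [h3, h2]
  exact lintegral_lintegral_swap hF.aemeasurable

theorem lintegral_chordDomain_mul {O : Set (ℝ × ℝ)} (hO : MeasurableSet O) (f g : ℝ → ℝ≥0∞)
    (h : ℝ × ℝ → ℝ≥0∞) (hf : Measurable f) (hg : Measurable g) (hh : Measurable h) :
    ∫⁻ y in chordDomain O, f (y 0) * g (y 1) * h (y 2, y 3) =
      (∫⁻ t in Ioi 0, f t) * (∫⁻ t in Ioi 0, g t) * ∫⁻ u in O, h u := by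
  have hm := measurableSet_chordDomain hO
  have hm' : Measurable fun y : Fin 4 → ℝ => f (y 0) * g (y 1) * h (y 2, y 3) := by fun_prop
  rw [← lintegral_indicator hm, lintegral_fin_four _ (hm'.indicator hm),
    ← lintegral_indicator measurableSet_Ioi, ← lintegral_indicator measurableSet_Ioi,
    ← lintegral_indicator hO, Measure.volume_eq_prod,
    lintegral_prod _ (hh.indicator hO).aemeasurable]
  have hf' := hf.indicator (measurableSet_Ioi (a := (0 : ℝ)))
  have hg' := hg.indicator (measurableSet_Ioi (a := (0 : ℝ)))
  have hh' := hh.indicator hO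
  have e : ∀ a b c d : ℝ, (chordDomain O).indicator
      (fun y : Fin 4 → ℝ => f (y 0) * g (y 1) * h (y 2, y 3)) ![a, b, c, d] =
      (Ioi 0).indicator f a * ((Ioi 0).indicator g b * O.indicator h (c, d)) := by
    intro a b c d
    by_cases ha : 0 < a <;> by_cases hb : 0 < b <;> by_cases hc : (c, d) ∈ O <;>
      simp [indicator, chordDomain, ha, hb, hc, mul_assoc]
  simp_rw [e]
  have hin : Measurable fun c : ℝ => ∫⁻ d, O.indicator h (c, d) := hh'.lintegral_prod_right'
  calc _ = ∫⁻ a, (Ioi 0).indicator f a * ∫⁻ b, (Ioi 0).indicator g b *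
          ∫⁻ c, ∫⁻ d, O.indicator h (c, d) := by
        refine lintegral_congr fun a => ?_
        rw [← lintegral_const_mul _ (by fun_prop)]
        refine lintegral_congr fun b => ?_
        rw [← lintegral_const_mul _ hin, ← lintegral_const_mul _ (by fun_prop)]
        refine lintegral_congr fun c => ?_
        rw [lintegral_const_mul _ (by fun_prop), lintegral_const_mul _ (by fun_prop)]
    _ = _ := by
        rw [lintegral_mul_const _ hg', lintegral_mul_const _ hf']
        ring

/-- The volume of the set of the quintuples of vectors in the shell that have the directions of the
edges of a tree with order `O`. -/
noncomputable def dirVolume (O : Set (ℝ × ℝ)) : ℝ≥0∞ :=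
  ∫⁻ a, ∫⁻ b, ∫⁻ e, shell a * shell b * shell e *
    ∫⁻ c, ∫⁻ d, shell c * shell d * treeDensity O a b e c d

/-- The absolute value of the form on the configurations of a tree with univalent vertices at `0`,
`b`, `u.1 • b`, `u.2 • b` and trivalent vertices at `p` and `q`, without the factor of the edge
between the trivalent vertices. -/
noncomputable def configDensity (b p q : E3) (u : ℝ × ℝ) : ℝ≥0∞ :=
  ENNReal.ofReal ((u.2 - u.1) * triple b p q ^ 2) * invCube p * invCube (b - p) *
    invCube (u.1 • b - q) * invCube (u.2 • b - q)

/-- The change of variables from the edges `a`, `b`, `e` to the positions `p`, `b`, `q` of three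
vertices, at fixed `α = y 0` and `β = y 1`. -/
theorem lintegral_directions_fixed {y : Fin 4 → ℝ} (h0 : 0 < y 0) (h1 : 0 < y 1) :
    ∫⁻ a, ∫⁻ b, ∫⁻ e, shell a * shell b * shell e * (ENNReal.ofReal (triple a b e ^ 2) *
        ENNReal.ofReal (y 0 * y 1 * (y 3 - y 2)) *
        invCube (chordMap y 0 • a + chordMap y 1 • b - e) *
        invCube (chordMap y 2 • a + chordMap y 3 • b - e)) =
    ∫⁻ p : E3, ∫⁻ b : E3, ∫⁻ q : E3, (ENNReal.ofReal (y 0 ^ 4)⁻¹ * shell ((y 0)⁻¹ • p)) *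
      (ENNReal.ofReal (y 1 ^ 4)⁻¹ * shell ((y 1)⁻¹ • (b - p))) *
      (ENNReal.ofReal ((y 3 - y 2) * triple b p q ^ 2) *
        invCube (y 2 • b - q) * invCube (y 3 • b - q) * shell (q - p)) := by
  rw [lintegral_neg_E3, lintegral_smul_E3 (inv_pos.2 h0),
    ← lintegral_const_mul' _ _ ENNReal.ofReal_ne_top]
  refine lintegral_congr fun p => ?_
  rw [lintegral_smul_E3 (inv_pos.2 h1), ← lintegral_sub_right_eq_self _ p,
    ← lintegral_const_mul' _ _ ENNReal.ofReal_ne_top,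
    ← lintegral_const_mul' _ _ ENNReal.ofReal_ne_top]
  refine lintegral_congr fun b => ?_
  rw [← lintegral_sub_right_eq_self _ p, ← lintegral_const_mul' _ _ ENNReal.ofReal_ne_top,
    ← lintegral_const_mul' _ _ ENNReal.ofReal_ne_top]
  refine lintegral_congr fun q => ?_
  have hs : shell (-((y 0)⁻¹ • p)) = shell ((y 0)⁻¹ • p) := by simp [shell]
  have hc : ∀ u : ℝ, (y 0 * (1 - u)) • (-((y 0)⁻¹ • p)) + (y 1 * u) • ((y 1)⁻¹ • (b - p)) - (q - p) =
      u • b - q := by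
    intro u
    rw [smul_neg, smul_smul, smul_smul, show y 0 * (1 - u) * (y 0)⁻¹ = 1 - u by field_simp,
      show y 1 * u * (y 1)⁻¹ = u by field_simp]
    module
  have ht : triple (-((y 0)⁻¹ • p)) ((y 1)⁻¹ • (b - p)) (q - p) ^ 2 =
      (y 0)⁻¹ ^ 2 * (y 1)⁻¹ ^ 2 * triple b p q ^ 2 := by
    simp only [triple_eq, PiLp.sub_apply, PiLp.smul_apply, PiLp.neg_apply, smul_eq_mul]
    ring
  simp only [chordMap, Matrix.cons_val_zero, Matrix.cons_val_one, Matrix.cons_val]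
  rw [hs, hc, hc, ht]
  have key : ENNReal.ofReal ((y 0)⁻¹ ^ 3) * (ENNReal.ofReal ((y 1)⁻¹ ^ 3) *
      (ENNReal.ofReal ((y 0)⁻¹ ^ 2 * (y 1)⁻¹ ^ 2 * triple b p q ^ 2) *
        ENNReal.ofReal (y 0 * y 1 * (y 3 - y 2)))) =
      ENNReal.ofReal (y 0 ^ 4)⁻¹ * (ENNReal.ofReal (y 1 ^ 4)⁻¹ *
        ENNReal.ofReal ((y 3 - y 2) * triple b p q ^ 2)) := by
    rw [← ENNReal.ofReal_mul (by positivity), ← ENNReal.ofReal_mul (by positivity),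
      ← ENNReal.ofReal_mul (by positivity), ← ENNReal.ofReal_mul (by positivity),
      ← ENNReal.ofReal_mul (by positivity)]
    congr 1
    field_simp
  calc _ = (ENNReal.ofReal ((y 0)⁻¹ ^ 3) * (ENNReal.ofReal ((y 1)⁻¹ ^ 3) *
      (ENNReal.ofReal ((y 0)⁻¹ ^ 2 * (y 1)⁻¹ ^ 2 * triple b p q ^ 2) *
        ENNReal.ofReal (y 0 * y 1 * (y 3 - y 2))))) * (shell ((y 0)⁻¹ • p) *
        shell ((y 1)⁻¹ • (b - p)) * shell (q - p) * invCube (y 2 • b - q) *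
          invCube (y 3 • b - q)) := by ring
    _ = _ := by rw [key]; ring

/-- The map from configurations to directions of edges preserves the measures, up to the constant
coming from the shells. The integrals over `α` and `β` restore the inverse cubes of two legs. -/
theorem dirVolume_eq {O : Set (ℝ × ℝ)} (hO : MeasurableSet O) (hlt : ∀ u ∈ O, u.1 < u.2) :
    dirVolume O = shellMass ^ 4 * ∫⁻ p : E3, ∫⁻ b : E3, ∫⁻ q : E3,
      shell (q - p) * ∫⁻ u in O, configDensity b p q u := by
  have hchord : ∀ i : Fin 4, Measurable fun y : Fin 4 → ℝ => chordMap y i := by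
    intro i
    fin_cases i <;> simp [chordMap] <;> fun_prop
  have hshell : ∀ v : E3, shell v ≠ ∞ := fun v => by unfold shell; split_ifs <;> simp
  calc dirVolume O = ∫⁻ a, ∫⁻ b, ∫⁻ e, ∫⁻ y in chordDomain O, shellMass ^ 2 *
        (shell a * shell b * shell e * (ENNReal.ofReal (triple a b e ^ 2) *
        ENNReal.ofReal (y 0 * y 1 * (y 3 - y 2)) *
        invCube (chordMap y 0 • a + chordMap y 1 • b - e) *
        invCube (chordMap y 2 • a + chordMap y 3 • b - e))) := by
        refine lintegral_congr fun a => lintegral_congr fun b => lintegral_congr fun e => ?_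
        rw [lintegral_treeDensity_slice hO hlt, lintegral_const_mul' _ _
          (ENNReal.pow_ne_top shellMass_ne_top), lintegral_const_mul' _ _
          (ENNReal.mul_ne_top (ENNReal.mul_ne_top (hshell a) (hshell b)) (hshell e))]
        ring
    _ = ∫⁻ y in chordDomain O, ∫⁻ a, ∫⁻ b, ∫⁻ e, shellMass ^ 2 *
        (shell a * shell b * shell e * (ENNReal.ofReal (triple a b e ^ 2) *
        ENNReal.ofReal (y 0 * y 1 * (y 3 - y 2)) *
        invCube (chordMap y 0 • a + chordMap y 1 • b - e) *
        invCube (chordMap y 2 • a + chordMap y 3 • b - e))) := by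
        refine lintegral_swap_triple _ _ ?_
        have h0 := hchord 0
        have h1 := hchord 1
        have h2 := hchord 2
        have h3 := hchord 3
        fun_prop
    _ = ∫⁻ y in chordDomain O, ∫⁻ p : E3, ∫⁻ b : E3, ∫⁻ q : E3, shellMass ^ 2 *
        ((ENNReal.ofReal (y 0 ^ 4)⁻¹ * shell ((y 0)⁻¹ • p)) *
        (ENNReal.ofReal (y 1 ^ 4)⁻¹ * shell ((y 1)⁻¹ • (b - p))) *
        (ENNReal.ofReal ((y 3 - y 2) * triple b p q ^ 2) *
        invCube (y 2 • b - q) * invCube (y 3 • b - q) * shell (q - p))) := by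
        refine setLIntegral_congr_fun (measurableSet_chordDomain hO) fun y hy => ?_
        have hK : shellMass ^ 2 ≠ ∞ := ENNReal.pow_ne_top shellMass_ne_top
        simp only [lintegral_const_mul' _ _ hK]
        rw [lintegral_directions_fixed hy.1 hy.2.1]
    _ = ∫⁻ p : E3, ∫⁻ b : E3, ∫⁻ q : E3, ∫⁻ y in chordDomain O, shellMass ^ 2 *
        ((ENNReal.ofReal (y 0 ^ 4)⁻¹ * shell ((y 0)⁻¹ • p)) *
        (ENNReal.ofReal (y 1 ^ 4)⁻¹ * shell ((y 1)⁻¹ • (b - p))) *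
        (ENNReal.ofReal ((y 3 - y 2) * triple b p q ^ 2) *
        invCube (y 2 • b - q) * invCube (y 3 • b - q) * shell (q - p))) := by
        refine (lintegral_swap_triple _ _ ?_).symm
        fun_prop
    _ = ∫⁻ p : E3, ∫⁻ b : E3, ∫⁻ q : E3, shellMass ^ 4 *
      (shell (q - p) * ∫⁻ u in O, configDensity b p q u) := by
        refine lintegral_congr fun p => lintegral_congr fun b => lintegral_congr fun q => ?_
        rw [lintegral_const_mul' _ _ (ENNReal.pow_ne_top shellMass_ne_top),
          lintegral_chordDomain_mul hO (fun t => ENNReal.ofReal (t ^ 4)⁻¹ * shell (t⁻¹ • p))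
          (fun t => ENNReal.ofReal (t ^ 4)⁻¹ * shell (t⁻¹ • (b - p)))
          (fun u => ENNReal.ofReal ((u.2 - u.1) * triple b p q ^ 2) *
            invCube (u.1 • b - q) * invCube (u.2 • b - q) * shell (q - p))
          (by fun_prop) (by fun_prop) (by fun_prop), lintegral_shell_inv_smul,
          lintegral_shell_inv_smul, lintegral_mul_const' _ _ (hshell _)]
        have : ∀ u, configDensity b p q u = (invCube p * invCube (b - p)) *
          (ENNReal.ofReal ((u.2 - u.1) * triple b p q ^ 2) *
            invCube (u.1 • b - q) * invCube (u.2 • b - q)) := fun u => by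
          unfold configDensity; ring
        simp only [this]
        rw [lintegral_const_mul' _ _ (ENNReal.mul_ne_top (by simp [invCube]) (by simp [invCube]))]
        ring
    _ = _ := by
        have hK : shellMass ^ 4 ≠ ∞ := ENNReal.pow_ne_top shellMass_ne_top
        simp only [lintegral_const_mul' _ _ hK]

/-! ### The symmetry between the separated and the nested tree -/

/-- The abscissas `(u, v)` of `c < d` when `a = 0`, `b = 1`, and the order is `a < b < c < d`. -/
def separated : Set (ℝ × ℝ) := {u | 1 < u.1 ∧ u.1 < u.2}

/-- The abscissas `(u, v)` of `c < d` when `a = 0`, `b = 1`, and the order is `a < c < d < b`. -/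
def nested : Set (ℝ × ℝ) := {u | 0 < u.1 ∧ u.1 < u.2 ∧ u.2 < 1}

/-- The abscissas `(u, v)` of `c < d` when `a = 0`, `b = 1`, and the order is `a < c < b < d`. -/
def crossed : Set (ℝ × ℝ) := {u | 0 < u.1 ∧ u.1 < 1 ∧ 1 < u.2}

theorem measurableSet_separated : MeasurableSet separated :=
  (measurableSet_lt measurable_const measurable_fst).inter
    (measurableSet_lt measurable_fst measurable_snd)

theorem measurableSet_nested : MeasurableSet nested :=
  (measurableSet_lt measurable_const measurable_fst).inter
    ((measurableSet_lt measurable_fst measurable_snd).inter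
      (measurableSet_lt measurable_snd measurable_const))

theorem measurableSet_crossed : MeasurableSet crossed :=
  (measurableSet_lt measurable_const measurable_fst).inter
    ((measurableSet_lt measurable_fst measurable_const).inter
      (measurableSet_lt measurable_const measurable_snd))

theorem lt_of_mem_separated : ∀ u ∈ separated, u.1 < u.2 := fun _ h => h.2

theorem lt_of_mem_nested : ∀ u ∈ nested, u.1 < u.2 := fun _ h => h.2.1

theorem lt_of_mem_crossed : ∀ u ∈ crossed, u.1 < u.2 := fun _ h => h.2.1.trans h.2.2

/-- Solving for the intercepts `α`, `β` and the abscissas `u`, `v`. -/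
theorem mem_chordImage_iff {O : Set (ℝ × ℝ)} (hlt : ∀ u ∈ O, u.1 < u.2) (x y z w : ℝ) :
    ![x, y, z, w] ∈ chordImage O ↔ z < x ∧ y < w ∧ y * z < x * w ∧
      (y * ((x - z) / (x * w - y * z)), w * ((x - z) / (x * w - y * z))) ∈ O := by
  constructor
  · rintro ⟨t, ⟨h0, h1, h2⟩, ht⟩
    have hu : t 2 < t 3 := hlt _ h2
    have e0 : t 0 * (1 - t 2) = x := congrFun ht 0
    have e1 : t 1 * t 2 = y := congrFun ht 1
    have e2 : t 0 * (1 - t 3) = z := congrFun ht 2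
    have e3 : t 1 * t 3 = w := congrFun ht 3
    have hP : x * w - y * z = t 0 * t 1 * (t 3 - t 2) := by
      rw [← e0, ← e1, ← e2, ← e3]; ring
    have hA : x - z = t 0 * (t 3 - t 2) := by rw [← e0, ← e2]; ring
    have hB : w - y = t 1 * (t 3 - t 2) := by rw [← e1, ← e3]; ring
    have hd := sub_pos.2 hu
    have hA' : 0 < x - z := hA ▸ mul_pos h0 hd
    have hB' : 0 < w - y := hB ▸ mul_pos h1 hd
    have hP' : 0 < x * w - y * z := hP ▸ mul_pos (mul_pos h0 h1) hd
    refine ⟨by linarith, by linarith, by linarith, ?_⟩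
    rw [hP, hA, ← e1, ← e3]
    have : ∀ r, t 1 * r * (t 0 * (t 3 - t 2) / (t 0 * t 1 * (t 3 - t 2))) = r := by
      intro r
      field_simp
    rw [this, this]
    exact h2
  · rintro ⟨h1, h2, h3, h4⟩
    have hA : 0 < x - z := sub_pos.2 h1
    have hB : 0 < w - y := sub_pos.2 h2
    have hP : 0 < x * w - y * z := sub_pos.2 h3
    refine ⟨![(x * w - y * z) / (w - y), (x * w - y * z) / (x - z),
      y * ((x - z) / (x * w - y * z)), w * ((x - z) / (x * w - y * z))],
      ⟨div_pos hP hB, div_pos hP hA, h4⟩, ?_⟩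
    ext i
    fin_cases i <;> simp [chordMap] <;> field_simp <;> ring

theorem mem_chordImage_separated (x y z w : ℝ) :
    ![x, y, z, w] ∈ chordImage separated ↔ z < x ∧ y < w ∧ y * z < x * w ∧ x < 0 ∧ 0 < y := by
  rw [mem_chordImage_iff lt_of_mem_separated]
  refine and_congr_right fun h1 => and_congr_right fun h2 => and_congr_right fun h3 => ?_
  have hA : 0 < x - z := sub_pos.2 h1
  have hP : 0 < x * w - y * z := sub_pos.2 h3
  rw [separated, mem_ofPred_eq]
  simp only [mul_lt_mul_of_pos_right h2 (div_pos hA hP), and_true]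
  rw [← mul_div_assoc, lt_div_iff₀ hP]
  constructor
  · intro h
    have hx : x < 0 := by
      have : 0 < -x * (w - y) := by linarith
      have := (pos_iff_pos_of_mul_pos this).2 (sub_pos.2 h2)
      linarith
    refine ⟨hx, ?_⟩
    have : 0 < y * (x - z) := by linarith
    exact (pos_iff_pos_of_mul_pos this).2 hA
  · rintro ⟨hx, hy⟩
    have : 0 < -x * (w - y) := mul_pos (neg_pos.2 hx) (sub_pos.2 h2)
    linarith

theorem mem_chordImage_nested (x y z w : ℝ) :
    ![x, y, z, w] ∈ chordImage nested ↔ z < x ∧ y < w ∧ y * z < x * w ∧ 0 < y ∧ 0 < z := by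
  rw [mem_chordImage_iff lt_of_mem_nested]
  refine and_congr_right fun h1 => and_congr_right fun h2 => and_congr_right fun h3 => ?_
  have hA : 0 < x - z := sub_pos.2 h1
  have hP : 0 < x * w - y * z := sub_pos.2 h3
  rw [nested, mem_ofPred_eq]
  simp only [mul_lt_mul_of_pos_right h2 (div_pos hA hP), true_and]
  simp only [← mul_div_assoc, div_lt_iff₀ hP, div_pos_iff_of_pos_right hP, mul_pos_iff_of_pos_right hA]
  refine and_congr_right fun hy => ?_
  rw [show (w * (x - z) < 1 * (x * w - y * z)) ↔ 0 < z * (w - y) by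
    constructor <;> intro h <;> linarith, mul_pos_iff_of_pos_right (sub_pos.2 h2)]

/-- The signs of the determinants of the directions of the edges of a tree whose feet are in the
order `a < b < c < d`. -/
def separatedSigns (a b e c d : E3) : Prop :=
  0 < -triple a b c / triple a b e ∧ 0 < -triple a b d / triple a b e ∧
  0 < triple b c d / triple a b e ∧ 0 < triple a c d / triple a b e ∧
  0 < triple c d e / triple a b e ∧ 0 < triple b c e / triple a b e ∧
  0 < triple a c e / triple a b e ∧ 0 < triple b d e / triple a b e

/-- The signs of the determinants of the directions of the edges of a tree whose feet are in the
order `a < c < d < b`. -/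
def nestedSigns (a b e c d : E3) : Prop :=
  0 < -triple a b c / triple a b e ∧ 0 < -triple a b d / triple a b e ∧
  0 < triple b c d / triple a b e ∧ 0 < triple a c d / triple a b e ∧
  0 < triple c d e / triple a b e ∧ 0 < -triple b c e / triple a b e ∧
  0 < triple a c e / triple a b e ∧ 0 < -triple b d e / triple a b e

/-- The Plücker relations used to pass from the intercepts to determinants. -/
theorem triple_plucker {a b e : E3} (h : triple a b e ≠ 0) (c d : E3) :
    triple b c d / triple a b e = (triple b d e / triple a b e) * (-triple a b c / triple a b e) -
      (triple b c e / triple a b e) * (-triple a b d / triple a b e) ∧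
    triple a c d / triple a b e = (triple a d e / triple a b e) * (-triple a b c / triple a b e) -
      (triple a c e / triple a b e) * (-triple a b d / triple a b e) ∧
    triple c d e / triple a b e = (triple a c e / triple a b e) * (triple b d e / triple a b e) -
      (triple b c e / triple a b e) * (triple a d e / triple a b e) := by
  refine ⟨?_, ?_, ?_⟩ <;> field_simp <;> simp only [triple_eq] <;> ring

theorem treeRegion_intercepts {a b e : E3} (h : triple a b e ≠ 0) (c d : E3) :
    ![triple c b e / -triple a b c, triple a c e / -triple a b c,
      triple d b e / -triple a b d, triple a d e / -triple a b d] =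
    ![-(triple b c e / triple a b e) / (-triple a b c / triple a b e),
      (triple a c e / triple a b e) / (-triple a b c / triple a b e),
      -(triple b d e / triple a b e) / (-triple a b d / triple a b e),
      (triple a d e / triple a b e) / (-triple a b d / triple a b e)] := by
  have e1 : triple c b e = -triple b c e := by simp only [triple_eq]; ring
  have e2 : triple d b e = -triple b d e := by simp only [triple_eq]; ring
  rw [e1, e2, ← neg_div, ← neg_div]
  simp only [div_div_div_cancel_right₀ h]

theorem treeRegion_separated_iff (a b e c d : E3) :
    treeRegion separated a b e c d ↔ separatedSigns a b e c d := by
  by_cases h : triple a b e = 0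
  · simp [treeRegion, separatedSigns, h]
  obtain ⟨h1, h2, h3⟩ := triple_plucker h c d
  rw [treeRegion, separatedSigns, treeRegion_intercepts h, mem_chordImage_separated, h1, h2, h3]
  simp only [ne_eq, h, not_false_eq_true, true_and]
  generalize -triple a b c / triple a b e = m
  generalize -triple a b d / triple a b e = n
  generalize triple b c e / triple a b e = p
  generalize triple a c e / triple a b e = q
  generalize triple b d e / triple a b e = r
  generalize triple a d e / triple a b e = s
  refine and_congr_right fun hm => and_congr_right fun hn => ?_
  rw [div_lt_div_iff₀ hn hm, div_lt_div_iff₀ hm hn, div_mul_div_comm, div_mul_div_comm,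
    div_lt_div_iff_of_pos_right (mul_pos hm hn), neg_div, neg_lt_zero,
    div_pos_iff_of_pos_right hm, div_pos_iff_of_pos_right hm]
  constructor
  · rintro ⟨k1, k2, k3, k4, k5⟩
    refine ⟨by linarith, by linarith, by linarith, k4, k5, ?_⟩
    have : 0 < r * m := by nlinarith [mul_pos k4 hn]
    exact (pos_iff_pos_of_mul_pos this).2 hm
  · rintro ⟨k1, k2, k3, k4, k5, k6⟩
    exact ⟨by linarith, by linarith, by linarith, k4, k5⟩

theorem treeRegion_nested_iff (a b e c d : E3) :
    treeRegion nested a b e c d ↔ nestedSigns a b e c d := by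
  by_cases h : triple a b e = 0
  · simp [treeRegion, nestedSigns, h]
  obtain ⟨h1, h2, h3⟩ := triple_plucker h c d
  rw [treeRegion, nestedSigns, treeRegion_intercepts h, mem_chordImage_nested, h1, h2, h3,
    neg_div _ (triple b c e), neg_div _ (triple b d e)]
  simp only [ne_eq, h, not_false_eq_true, true_and]
  generalize -triple a b c / triple a b e = m
  generalize -triple a b d / triple a b e = n
  generalize triple b c e / triple a b e = p
  generalize triple a c e / triple a b e = q
  generalize triple b d e / triple a b e = r
  generalize triple a d e / triple a b e = s
  refine and_congr_right fun hm => and_congr_right fun hn => ?_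
  rw [div_lt_div_iff₀ hn hm, div_lt_div_iff₀ hm hn, div_mul_div_comm, div_mul_div_comm,
    div_lt_div_iff_of_pos_right (mul_pos hm hn), div_pos_iff_of_pos_right hn,
    div_pos_iff_of_pos_right hm]
  constructor
  · rintro ⟨k1, k2, k3, k4, k5⟩
    refine ⟨by linarith, by linarith, by linarith, ?_, k4, k5⟩
    have : 0 < -p * n := by nlinarith [mul_pos k5 hm]
    exact (pos_iff_pos_of_mul_pos this).2 hn
  · rintro ⟨k1, k2, k3, k4, k5, k6⟩
    exact ⟨by linarith, by linarith, by linarith, k5, k6⟩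

theorem div_pos_iff_of_div_pos {x y : ℝ} (h : 0 < y / x) (z : ℝ) : 0 < z / y ↔ 0 < z / x := by
  rcases div_pos_iff.1 h with ⟨hy, hx⟩ | ⟨hy, hx⟩
  · rw [div_pos_iff_of_pos_right hy, div_pos_iff_of_pos_right hx]
  · simp only [div_pos_iff, hy, hx, hy.not_gt, hx.not_gt, and_true, and_false, false_or]

/-- The two lists of signs are exchanged by a permutation of the directions and two reflections. -/
theorem nestedSigns_iff_separatedSigns (a b e c d : E3) :
    nestedSigns a (-c) (-d) b e ↔ separatedSigns a b e c d := by
  have e1 : triple a (-c) b = triple a b c := by simp only [triple_eq, PiLp.neg_apply]; ring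
  have e2 : triple a (-c) (-d) = triple a c d := by simp only [triple_eq, PiLp.neg_apply]; ring
  have e3 : triple a (-c) e = -triple a c e := by simp only [triple_eq, PiLp.neg_apply]; ring
  have e4 : triple (-c) b e = triple b c e := by simp only [triple_eq, PiLp.neg_apply]; ring
  have e5 : triple b e (-d) = triple b d e := by simp only [triple_eq, PiLp.neg_apply]; ring
  have e6 : triple (-c) b (-d) = -triple b c d := by simp only [triple_eq, PiLp.neg_apply]; ring
  have e7 : triple a b (-d) = -triple a b d := by simp only [triple_eq, PiLp.neg_apply]; ring
  have e8 : triple (-c) e (-d) = -triple c d e := by simp only [triple_eq, PiLp.neg_apply]; ring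
  rw [nestedSigns, separatedSigns, e1, e2, e3, e4, e5, e6, e7, e8]
  simp only [neg_neg]
  by_cases h : 0 < triple a c d / triple a b e
  · have h' : 0 < triple a b e / triple a c d := by rw [← inv_div]; exact inv_pos.2 h
    simp only [div_pos_iff_of_div_pos h, h, true_and]
    have : 0 < triple a b e / triple a b e := (div_pos_iff_of_div_pos h _).1 h'
    tauto
  · have h' : ¬ 0 < triple a b e / triple a c d := by
      rw [← inv_div]; exact fun k => h (inv_pos.1 k)
    tauto

theorem lintegral_swap_pairs (F : E3 → E3 → E3 → E3 → ℝ≥0∞)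
    (hF : Measurable fun x : (E3 × E3) × E3 × E3 => F x.1.1 x.1.2 x.2.1 x.2.2) :
    ∫⁻ a, ∫⁻ b, ∫⁻ c, ∫⁻ d, F a b c d = ∫⁻ c, ∫⁻ d, ∫⁻ a, ∫⁻ b, F a b c d := by
  have h1 : ∀ g : E3 × E3 → ℝ≥0∞, Measurable g → ∫⁻ a, ∫⁻ b, g (a, b) = ∫⁻ x, g x := by
    intro g hg
    rw [Measure.volume_eq_prod, lintegral_prod _ hg.aemeasurable]
  have h2 : ∀ G : E3 → E3 → E3 → E3 → ℝ≥0∞,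
      (Measurable fun x : (E3 × E3) × E3 × E3 => G x.1.1 x.1.2 x.2.1 x.2.2) →
      ∫⁻ a, ∫⁻ b, ∫⁻ c, ∫⁻ d, G a b c d = ∫⁻ x : E3 × E3, ∫⁻ y : E3 × E3, G x.1 x.2 y.1 y.2 := by
    intro G hG
    rw [← h1 _ hG.lintegral_prod_right']
    refine lintegral_congr fun a => lintegral_congr fun b => ?_
    exact h1 (fun y => G a b y.1 y.2) (hG.comp (by fun_prop : Measurable fun y => ((a, b), y)))
  rw [h2 F hF, h2 (fun c d a b => F a b c d) (hF.comp measurable_swap)]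
  exact lintegral_lintegral_swap hF.aemeasurable

theorem shell_neg (v : E3) : shell (-v) = shell v := by simp [shell]

theorem shell_ne_top (v : E3) : shell v ≠ ∞ := by unfold shell; split_ifs <;> simp

theorem dirVolume_eq_lintegral (O : Set (ℝ × ℝ)) : dirVolume O =
    ∫⁻ a, ∫⁻ b, ∫⁻ e, ∫⁻ c, ∫⁻ d, shell a * shell b * shell e * (shell c * shell d *
      treeDensity O a b e c d) := by
  refine lintegral_congr fun a => lintegral_congr fun b => lintegral_congr fun e => ?_
  have h := ENNReal.mul_ne_top (ENNReal.mul_ne_top (shell_ne_top a) (shell_ne_top b))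
    (shell_ne_top e)
  rw [← lintegral_const_mul' _ _ h]
  refine lintegral_congr fun c => ?_
  rw [← lintegral_const_mul' _ _ h]

/-- The sets of directions of the separated and the nested tree have the same volume. -/
theorem dirVolume_nested : dirVolume nested = dirVolume separated := by
  rw [dirVolume_eq_lintegral, dirVolume_eq_lintegral]
  refine lintegral_congr fun a => ?_
  rw [lintegral_neg_E3]
  conv_lhs => enter [2, b]; rw [lintegral_neg_E3]
  rw [lintegral_swap_pairs]
  · refine lintegral_congr fun b => lintegral_congr fun e => lintegral_congr fun c =>
      lintegral_congr fun d => ?_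
    have : treeDensity nested a (-c) (-d) b e = treeDensity separated a b e c d := by
      have h : treeRegion nested a (-c) (-d) b e ↔ treeRegion separated a b e c d := by
        rw [treeRegion_separated_iff, treeRegion_nested_iff, nestedSigns_iff_separatedSigns]
      unfold treeDensity
      split_ifs <;> tauto
    rw [shell_neg, shell_neg, this]
    ring
  · have := measurable_treeDensity measurableSet_nested lt_of_mem_nested
      (α := (E3 × E3) × E3 × E3) (a := fun _ => a) (b := fun x => -x.1.1) (e := fun x => -x.1.2)
      (c := fun x => x.2.1) (d := fun x => x.2.2) (by fun_prop) (by fun_prop) (by fun_prop)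
      (by fun_prop) (by fun_prop)
    fun_prop

theorem lintegral_shell_lt_top : ∫⁻ v, shell v < ∞ := by
  have h : ∀ v, shell v ≤ (Metric.ball (0 : E3) 2).indicator 1 v := by
    intro v
    unfold shell
    split_ifs with hv
    · rw [indicator_of_mem (by simpa using hv.2)]
      simp
    · simp
  refine (lintegral_mono h).trans_lt ?_
  rw [lintegral_indicator_one Metric.isOpen_ball.measurableSet]
  exact measure_ball_lt_top

theorem dirVolume_lt_top (O : Set (ℝ × ℝ)) : dirVolume O < ∞ := by
  have h : dirVolume O ≤ ∫⁻ a, ∫⁻ b, ∫⁻ e, shell a * shell b * shell e *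
      ∫⁻ c, ∫⁻ d, shell c * shell d * 1 := by
    refine lintegral_mono fun a => lintegral_mono fun b => lintegral_mono fun e => ?_
    dsimp only
    gcongr with c d
    unfold treeDensity
    split_ifs <;> simp
  refine h.trans_lt ?_
  simp only [mul_one, lintegral_const_mul' _ _ (shell_ne_top _), lintegral_mul_const _ measurable_shell,
    mul_assoc]
  have := lintegral_shell_lt_top
  finiteness

/-! ### From normalized configurations to directions of edges -/

/-- The absolute value of the form on the configurations of a tree with axis `s`, trivalent
vertices at `p`, `q` and univalent vertices at the abscissas `0`, `x 0` (joined to `p`), `x 1`,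
`x 2` (joined to `q`), without the factor of the edge between the trivalent vertices. -/
noncomputable def axisDensity (O : Set (ℝ × ℝ)) (s p q : E3) (x : Fin 3 → ℝ) : ℝ≥0∞ :=
  open Classical in
  if 0 < x 0 ∧ (x 1 / x 0, x 2 / x 0) ∈ O then
    ENNReal.ofReal (x 0 * (x 2 - x 1) * triple s p q ^ 2) * invCube p * invCube (x 0 • s - p) *
      invCube (x 1 • s - q) * invCube (x 2 • s - q)
  else 0

theorem measurable_axisDensity {O : Set (ℝ × ℝ)} (hO : MeasurableSet O) {α : Type*}
    [MeasurableSpace α] {s p q : α → E3} {x : α → Fin 3 → ℝ} (hs : Measurable s)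
    (hp : Measurable p) (hq : Measurable q) (hx : Measurable x) :
    Measurable fun t => axisDensity O (s t) (p t) (q t) (x t) := by
  have h : ∀ i, Measurable fun t => x t i := fun i => (measurable_pi_apply i).comp hx
  have h0 := h 0
  have h1 := h 1
  have h2 := h 2
  refine Measurable.ite ?_ (by fun_prop) measurable_const
  exact (measurableSet_lt measurable_const h0).inter
    (hO.preimage (by fun_prop : Measurable fun t => (x t 1 / x t 0, x t 2 / x t 0)))

theorem invCube_smul {t : ℝ} (ht : 0 < t) (v : E3) :
    invCube (t • v) = ENNReal.ofReal (t ^ 3)⁻¹ * invCube v := by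
  rw [invCube, invCube, norm_smul, Real.norm_eq_abs, abs_of_pos ht,
    ← ENNReal.ofReal_mul (by positivity), mul_pow, mul_inv]

theorem axisDensity_smul (O : Set (ℝ × ℝ)) {t : ℝ} (ht : 0 < t) (s p q : E3) (x : Fin 3 → ℝ) :
    axisDensity O s (t • p) (t • q) (t • x) = ENNReal.ofReal (t ^ 6)⁻¹ * axisDensity O s p q x := by
  have hc : (0 < (t • x) 0 ∧ ((t • x) 1 / (t • x) 0, (t • x) 2 / (t • x) 0) ∈ O) ↔
      (0 < x 0 ∧ (x 1 / x 0, x 2 / x 0) ∈ O) := by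
    simp only [Pi.smul_apply, smul_eq_mul, mul_pos_iff_of_pos_left ht, mul_div_mul_left _ _ ht.ne']
  unfold axisDensity
  by_cases h0 : 0 < x 0 ∧ (x 1 / x 0, x 2 / x 0) ∈ O
  · rw [if_pos h0, if_pos (hc.2 h0)]
    simp only [Pi.smul_apply, smul_eq_mul, mul_smul, ← smul_sub, invCube_smul ht]
    have h : triple s (t • p) (t • q) = t ^ 2 * triple s p q := by
      simp only [triple_eq, PiLp.smul_apply, smul_eq_mul]; ring
    have e : t * x 0 * (t * x 2 - t * x 1) * triple s (t • p) (t • q) ^ 2 =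
        t ^ 6 * (x 0 * (x 2 - x 1) * triple s p q ^ 2) := by rw [h]; ring
    rw [e, ENNReal.ofReal_mul (by positivity)]
    have key : ENNReal.ofReal (t ^ 6) * ENNReal.ofReal (t ^ 3)⁻¹ * ENNReal.ofReal (t ^ 3)⁻¹ *
        ENNReal.ofReal (t ^ 3)⁻¹ * ENNReal.ofReal (t ^ 3)⁻¹ = ENNReal.ofReal (t ^ 6)⁻¹ := by
      rw [← ENNReal.ofReal_mul (by positivity), ← ENNReal.ofReal_mul (by positivity),
        ← ENNReal.ofReal_mul (by positivity), ← ENNReal.ofReal_mul (by positivity)]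
      congr 1
      field_simp
    rw [← key]
    ring
  · rw [if_neg h0, if_neg (hc.not.2 h0), mul_zero]

theorem lintegral_axisDensity {O : Set (ℝ × ℝ)} (hO : MeasurableSet O) (p q : E3) :
    ∫⁻ s : Metric.sphere (0 : E3) 1, ∫⁻ x, axisDensity O s p q x ∂volume ∂sphereMeasure (Fin 3) =
      ∫⁻ b, ∫⁻ u in O, configDensity b p q u := by
  have hm : Measurable fun x : E3 × (ℝ × ℝ) => configDensity x.1 p q x.2 := by
    unfold configDensity
    fun_prop
  have hI : Measurable fun b => ∫⁻ u in O, configDensity b p q u := hm.lintegral_prod_right'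
  rw [lintegral_polar _ hI]
  refine lintegral_congr fun s => ?_
  rw [lintegral_fin_three _ (measurable_axisDensity hO (x := fun x => x) measurable_const
    measurable_const measurable_const measurable_id), ← lintegral_indicator measurableSet_Ioi]
  refine lintegral_congr fun z => ?_
  by_cases hz : 0 < z
  · rw [indicator_of_mem (mem_Ioi.2 hz), ← lintegral_indicator hO, Measure.volume_eq_prod,
      lintegral_prod _ ((by fun_prop : Measurable fun u =>
        configDensity (z • (s : E3)) p q u).indicator hO).aemeasurable,
      lintegral_mul_left hz, show Fintype.card (Fin 3) - 1 = 2 from rfl, sq,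
      ENNReal.ofReal_mul hz.le, mul_assoc]
    congr 1
    rw [← lintegral_const_mul' _ _ ENNReal.ofReal_ne_top]
    refine lintegral_congr fun u => ?_
    rw [lintegral_mul_left hz]
    congr 1
    refine lintegral_congr fun v => ?_
    have hc : (0 < (![z, z * u, z * v] : Fin 3 → ℝ) 0 ∧
        ((![z, z * u, z * v] : Fin 3 → ℝ) 1 / (![z, z * u, z * v] : Fin 3 → ℝ) 0,
        (![z, z * u, z * v] : Fin 3 → ℝ) 2 / (![z, z * u, z * v] : Fin 3 → ℝ) 0) ∈ O) ↔
        (u, v) ∈ O := by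
      simp [hz, mul_div_cancel_left₀ _ hz.ne']
    unfold axisDensity
    by_cases h0 : (u, v) ∈ O
    · rw [if_pos (hc.2 h0), indicator_of_mem h0]
      have h : triple (z • (s : E3)) p q = z * triple s p q := by
        simp only [triple_eq, PiLp.smul_apply, smul_eq_mul]; ring
      simp only [configDensity, h, smul_smul, mul_comm u z, mul_comm v z, Matrix.cons_val_zero,
        Matrix.cons_val_one, Matrix.cons_val]
      have e : z * (z * v - z * u) * triple (s : E3) p q ^ 2 =
        (v - u) * (z * triple (s : E3) p q) ^ 2 := by ring
      rw [e]
    · rw [if_neg (hc.not.2 h0), indicator_of_notMem h0]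
  · rw [indicator_of_notMem (by simpa using hz)]
    simp [axisDensity, hz]

section Coordinates

variable {ι : Type} [Fintype ι] (φ : Fin 3 ⊕ Fin 3 ⊕ Fin 3 ≃ ι)

/-- The first three of nine coordinates. -/
def firstCoords (y : EuclideanSpace ℝ ι) : E3 := WithLp.toLp 2 fun i => y (φ (Sum.inl i))

/-- The three middle coordinates among nine. -/
def secondCoords (y : EuclideanSpace ℝ ι) : E3 := WithLp.toLp 2 fun i => y (φ (Sum.inr (Sum.inl i)))

/-- The last three of nine coordinates. -/
def thirdCoords (y : EuclideanSpace ℝ ι) : Fin 3 → ℝ := fun i => y (φ (Sum.inr (Sum.inr i)))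

theorem lintegral_coords (G : E3 → E3 → (Fin 3 → ℝ) → ℝ≥0∞)
    (hG : Measurable fun x : E3 × E3 × (Fin 3 → ℝ) => G x.1 x.2.1 x.2.2) :
    ∫⁻ y, G (firstCoords φ y) (secondCoords φ y) (thirdCoords φ y) = ∫⁻ p, ∫⁻ q, ∫⁻ x, G p q x := by
  have e3 : ∀ f : E3 → ℝ≥0∞, ∫⁻ p, f p = ∫⁻ p : Fin 3 → ℝ, f (WithLp.toLp 2 p) := fun f =>
    ((EuclideanSpace.volume_preserving_symm_measurableEquiv_toLp (Fin 3)).symm.lintegral_comp_emb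
      (MeasurableEquiv.measurableEmbedding _) f).symm
  have h1 := (EuclideanSpace.volume_preserving_symm_measurableEquiv_toLp ι).symm
  have h2 := volume_measurePreserving_piCongrLeft (fun _ : ι => ℝ) φ
  have h3 := (volume_measurePreserving_sumPiEquivProdPi
    (fun _ : Fin 3 ⊕ Fin 3 ⊕ Fin 3 => ℝ)).symm
  have h4 := (volume_measurePreserving_sumPiEquivProdPi (fun _ : Fin 3 ⊕ Fin 3 => ℝ)).symm
  rw [← h1.lintegral_comp_emb (MeasurableEquiv.measurableEmbedding _),
    ← h2.lintegral_comp_emb (MeasurableEquiv.measurableEmbedding _),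
    ← h3.lintegral_comp_emb (MeasurableEquiv.measurableEmbedding _)]
  have hL : Measurable fun p : Fin 3 → ℝ => (WithLp.toLp 2 p : E3) :=
    (EuclideanSpace.volume_preserving_symm_measurableEquiv_toLp (Fin 3)).symm.measurable
  have key : ∀ y : (Fin 3 → ℝ) × (Fin 3 ⊕ Fin 3 → ℝ),
      G (firstCoords φ ((MeasurableEquiv.toLp 2 (ι → ℝ)) (MeasurableEquiv.piCongrLeft (fun _ => ℝ) φ
        ((MeasurableEquiv.sumPiEquivProdPi (fun _ : Fin 3 ⊕ Fin 3 ⊕ Fin 3 => ℝ)).symm y))))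
      (secondCoords φ ((MeasurableEquiv.toLp 2 (ι → ℝ)) (MeasurableEquiv.piCongrLeft (fun _ => ℝ) φ
        ((MeasurableEquiv.sumPiEquivProdPi (fun _ : Fin 3 ⊕ Fin 3 ⊕ Fin 3 => ℝ)).symm y))))
      (thirdCoords φ ((MeasurableEquiv.toLp 2 (ι → ℝ)) (MeasurableEquiv.piCongrLeft (fun _ => ℝ) φ
        ((MeasurableEquiv.sumPiEquivProdPi (fun _ : Fin 3 ⊕ Fin 3 ⊕ Fin 3 => ℝ)).symm y)))) =
      G (WithLp.toLp 2 y.1) (WithLp.toLp 2 fun i => y.2 (Sum.inl i)) (fun i => y.2 (Sum.inr i)) := by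
    intro y
    have hc : ∀ j, MeasurableEquiv.toLp 2 (ι → ℝ) (MeasurableEquiv.piCongrLeft (fun _ => ℝ) φ
        ((MeasurableEquiv.sumPiEquivProdPi (fun _ : Fin 3 ⊕ Fin 3 ⊕ Fin 3 => ℝ)).symm y)) (φ j) =
        Sum.elim y.1 y.2 j := by
      intro j
      rw [MeasurableEquiv.coe_toLp]
      simp only [MeasurableEquiv.coe_piCongrLeft, Equiv.piCongrLeft_apply_apply]
      cases j <;> rfl
    have k1 := congrArg (WithLp.toLp 2) (funext fun i => hc (Sum.inl i))
    have k2 := congrArg (WithLp.toLp 2) (funext fun i => hc (Sum.inr (Sum.inl i)))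
    have k3 := funext fun i => hc (Sum.inr (Sum.inr i))
    exact congr (congr (congrArg G k1) k2) k3
  refine (lintegral_congr key).trans ?_
  rw [Measure.volume_eq_prod, lintegral_prod _ (by fun_prop), e3]
  refine lintegral_congr fun p => ?_
  rw [← h4.lintegral_comp_emb (MeasurableEquiv.measurableEmbedding _), Measure.volume_eq_prod,
    lintegral_prod _ ?_, e3]
  · rfl
  · fun_prop

theorem lintegral_sphere_axisDensity {O : Set (ℝ × ℝ)} (hO : MeasurableSet O) (s : E3) :
    shellMass * ∫⁻ y : Metric.sphere (0 : EuclideanSpace ℝ ι) 1,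
      axisDensity O s (firstCoords φ y) (secondCoords φ y) (thirdCoords φ y) *
        invCube (secondCoords φ y.1 - firstCoords φ y.1) ∂sphereMeasure ι =
    ∫⁻ p, ∫⁻ q, ∫⁻ x, axisDensity O s p q x * shell (q - p) := by
  have hm := measurable_axisDensity hO (α := E3 × E3 × (Fin 3 → ℝ)) (s := fun _ => s)
    (p := fun x => x.1) (q := fun x => x.2.1) (x := fun x => x.2.2) (by fun_prop) (by fun_prop)
    (by fun_prop) (by fun_prop)
  have : Nonempty ι := ⟨φ (Sum.inl 0)⟩
  have h9 : Fintype.card ι = 9 := by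
    rw [← Fintype.card_congr φ]; rfl
  have hp : Measurable (firstCoords φ) := by unfold firstCoords; fun_prop
  have hq : Measurable (secondCoords φ) := by unfold secondCoords; fun_prop
  have hx : Measurable (thirdCoords φ) := by unfold thirdCoords; fun_prop
  have hax : Measurable fun y => axisDensity O s (firstCoords φ y) (secondCoords φ y)
    (thirdCoords φ y) := measurable_axisDensity hO measurable_const hp hq hx
  rw [← lintegral_coords φ (fun p q x => axisDensity O s p q x * shell (q - p))
    (by fun_prop), lintegral_polar _ (by fun_prop), ← lintegral_const_mul' _ _ shellMass_ne_top, h9]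
  refine lintegral_congr fun y => ?_
  have h1 : ∀ t ∈ Ioi (0 : ℝ), ENNReal.ofReal (t ^ (9 - 1)) *
      (axisDensity O s (firstCoords φ (t • y.1)) (secondCoords φ (t • y.1))
        (thirdCoords φ (t • y.1)) * shell (secondCoords φ (t • y.1) - firstCoords φ (t • y.1))) =
      axisDensity O s (firstCoords φ y) (secondCoords φ y) (thirdCoords φ y) *
        (ENNReal.ofReal (t ^ 2) * shell (t • (secondCoords φ y.1 - firstCoords φ y.1))) := by
    intro t ht
    have ht : 0 < t := ht
    have e1 : firstCoords φ (t • y.1) = t • firstCoords φ y.1 := rfl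
    have e2 : secondCoords φ (t • y.1) = t • secondCoords φ y.1 := rfl
    have e3 : thirdCoords φ (t • y.1) = t • thirdCoords φ y.1 := rfl
    rw [e1, e2, e3, axisDensity_smul O ht, ← smul_sub]
    have : ENNReal.ofReal (t ^ (9 - 1)) * ENNReal.ofReal (t ^ 6)⁻¹ = ENNReal.ofReal (t ^ 2) := by
      rw [← ENNReal.ofReal_mul (by positivity)]
      congr 1
      field_simp
    rw [← this]
    ring
  rw [setLIntegral_congr_fun measurableSet_Ioi h1, lintegral_const_mul _ (by fun_prop),
    lintegral_shell_smul]
  ring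

/-- The integral over the normalized configurations of a tree is, up to the constant coming from
the shells, the volume of the set of the directions of its edges. -/
theorem lintegral_normalized {O : Set (ℝ × ℝ)} (hO : MeasurableSet O) (hlt : ∀ u ∈ O, u.1 < u.2) :
    shellMass ^ 5 * ∫⁻ s : Metric.sphere (0 : E3) 1,
      ∫⁻ y : Metric.sphere (0 : EuclideanSpace ℝ ι) 1,
        axisDensity O s (firstCoords φ y) (secondCoords φ y) (thirdCoords φ y) *
          invCube (secondCoords φ y.1 - firstCoords φ y.1) ∂sphereMeasure ι ∂sphereMeasure (Fin 3) =
    dirVolume O := by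
  have hm := measurable_axisDensity hO (α := (Metric.sphere (0 : E3) 1 × E3 × E3) × (Fin 3 → ℝ))
    (s := fun x => x.1.1) (p := fun x => x.1.2.1) (q := fun x => x.1.2.2) (x := fun x => x.2)
    (by fun_prop) (by fun_prop) (by fun_prop) (by fun_prop)
  have hm2 : Measurable fun x : Metric.sphere (0 : E3) 1 × E3 × E3 =>
      ∫⁻ z, axisDensity O x.1 x.2.1 x.2.2 z := hm.lintegral_prod_right'
  have hm3 : Measurable fun x : (Metric.sphere (0 : E3) 1 × E3) × E3 =>
      (∫⁻ z, axisDensity O x.1.1 x.1.2 x.2 z) * shell (x.2 - x.1.2) := by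
    have := hm2.comp (MeasurableEquiv.prodAssoc (α := Metric.sphere (0 : E3) 1) (β := E3)
      (γ := E3)).measurable
    exact this.mul (by fun_prop)
  have hcfg : ∀ p : E3, Measurable fun x : E3 × E3 × (ℝ × ℝ) => configDensity x.1 p x.2.1 x.2.2 := by
    intro p
    unfold configDensity
    fun_prop
  rw [dirVolume_eq hO hlt, pow_succ, mul_assoc, ← lintegral_const_mul' _ _ shellMass_ne_top]
  congr 1
  simp_rw [lintegral_sphere_axisDensity φ hO, lintegral_mul_const' _ _ (shell_ne_top _)]
  rw [lintegral_lintegral_swap hm3.lintegral_prod_right'.aemeasurable]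
  refine lintegral_congr fun p => ?_
  rw [lintegral_lintegral_swap (f := fun (s : Metric.sphere (0 : E3) 1) q =>
    (∫⁻ z, axisDensity O s p q z) * shell (q - p)) (hm3.comp (by fun_prop :
    Measurable fun x : Metric.sphere (0 : E3) 1 × E3 => ((x.1, p), x.2))).aemeasurable]
  simp_rw [lintegral_mul_const' _ _ (shell_ne_top _), lintegral_axisDensity hO]
  have hsw : Measurable fun x : E3 × E3 => ∫⁻ u in O, configDensity x.1 p x.2 u :=
    ((hcfg p).comp (MeasurableEquiv.prodAssoc (α := E3) (β := E3)
      (γ := ℝ × ℝ)).measurable).lintegral_prod_right'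
  have hq : ∀ q : E3, (∫⁻ b, ∫⁻ u in O, configDensity b p q u) * shell (q - p) =
      ∫⁻ b, shell (q - p) * ∫⁻ u in O, configDensity b p q u := by
    intro q
    rw [lintegral_const_mul' _ _ (shell_ne_top _), mul_comm]
  simp_rw [hq]
  refine (lintegral_lintegral_swap ?_)
  exact ((by fun_prop : Measurable fun x : E3 × E3 => shell (x.1 - p)).mul
    (hsw.comp measurable_swap)).aemeasurable

end Coordinates

namespace ConnOriented

variable {n : ℕ} (Γ : ConnOriented n)

/-! ### The differential of the displacements -/

/-- The velocity of the vertex `v` when the axis and the coordinates `p` vary with the speed `q`. -/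
noncomputable def velocity (p q : E3 × (Γ.HalfEdge → ℝ)) (v : Fin (2 * n)) : E3 :=
  open Classical in
  ∑ h : Γ.HalfEdge, if h.1.1 = v then
    q.2 h • Γ.frame p.1 h + p.2 h • (if Γ.IsUni h.1.1 then q.1 else 0) else 0

theorem hasFDerivAt_frame (p : E3 × (Γ.HalfEdge → ℝ)) (h : Γ.HalfEdge) :
    open Classical in
    HasFDerivAt (fun p : E3 × (Γ.HalfEdge → ℝ) => Γ.frame p.1 h)
      (if Γ.IsUni h.1.1 then ContinuousLinearMap.fst ℝ E3 (Γ.HalfEdge → ℝ) else 0) p := by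
  unfold frame
  split_ifs
  · exact hasFDerivAt_fst
  · exact hasFDerivAt_const _ _

theorem hasFDerivAt_position (p : E3 × (Γ.HalfEdge → ℝ)) (v : Fin (2 * n)) :
    ∃ L : E3 × (Γ.HalfEdge → ℝ) →L[ℝ] E3,
      HasFDerivAt (fun p : E3 × (Γ.HalfEdge → ℝ) => Γ.position p.1 p.2 v) L p ∧
      ∀ q, L q = Γ.velocity p q v := by
  classical
  have hc : ∀ h : Γ.HalfEdge, HasFDerivAt (fun p : E3 × (Γ.HalfEdge → ℝ) => p.2 h)
      ((ContinuousLinearMap.proj (R := ℝ) (φ := fun _ : Γ.HalfEdge => ℝ) h).comp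
        (ContinuousLinearMap.snd ℝ E3 (Γ.HalfEdge → ℝ))) p := fun h =>
    ((ContinuousLinearMap.proj (R := ℝ) (φ := fun _ : Γ.HalfEdge => ℝ) h).comp
        (ContinuousLinearMap.snd ℝ E3 (Γ.HalfEdge → ℝ))).hasFDerivAt
  have hs : ∀ h : Γ.HalfEdge, ∃ L : E3 × (Γ.HalfEdge → ℝ) →L[ℝ] E3,
      HasFDerivAt (fun p : E3 × (Γ.HalfEdge → ℝ) =>
        if h.1.1 = v then p.2 h • Γ.frame p.1 h else 0) L p ∧ ∀ q, L q = if h.1.1 = v then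
        q.2 h • Γ.frame p.1 h + p.2 h • (if Γ.IsUni h.1.1 then q.1 else 0) else 0 := by
    intro h
    split_ifs with hv hu
    · refine ⟨_, (hc h).smul (Γ.hasFDerivAt_frame p h), fun q => ?_⟩
      simp [hu, add_comm]
    · refine ⟨_, (hc h).smul (Γ.hasFDerivAt_frame p h), fun q => ?_⟩
      simp [hu]
    · exact ⟨_, hasFDerivAt_const _ _, fun q => rfl⟩
  choose L hL hLq using hs
  refine ⟨_, HasFDerivAt.fun_sum fun h _ => hL h, fun q => ?_⟩
  rw [_root_.sum_apply, velocity]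
  exact Finset.sum_congr rfl fun h _ => hLq h q

theorem fderiv_displacement (p q : E3 × (Γ.HalfEdge → ℝ)) (e : Γ.Edge) :
    fderiv ℝ Γ.displacement p q e = Γ.velocity p q e.1.2 - Γ.velocity p q e.1.1 := by
  choose L hL hLq using fun v => Γ.hasFDerivAt_position p v
  have h : HasFDerivAt Γ.displacement
      (ContinuousLinearMap.pi fun e : Γ.Edge => L e.1.2 - L e.1.1) p :=
    hasFDerivAt_pi.2 fun e => (hL e.1.2).sub (hL e.1.1)
  rw [h.fderiv]
  simp [hLq]

end ConnOriented

/-! ### The bordered matrix of a tree -/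

theorem treeMatrix_length (xb xc xd : ℝ) (s p q : Fin 3 → ℝ) (k k' : Fin 5) (m : Fin 3) :
    treeMatrix xb xc xd s p q (Sum.inl (k, m)) (Sum.inl (Sum.inl k')) =
      if k = k' then treeEdgeCoord xb xc xd k 0 * s m + treeEdgeCoord xb xc xd k 1 * p m +
        treeEdgeCoord xb xc xd k 2 * q m else 0 := by
  simp only [treeMatrix, Matrix.fromBlocks_apply₁₁, Matrix.mul_apply, Fintype.sum_prod_type,
    Matrix.kroneckerMap_apply, treeScaleLeg, Matrix.of_apply, Sum.elim_inl, Fin.sum_univ_three,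
    Matrix.one_apply]
  rw [Finset.sum_eq_single k (fun b _ hb => by simp [hb.symm]) (by simp)]
  by_cases h : k = k'
  · subst h
    simp [treeFrame]
    ring
  · simp [h]

theorem treeMatrix_leg (xb xc xd : ℝ) (s p q : Fin 3 → ℝ) (k : Fin 5) (l : Fin 4) (m : Fin 3) :
    treeMatrix xb xc xd s p q (Sum.inl (k, m)) (Sum.inl (Sum.inr l)) =
      if k = l.castSucc then s m else 0 := by
  simp only [treeMatrix, Matrix.fromBlocks_apply₁₁, Matrix.mul_apply, Fintype.sum_prod_type,
    Matrix.kroneckerMap_apply, treeScaleLeg, Matrix.of_apply, Sum.elim_inr, Fin.sum_univ_three,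
    Matrix.one_apply]
  split_ifs with h
  · subst h
    simp [treeFrame]
  · simp [h]

theorem treeMatrix_point (xb xc xd : ℝ) (s p q : Fin 3 → ℝ) (k : Fin 5) (m : Fin 3)
    (c : Fin 3 × Fin 3) :
    treeMatrix xb xc xd s p q (Sum.inl (k, m)) (Sum.inr c) =
      if m = c.2 then treeIncidence xb xc xd k c.1 else 0 := by
  simp [treeMatrix, Matrix.one_apply]

/-- The trivalent end of an edge of the standard tree, which has the univalent vertices
`0, 1, 2, 3` and the trivalent vertices `4` (joined to `0`, `1`, `5`) and `5`
(joined to `2`, `3`, `4`); the edge `4` joins the trivalent vertices. -/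
def treeTail : Fin 5 → Fin (2 * 3) := ![4, 4, 5, 5, 4]

/-- The other end of an edge of the standard tree. -/
def treeHead : Fin 5 → Fin (2 * 3) := ![0, 1, 2, 3, 5]

/-- Adjacency in the standard tree. -/
def treeAdj (i j : Fin (2 * 3)) : Prop :=
  ∃ k, (treeTail k = i ∧ treeHead k = j) ∨ (treeTail k = j ∧ treeHead k = i)

instance : DecidableRel treeAdj := fun i j => by unfold treeAdj; infer_instance

theorem treeAdj_tail_head (k : Fin 5) : treeAdj (treeTail k) (treeHead k) := ⟨k, Or.inl ⟨rfl, rfl⟩⟩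

theorem treeAdj_symm {i j : Fin (2 * 3)} (h : treeAdj i j) : treeAdj j i := by
  obtain ⟨k, h⟩ := h
  exact ⟨k, h.symm⟩

/-- The trivalent vertices of the standard tree. -/
def treeCenter : Fin 2 → Fin (2 * 3) := ![4, 5]

/-- The neighbours of a trivalent vertex of the standard tree. -/
def treeNbr : Fin 2 → Fin 3 → Fin (2 * 3) := ![![0, 1, 5], ![2, 3, 4]]

theorem treeAdj_center (j : Fin 2) (k : Fin 3) : treeAdj (treeCenter j) (treeNbr j k) := by
  revert j k; decide

/-- The columns of the tree matrix as indices of the bordered matrix of the standard tree: at an edge,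
`0` is for its length, `1` and `2` are for its tail and its head. -/
def treeSlot : TreeCol → TreeRow
  | Sum.inl (Sum.inl k) => Sum.inl (k, 0)
  | Sum.inl (Sum.inr l) => Sum.inl (l.castSucc, 2)
  | Sum.inr (j, m) => ![![Sum.inl (0, 1), Sum.inl (1, 1), Sum.inl (4, 1)],
      ![Sum.inl (2, 1), Sum.inl (3, 1), Sum.inl (4, 2)], ![Sum.inr 0, Sum.inr 1, Sum.inr 2]] j m

theorem treeSlot_bijective : Function.Bijective treeSlot := by decide

/-- The bijection `treeSlot`. -/
noncomputable def treeSlotEquiv : TreeCol ≃ TreeRow := Equiv.ofBijective treeSlot treeSlot_bijective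

/-! ### Labellings by the standard tree -/

theorem treeHead_castSucc_injective : Function.Injective fun l : Fin 4 => treeHead l.castSucc := by
  decide

/-- The two ends of the half-edges of the standard tree: the legs at the univalent vertices, and
the half-edges at the trivalent vertices. -/
def treeHalfEnds : Fin 4 ⊕ Fin 2 × Fin 3 → Fin (2 * 3) × Fin (2 * 3) :=
  Sum.elim (fun l => (treeHead l.castSucc, treeTail l.castSucc))
    fun x => (treeCenter x.1, treeNbr x.1 x.2)

theorem treeHalfEnds_injective : Function.Injective treeHalfEnds := by decide

theorem treeAdj_treeHalfEnds (x : Fin 4 ⊕ Fin 2 × Fin 3) :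
    treeAdj (treeHalfEnds x).1 (treeHalfEnds x).2 := by
  revert x; decide

theorem exists_treeHalfEnds {i j : Fin (2 * 3)} (h : treeAdj i j) :
    ∃ x, treeHalfEnds x = (i, j) := by
  revert i j; decide

/-- The permutation of the three indices at an edge that exchanges its two halves if the labelling
reverses its direction, i.e. if the tail gets a larger label than the head. -/
def treeFlip (σ : Equiv.Perm (Fin (2 * 3))) (k : Fin 5) : Equiv.Perm (Fin 3) :=
  if σ (treeTail k) < σ (treeHead k) then 1 else Equiv.swap 1 2

namespace ConnOriented

variable {Γ : ConnOriented 3} {σ : Equiv.Perm (Fin (2 * 3))}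

theorem ncard_neighborSet_label (hσ : ∀ i j, Γ.graph.Adj (σ i) (σ j) ↔ treeAdj i j)
    (v : Fin (2 * 3)) :
    (Γ.graph.neighborSet (σ v)).ncard = (Finset.univ.filter (treeAdj v)).card := by
  have : Γ.graph.neighborSet (σ v) = σ '' (Finset.univ.filter (treeAdj v) : Finset (Fin (2 * 3))) := by
    ext w
    obtain ⟨w, rfl⟩ := σ.surjective w
    simp [hσ]
  rw [this, ncard_image_of_injective _ σ.injective, ncard_coe_finset]

theorem isUni_label (hσ : ∀ i j, Γ.graph.Adj (σ i) (σ j) ↔ treeAdj i j) (l : Fin 4) :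
    Γ.IsUni (σ (treeHead l.castSucc)) := by
  rw [Diagram.IsUni, ncard_neighborSet_label hσ]
  revert l; decide

theorem isTri_label (hσ : ∀ i j, Γ.graph.Adj (σ i) (σ j) ↔ treeAdj i j) (j : Fin 2) :
    Γ.IsTri (σ (treeCenter j)) := by
  rw [Diagram.IsTri, ncard_neighborSet_label hσ]
  revert j; decide

theorem not_isUni_label (hσ : ∀ i j, Γ.graph.Adj (σ i) (σ j) ↔ treeAdj i j) (j : Fin 2) :
    ¬ Γ.IsUni (σ (treeCenter j)) := by
  have h := isTri_label hσ j
  rw [Diagram.IsTri] at h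
  rw [Diagram.IsUni, h]
  norm_num

/-- The half-edges of a tree labelled by the standard tree. -/
def treeHalf (hσ : ∀ i j, Γ.graph.Adj (σ i) (σ j) ↔ treeAdj i j) (x : Fin 4 ⊕ Fin 2 × Fin 3) :
    Γ.HalfEdge :=
  ⟨(σ (treeHalfEnds x).1, σ (treeHalfEnds x).2), (hσ _ _).2 (treeAdj_treeHalfEnds x)⟩

theorem treeHalf_bijective (hσ : ∀ i j, Γ.graph.Adj (σ i) (σ j) ↔ treeAdj i j) :
    Function.Bijective (treeHalf hσ) := by
  constructor
  · intro x y h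
    have h' := congrArg Subtype.val h
    simp only [treeHalf, Prod.mk.injEq, EmbeddingLike.apply_eq_iff_eq] at h'
    exact treeHalfEnds_injective (Prod.ext h'.1 h'.2)
  · rintro ⟨⟨v, w⟩, h⟩
    obtain ⟨i, rfl⟩ := σ.surjective v
    obtain ⟨j, rfl⟩ := σ.surjective w
    obtain ⟨x, hx⟩ := exists_treeHalfEnds ((hσ i j).1 h)
    refine ⟨x, Subtype.ext ?_⟩
    simp [treeHalf, hx]

theorem sum_halfEdge (hσ : ∀ i j, Γ.graph.Adj (σ i) (σ j) ↔ treeAdj i j) {M : Type*}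
    [AddCommMonoid M] (g : Γ.HalfEdge → M) :
    ∑ h, g h = ∑ l, g (treeHalf hσ (Sum.inl l)) + ∑ j, ∑ k, g (treeHalf hσ (Sum.inr (j, k))) := by
  rw [← (Equiv.ofBijective _ (treeHalf_bijective hσ)).sum_comp, Fintype.sum_sum_type,
    Fintype.sum_prod_type]
  rfl

theorem sum_halfEdge_at_leaf (hσ : ∀ i j, Γ.graph.Adj (σ i) (σ j) ↔ treeAdj i j) {M : Type*}
    [AddCommMonoid M] (g : Γ.HalfEdge → M) (l : Fin 4) :
    (∑ h, if h.1.1 = σ (treeHead l.castSucc) then g h else 0) = g (treeHalf hσ (Sum.inl l)) := by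
  have h2 : ∀ j, treeCenter j ≠ treeHead l.castSucc := by revert l; decide
  rw [sum_halfEdge hσ, Finset.sum_eq_single l]
  · simp [treeHalf, treeHalfEnds, h2]
  · intro b _ hb
    simp [treeHalf, treeHalfEnds, treeHead_castSucc_injective.eq_iff.not.2 hb]
  · simp

theorem sum_halfEdge_at_center (hσ : ∀ i j, Γ.graph.Adj (σ i) (σ j) ↔ treeAdj i j) {M : Type*}
    [AddCommMonoid M] (g : Γ.HalfEdge → M) (j : Fin 2) :
    (∑ h, if h.1.1 = σ (treeCenter j) then g h else 0) =
      ∑ k, g (treeHalf hσ (Sum.inr (j, k))) := by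
  have h2 : ∀ l : Fin 4, treeHead l.castSucc ≠ treeCenter j := by revert j; decide
  have h3 : Function.Injective treeCenter := by decide
  rw [sum_halfEdge hσ]
  simp [treeHalf, treeHalfEnds, h2, h3.eq_iff]

/-- The cyclic order at a trivalent vertex, as a permutation of its three neighbours. -/
noncomputable def treeCyc (hσ : ∀ i j, Γ.graph.Adj (σ i) (σ j) ↔ treeAdj i j) (j : Fin 2) :
    Equiv.Perm (Fin 3) :=
  Equiv.ofBijective (fun k => Γ.cyc (σ (treeCenter j)) (σ (treeNbr j k)))
    (Finite.injective_iff_bijective.1 fun k k' h => by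
      have hinj : ∀ j, Function.Injective (treeNbr j) := by decide
      exact hinj j (σ.injective (Γ.cyc_injOn _ (isTri_label hσ j)
        ((hσ _ _).2 (treeAdj_center j k)) ((hσ _ _).2 (treeAdj_center j k')) h)))

variable (hσ : ∀ i j, Γ.graph.Adj (σ i) (σ j) ↔ treeAdj i j)

/-- The abscissas of the univalent vertices. -/
def treeAbscissa (c : Γ.HalfEdge → ℝ) (l : Fin 4) : ℝ := c (treeHalf hσ (Sum.inl l))

/-- The positions of the trivalent vertices. -/
noncomputable def treePoint (c : Γ.HalfEdge → ℝ) (j : Fin 2) : E3 :=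
  WithLp.toLp 2 fun i => c (treeHalf hσ (Sum.inr (j, (treeCyc hσ j).symm i)))

theorem sum_smul_frame_center (s : E3) (c : Γ.HalfEdge → ℝ) (j : Fin 2) :
    ∑ k, c (treeHalf hσ (Sum.inr (j, k))) • Γ.frame s (treeHalf hσ (Sum.inr (j, k))) =
      treePoint hσ c j := by
  have hf : ∀ k, Γ.frame s (treeHalf hσ (Sum.inr (j, k))) =
      EuclideanSpace.single (treeCyc hσ j k) 1 := fun k => if_neg (not_isUni_label hσ j)
  simp only [hf]
  rw [← (treeCyc hσ j).symm.sum_comp]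
  ext i
  simp [treePoint, Finset.sum_apply, Pi.single_apply]

theorem position_leaf (s : E3) (c : Γ.HalfEdge → ℝ) (l : Fin 4) :
    Γ.position s c (σ (treeHead l.castSucc)) = treeAbscissa hσ c l • s := by
  rw [position, sum_halfEdge_at_leaf hσ fun h => c h • Γ.frame s h, frame]
  exact congrArg _ (if_pos (isUni_label hσ l))

theorem position_center (s : E3) (c : Γ.HalfEdge → ℝ) (j : Fin 2) :
    Γ.position s c (σ (treeCenter j)) = treePoint hσ c j := by
  rw [position, sum_halfEdge_at_center hσ fun h => c h • Γ.frame s h, sum_smul_frame_center]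

theorem velocity_leaf (p q : E3 × (Γ.HalfEdge → ℝ)) (l : Fin 4) :
    Γ.velocity p q (σ (treeHead l.castSucc)) =
      treeAbscissa hσ q.2 l • p.1 + treeAbscissa hσ p.2 l • q.1 := by
  classical
  have := sum_halfEdge_at_leaf hσ (fun h => q.2 h • Γ.frame p.1 h +
    p.2 h • (if Γ.IsUni h.1.1 then q.1 else 0)) l
  have hu : Γ.IsUni (treeHalf hσ (Sum.inl l)).1.1 := isUni_label hσ l
  rw [frame, if_pos hu, if_pos hu] at this
  rw [velocity, treeAbscissa, treeAbscissa]
  convert this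

theorem velocity_center (p q : E3 × (Γ.HalfEdge → ℝ)) (j : Fin 2) :
    Γ.velocity p q (σ (treeCenter j)) = treePoint hσ q.2 j := by
  classical
  have := sum_halfEdge_at_center hσ (fun h => q.2 h • Γ.frame p.1 h +
    p.2 h • (if Γ.IsUni h.1.1 then q.1 else 0)) j
  have hu : ∀ k, ¬ Γ.IsUni (treeHalf hσ (Sum.inr (j, k))).1.1 := fun _ => not_isUni_label hσ j
  simp only [if_neg (hu _), smul_zero, add_zero, sum_smul_frame_center] at this
  rw [velocity]
  convert this

/-- The edges of a tree labelled by the standard tree. -/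
def treeEdge (k : Fin 5) : Γ.Edge :=
  if h : σ (treeTail k) < σ (treeHead k) then
    ⟨(σ (treeTail k), σ (treeHead k)), h, (hσ _ _).2 (treeAdj_tail_head k)⟩
  else ⟨(σ (treeHead k), σ (treeTail k)),
    lt_of_le_of_ne (not_lt.1 h) fun e => by
      have : ∀ k, treeHead k ≠ treeTail k := by decide
      exact this k (σ.injective e), (hσ _ _).2 (treeAdj_symm (treeAdj_tail_head k))⟩

theorem treeEdge_of_lt {k : Fin 5} (h : σ (treeTail k) < σ (treeHead k)) :
    (treeEdge hσ k).1 = (σ (treeTail k), σ (treeHead k)) :=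
  congrArg Subtype.val (dif_pos h)

theorem treeEdge_of_not_lt {k : Fin 5} (h : ¬ σ (treeTail k) < σ (treeHead k)) :
    (treeEdge hσ k).1 = (σ (treeHead k), σ (treeTail k)) :=
  congrArg Subtype.val (dif_neg h)

theorem treeEdge_bijective : Function.Bijective (treeEdge hσ) := by
  have hval : ∀ k, (treeEdge hσ k).1 = (σ (treeTail k), σ (treeHead k)) ∨
      (treeEdge hσ k).1 = (σ (treeHead k), σ (treeTail k)) := by
    intro k
    by_cases h : σ (treeTail k) < σ (treeHead k)
    · exact Or.inl (treeEdge_of_lt hσ h)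
    · exact Or.inr (treeEdge_of_not_lt hσ h)
  constructor
  · have key : ∀ k k', (treeTail k = treeTail k' ∧ treeHead k = treeHead k') ∨
        (treeTail k = treeHead k' ∧ treeHead k = treeTail k') → k = k' := by decide
    intro k k' h
    apply key
    have h' := congrArg Subtype.val h
    rcases hval k with h1 | h1 <;> rcases hval k' with h2 | h2 <;> rw [h1, h2] at h' <;>
      simp only [Prod.mk.injEq, EmbeddingLike.apply_eq_iff_eq] at h' <;> tauto
  · rintro ⟨⟨v, w⟩, hlt, h⟩
    obtain ⟨i, rfl⟩ := σ.surjective v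
    obtain ⟨j, rfl⟩ := σ.surjective w
    obtain ⟨k, ⟨rfl, rfl⟩ | ⟨rfl, rfl⟩⟩ := (hσ i j).1 h
    · exact ⟨k, Subtype.ext (treeEdge_of_lt hσ hlt)⟩
    · exact ⟨k, Subtype.ext (treeEdge_of_not_lt hσ hlt.not_gt)⟩

theorem treeEdge_sub {X : Type*} [AddCommGroup X] [Module ℝ X] (g : Fin (2 * 3) → X) (k : Fin 5) :
    g (treeEdge hσ k).1.2 - g (treeEdge hσ k).1.1 =
      ((Equiv.Perm.sign (treeFlip σ k) : ℤ) : ℝ) • (g (σ (treeHead k)) - g (σ (treeTail k))) := by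
  by_cases h : σ (treeTail k) < σ (treeHead k)
  · rw [treeEdge_of_lt hσ h, treeFlip, if_pos h]
    simp
  · rw [treeEdge_of_not_lt hσ h, treeFlip, if_neg h, Equiv.Perm.sign_swap (by decide)]
    simp

end ConnOriented

/-- A function on the vertices of the standard tree. -/
def treeVertex {X : Type*} (x : Fin 4 → X) (P : Fin 2 → X) : Fin (2 * 3) → X :=
  ![x 0, x 1, x 2, x 3, P 0, P 1]

/-- The permutation of the indices that exchanges the halves of the reversed edges. -/
def treeFlipPerm (σ : Equiv.Perm (Fin (2 * 3))) : Equiv.Perm TreeRow :=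
  Equiv.Perm.sumCongr (Equiv.prodCongrRight (treeFlip σ)) 1

namespace ConnOriented

variable {Γ : ConnOriented 3} {σ : Equiv.Perm (Fin (2 * 3))}
  (hσ : ∀ i j, Γ.graph.Adj (σ i) (σ j) ↔ treeAdj i j)

theorem position_label (s : E3) (c : Γ.HalfEdge → ℝ) (v : Fin (2 * 3)) :
    Γ.position s c (σ v) = treeVertex (fun l => treeAbscissa hσ c l • s) (treePoint hσ c) v := by
  have h : ∀ v : Fin (2 * 3), (∃ l : Fin 4, treeHead l.castSucc = v ∧ ∀ (x : Fin 4 → E3) P,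
      treeVertex x P v = x l) ∨ ∃ j, treeCenter j = v ∧ ∀ (x : Fin 4 → E3) P,
      treeVertex x P v = P j := by
    intro v
    fin_cases v
    exacts [Or.inl ⟨0, rfl, fun _ _ => rfl⟩, Or.inl ⟨1, rfl, fun _ _ => rfl⟩,
      Or.inl ⟨2, rfl, fun _ _ => rfl⟩, Or.inl ⟨3, rfl, fun _ _ => rfl⟩,
      Or.inr ⟨0, rfl, fun _ _ => rfl⟩, Or.inr ⟨1, rfl, fun _ _ => rfl⟩]
  rcases h v with ⟨l, rfl, hv⟩ | ⟨j, rfl, hv⟩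
  · rw [hv, position_leaf hσ]
  · rw [hv, position_center hσ]

theorem velocity_label (p q : E3 × (Γ.HalfEdge → ℝ)) (v : Fin (2 * 3)) :
    Γ.velocity p q (σ v) = treeVertex (fun l => treeAbscissa hσ q.2 l • p.1 +
      treeAbscissa hσ p.2 l • q.1) (treePoint hσ q.2) v := by
  have h : ∀ v : Fin (2 * 3), (∃ l : Fin 4, treeHead l.castSucc = v ∧ ∀ (x : Fin 4 → E3) P,
      treeVertex x P v = x l) ∨ ∃ j, treeCenter j = v ∧ ∀ (x : Fin 4 → E3) P,
      treeVertex x P v = P j := by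
    intro v
    fin_cases v
    exacts [Or.inl ⟨0, rfl, fun _ _ => rfl⟩, Or.inl ⟨1, rfl, fun _ _ => rfl⟩,
      Or.inl ⟨2, rfl, fun _ _ => rfl⟩, Or.inl ⟨3, rfl, fun _ _ => rfl⟩,
      Or.inr ⟨0, rfl, fun _ _ => rfl⟩, Or.inr ⟨1, rfl, fun _ _ => rfl⟩]
  rcases h v with ⟨l, rfl, hv⟩ | ⟨j, rfl, hv⟩
  · rw [hv, velocity_leaf hσ]
  · rw [hv, velocity_center hσ]

/-- The sign of the direction of an edge with respect to the standard tree. -/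
def treeSign (σ : Equiv.Perm (Fin (2 * 3))) (k : Fin 5) : ℝ :=
  ((Equiv.Perm.sign (treeFlip σ k) : ℤ) : ℝ)

/-- The edges of the diagram, labelled by those of the standard tree. -/
noncomputable def treeEdgeEquiv : Fin 5 ≃ Γ.Edge := Equiv.ofBijective _ (treeEdge_bijective hσ)

theorem displacement_treeEdge (p : E3 × (Γ.HalfEdge → ℝ)) (k : Fin 5) :
    Γ.displacement p (treeEdgeEquiv hσ k) = treeSign σ k •
      (treeVertex (fun l => treeAbscissa hσ p.2 l • p.1) (treePoint hσ p.2) (treeHead k) -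
        treeVertex (fun l => treeAbscissa hσ p.2 l • p.1) (treePoint hσ p.2) (treeTail k)) := by
  rw [← position_label, ← position_label]
  exact treeEdge_sub hσ (Γ.position p.1 p.2) k

theorem fderiv_displacement_treeEdge (p q : E3 × (Γ.HalfEdge → ℝ)) (k : Fin 5) :
    fderiv ℝ Γ.displacement p q (treeEdgeEquiv hσ k) = treeSign σ k •
      (treeVertex (fun l => treeAbscissa hσ q.2 l • p.1 + treeAbscissa hσ p.2 l • q.1)
          (treePoint hσ q.2) (treeHead k) -
        treeVertex (fun l => treeAbscissa hσ q.2 l • p.1 + treeAbscissa hσ p.2 l • q.1)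
          (treePoint hσ q.2) (treeTail k)) := by
  rw [fderiv_displacement, ← velocity_label, ← velocity_label]
  exact treeEdge_sub hσ (Γ.velocity p q) k

/-- The rows of the tree matrix as indices of the bordered matrix of the diagram. -/
noncomputable def treeRowIndex : TreeRow ≃ Γ.Index :=
  Equiv.sumCongr (Equiv.prodCongr (treeEdgeEquiv hσ) (Equiv.refl _)) (Equiv.refl _)

/-- The permutation of the columns given by the cyclic orders. -/
noncomputable def treeCycPerm : Equiv.Perm TreeCol :=
  Equiv.Perm.sumCongr 1 (Equiv.prodCongrRight ![(treeCyc hσ 0).symm, (treeCyc hσ 1).symm, 1])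

/-- The columns of the tree matrix as indices of the bordered matrix of the diagram. -/
noncomputable def treeColIndex (c : TreeCol) : Γ.Index :=
  treeRowIndex hσ (treeFlipPerm σ (treeSlotEquiv (treeCycPerm hσ c)))

theorem treeColIndex_injective : Function.Injective (treeColIndex hσ) := fun a b h => by
  simpa [treeColIndex] using h

theorem basisVec_source {k : Fin 5} {x : Fin 4 ⊕ Fin 2 × Fin 3}
    (hx : treeHalfEnds x = (treeTail k, treeHead k)) :
    Γ.basisVec (treeRowIndex hσ (treeFlipPerm σ (Sum.inl (k, 1)))) =
      (0, Pi.single (treeHalf hσ x) 1) := by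
  by_cases h : σ (treeTail k) < σ (treeHead k)
  · have e : (treeEdgeEquiv hσ k).src = treeHalf hσ x :=
      Subtype.ext ((treeEdge_of_lt hσ h).trans (by simp [treeHalf, hx]))
    simp [treeFlipPerm, treeFlip, h, treeRowIndex, basisVec, e]
  · have e : (treeEdgeEquiv hσ k).tgt = treeHalf hσ x :=
      Subtype.ext ((congrArg Prod.swap (treeEdge_of_not_lt hσ h)).trans (by simp [treeHalf, hx]))
    simp [treeFlipPerm, treeFlip, h, treeRowIndex, basisVec, e]

theorem basisVec_target {k : Fin 5} {x : Fin 4 ⊕ Fin 2 × Fin 3}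
    (hx : treeHalfEnds x = (treeHead k, treeTail k)) :
    Γ.basisVec (treeRowIndex hσ (treeFlipPerm σ (Sum.inl (k, 2)))) =
      (0, Pi.single (treeHalf hσ x) 1) := by
  by_cases h : σ (treeTail k) < σ (treeHead k)
  · have e : (treeEdgeEquiv hσ k).tgt = treeHalf hσ x :=
      Subtype.ext ((congrArg Prod.swap (treeEdge_of_lt hσ h)).trans (by simp [treeHalf, hx]))
    simp [treeFlipPerm, treeFlip, h, treeRowIndex, basisVec, e]
  · have e : (treeEdgeEquiv hσ k).src = treeHalf hσ x :=
      Subtype.ext ((treeEdge_of_not_lt hσ h).trans (by simp [treeHalf, hx]))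
    simp [treeFlipPerm, treeFlip, h, treeRowIndex, basisVec, e]

theorem treeColIndex_length (k : Fin 5) :
    treeColIndex hσ (Sum.inl (Sum.inl k)) = Sum.inl (treeEdgeEquiv hσ k, 0) := by
  have h0 : treeFlip σ k 0 = 0 := by
    unfold treeFlip
    split_ifs
    · rfl
    · decide
  simp [treeColIndex, treeCycPerm, treeSlotEquiv, treeSlot, treeFlipPerm, treeRowIndex, h0]

theorem basisVec_length (k : Fin 5) : Γ.basisVec (treeColIndex hσ (Sum.inl (Sum.inl k))) = 0 := by
  rw [treeColIndex_length]
  simp [basisVec]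

theorem basisVec_leg (l : Fin 4) : Γ.basisVec (treeColIndex hσ (Sum.inl (Sum.inr l))) =
    (0, Pi.single (treeHalf hσ (Sum.inl l)) 1) := by
  have : treeColIndex hσ (Sum.inl (Sum.inr l)) =
      treeRowIndex hσ (treeFlipPerm σ (Sum.inl (l.castSucc, 2))) := by
    simp [treeColIndex, treeCycPerm, treeSlotEquiv, treeSlot]
  rw [this]
  exact basisVec_target hσ rfl

theorem basisVec_center (j : Fin 2) (i : Fin 3) :
    Γ.basisVec (treeColIndex hσ (Sum.inr (j.castSucc, i))) =
      (0, Pi.single (treeHalf hσ (Sum.inr (j, (treeCyc hσ j).symm i))) 1) := by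
  have : treeColIndex hσ (Sum.inr (j.castSucc, i)) = treeRowIndex hσ (treeFlipPerm σ
      (treeSlot (Sum.inr (j.castSucc, (treeCyc hσ j).symm i)))) := by
    fin_cases j <;> simp [treeColIndex, treeCycPerm, treeSlotEquiv]
  rw [this]
  generalize (treeCyc hσ j).symm i = m
  fin_cases j <;> fin_cases m
  exacts [basisVec_source hσ rfl, basisVec_source hσ rfl, basisVec_source hσ rfl,
    basisVec_source hσ rfl, basisVec_source hσ rfl, basisVec_target hσ rfl]

theorem basisVec_axis (i : Fin 3) : Γ.basisVec (treeColIndex hσ (Sum.inr (2, i))) =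
    (EuclideanSpace.single i 1, 0) := by
  have : treeColIndex hσ (Sum.inr (2, i)) = Sum.inr i := by
    fin_cases i <;>
      simp [treeColIndex, treeCycPerm, treeSlotEquiv, treeSlot, treeFlipPerm, treeRowIndex]
  rw [this]
  rfl

theorem treeAbscissa_single (x : Fin 4 ⊕ Fin 2 × Fin 3) (l : Fin 4) :
    treeAbscissa hσ (Pi.single (treeHalf hσ x) 1) l = if Sum.inl l = x then 1 else 0 := by
  rw [treeAbscissa, Pi.single_apply]
  simp only [(treeHalf_bijective hσ).1.eq_iff]

theorem treePoint_single (x : Fin 4 ⊕ Fin 2 × Fin 3) (j : Fin 2) (i : Fin 3) :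
    treePoint hσ (Pi.single (treeHalf hσ x) 1) j i =
      if Sum.inr (j, (treeCyc hσ j).symm i) = x then 1 else 0 := by
  rw [treePoint]
  simp only [Pi.single_apply, (treeHalf_bijective hσ).1.eq_iff]

theorem treeAbscissa_zero (l : Fin 4) : treeAbscissa hσ 0 l = 0 := rfl

theorem treePoint_zero (j : Fin 2) : treePoint hσ 0 j = 0 := rfl

/-- The signs by which the rows of the two matrices differ. -/
def treeRowSign (σ : Equiv.Perm (Fin (2 * 3))) : TreeRow → ℝ :=
  Sum.elim (fun r => treeSign σ r.1) 1

theorem formMatrix_tree (hb : Γ.base = σ 0) (p : E3 × (Γ.HalfEdge → ℝ))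
    (h0 : treeAbscissa hσ p.2 0 = 0) (r : TreeRow) (c : TreeCol) :
    Γ.formMatrix p (treeRowIndex hσ r) (treeColIndex hσ c) = treeRowSign σ r *
      treeMatrix (treeAbscissa hσ p.2 1) (treeAbscissa hσ p.2 2) (treeAbscissa hσ p.2 3) p.1
        (treePoint hσ p.2 0) (treePoint hσ p.2 1) r c := by
  rcases r with ⟨k, m⟩ | r
  · have htop : Γ.formMatrix p (treeRowIndex hσ (Sum.inl (k, m))) (treeColIndex hσ c) =
        (if c = Sum.inl (Sum.inl k) then Γ.displacement p (treeEdgeEquiv hσ k) m else 0) +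
          fderiv ℝ Γ.displacement p (Γ.basisVec (treeColIndex hσ c)) (treeEdgeEquiv hσ k) m := by
      have : (treeColIndex hσ c = Sum.inl (treeEdgeEquiv hσ k, 0)) ↔ c = Sum.inl (Sum.inl k) := by
        rw [← treeColIndex_length, (treeColIndex_injective hσ).eq_iff]
      simp only [formMatrix, treeRowIndex, Equiv.sumCongr_apply, Sum.map_inl, Equiv.prodCongr_apply,
        Prod.map, Equiv.refl_apply, this]
    rw [htop, show treeRowSign σ (Sum.inl (k, m)) = treeSign σ k from rfl]
    rcases c with (k' | l) | ⟨j, i⟩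
    · rw [basisVec_length, map_zero, treeMatrix_length]
      by_cases hk : k' = k
      · subst hk
        rw [displacement_treeEdge]
        fin_cases k' <;> simp [treeVertex, treeHead, treeTail, treeEdgeCoord, h0] <;>
          first | ring1 | exact Or.inl (by ring1)
      · simp [hk, Ne.symm hk]
    · rw [basisVec_leg, fderiv_displacement_treeEdge, treeMatrix_leg, if_neg (by simp), zero_add]
      fin_cases k <;> fin_cases l <;>
        simp [treeVertex, treeHead, treeTail, treeAbscissa_single, treePoint_single]
    · rw [treeMatrix_point, if_neg (by simp), zero_add]
      have hj : (∃ j' : Fin 2, j = j'.castSucc) ∨ j = 2 := by clear htop; revert j; decide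
      rcases hj with ⟨j, rfl⟩ | rfl
      · rw [basisVec_center, fderiv_displacement_treeEdge]
        fin_cases k <;> fin_cases j <;>
          simp [treeVertex, treeHead, treeTail, treeAbscissa_single, treePoint_single,
            treeIncidence] <;> split_ifs <;> simp
      · rw [basisVec_axis, fderiv_displacement_treeEdge]
        fin_cases k <;>
          simp [treeVertex, treeHead, treeTail, treeAbscissa_zero, treePoint_zero, treeIncidence, h0]
  · have hsum : ∀ x : Fin 4 ⊕ Fin 2 × Fin 3,
        ∑ h, p.2 h * (Pi.single (treeHalf hσ x) 1 : Γ.HalfEdge → ℝ) h = p.2 (treeHalf hσ x) := by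
      intro x
      simp [Pi.single_apply]
    have hbase : ∀ y : Γ.HalfEdge → ℝ, (∑ h, if h.1.1 = Γ.base then y h else 0) =
        treeAbscissa hσ y 0 := by
      intro y
      rw [hb]
      exact sum_halfEdge_at_leaf hσ y 0
    have hbot : Γ.formMatrix p (treeRowIndex hσ (Sum.inr r)) (treeColIndex hσ c) =
        ![inner ℝ p.1 (Γ.basisVec (treeColIndex hσ c)).1,
          treeAbscissa hσ (Γ.basisVec (treeColIndex hσ c)).2 0,
          ∑ h, p.2 h * (Γ.basisVec (treeColIndex hσ c)).2 h] r := by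
      rw [← hbase]
      fin_cases r <;> rfl
    rw [hbot, show treeRowSign σ (Sum.inr r) = 1 from rfl, one_mul, treeMatrix]
    rcases c with (k' | l) | ⟨j, i⟩
    · rw [basisVec_length, Matrix.fromBlocks_apply₂₁]
      fin_cases r <;> simp [treeBottomLeft, treeAbscissa_zero]
    · rw [basisVec_leg, hsum, Matrix.fromBlocks_apply₂₁]
      have h0' := h0.symm
      fin_cases r <;> fin_cases l <;> simp [treeBottomLeft, treeAbscissa_single] <;>
        first | rfl | exact h0
    · rw [Matrix.fromBlocks_apply₂₂]
      have hj : (∃ j' : Fin 2, j = j'.castSucc) ∨ j = 2 := by clear hbot; revert j; decide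
      rcases hj with ⟨j, rfl⟩ | rfl
      · rw [basisVec_center, hsum]
        fin_cases r <;> fin_cases j <;> simp [treeBottomRight, treeAbscissa_single] <;> rfl
      · rw [basisVec_axis]
        fin_cases r <;> simp [treeBottomRight, treeAbscissa_zero, EuclideanSpace.inner_single_right]

/-- The universal sign relating the two ways to match the columns and the rows. -/
noncomputable def treeOrientation : ℤˣ :=
  -Equiv.Perm.sign (treeMatching.symm.trans treeSlotEquiv)

theorem sign_treeFlipPerm :
    ((Equiv.Perm.sign (treeFlipPerm σ) : ℤ) : ℝ) = ∏ k, treeSign σ k := by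
  rw [treeFlipPerm, Equiv.Perm.sign_sumCongr, Equiv.Perm.sign_prodCongrRight]
  simp [treeSign]

theorem prod_treeRowSign : ∏ r, treeRowSign σ r = ∏ k, treeSign σ k := by
  have h : ∀ k, treeSign σ k ^ 3 = treeSign σ k := by
    intro k
    rcases Int.units_eq_one_or (Equiv.Perm.sign (treeFlip σ k)) with h | h <;> simp [treeSign, h]
    norm_num
  rw [Fintype.prod_sum_type, Fintype.prod_prod_type]
  simp [treeRowSign, h]

theorem sign_treeCycPerm : Equiv.Perm.sign (treeCycPerm hσ) =
    Equiv.Perm.sign (treeCyc hσ 0) * Equiv.Perm.sign (treeCyc hσ 1) := by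
  rw [treeCycPerm, Equiv.Perm.sign_sumCongr, Equiv.Perm.sign_prodCongrRight, Fin.prod_univ_three]
  simp

/-- The sign of the cyclic orders at the two trivalent vertices. -/
noncomputable def treeCycSign : ℤˣ :=
  Equiv.Perm.sign (treeCyc hσ 0) * Equiv.Perm.sign (treeCyc hσ 1)

theorem det_formMatrix_tree (hb : Γ.base = σ 0) (p : E3 × (Γ.HalfEdge → ℝ))
    (h0 : treeAbscissa hσ p.2 0 = 0) (h1 : treeAbscissa hσ p.2 1 ≠ 0) :
    (Γ.formMatrix p).det = ((treeCycSign hσ : ℤ) : ℝ) * ((treeOrientation : ℤ) : ℝ) *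
      (treeAbscissa hσ p.2 1 * (treeAbscissa hσ p.2 3 - treeAbscissa hσ p.2 2) *
        triple p.1 (treePoint hσ p.2 0) (treePoint hσ p.2 1) ^ 2 *
        (‖p.1‖ ^ 2 * ∑ h, p.2 h ^ 2)) := by
  set π : Equiv.Perm TreeRow := treeMatching.symm.trans ((treeCycPerm hσ).trans
    (treeSlotEquiv.trans (treeFlipPerm σ))) with hπ
  set T := (treeMatrix (treeAbscissa hσ p.2 1) (treeAbscissa hσ p.2 2) (treeAbscissa hσ p.2 3) p.1
    (treePoint hσ p.2 0) (treePoint hσ p.2 1)).submatrix id treeMatching.symm with hT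
  have e1 : ((Γ.formMatrix p).submatrix (treeRowIndex hσ) (treeRowIndex hσ)).submatrix id π =
      Matrix.of fun r c => treeRowSign σ r * T r c := by
    ext r c
    exact formMatrix_tree hσ hb p h0 r (treeMatching.symm c)
  have e2 := congrArg Matrix.det e1
  rw [Matrix.det_permute', Matrix.det_submatrix_equiv_self, Matrix.det_mul_column,
    prod_treeRowSign, hT, treeMatrix_det _ _ _ h1] at e2
  have hsπ : Equiv.Perm.sign π = -(treeCycSign hσ * treeOrientation *
      Equiv.Perm.sign (treeFlipPerm σ)) := by
    have : π = ((treeMatching.symm.trans (treeCycPerm hσ)).trans treeMatching).trans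
        ((treeMatching.symm.trans treeSlotEquiv).trans (treeFlipPerm σ)) := by
      ext x
      simp [hπ]
    rw [this, Equiv.Perm.sign_trans, Equiv.Perm.sign_trans, Equiv.Perm.sign_symm_trans_trans,
      sign_treeCycPerm, treeCycSign, treeOrientation]
    simp [mul_comm, mul_left_comm]
  have hnorm : ‖p.1‖ ^ 2 = (p.1 : Fin 3 → ℝ) ⬝ᵥ (p.1 : Fin 3 → ℝ) := by
    rw [EuclideanSpace.real_norm_sq_eq]
    simp [dotProduct, sq]
  have hsum : ∑ h, p.2 h ^ 2 = treeAbscissa hσ p.2 1 ^ 2 + treeAbscissa hσ p.2 2 ^ 2 +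
      treeAbscissa hσ p.2 3 ^ 2 + (treePoint hσ p.2 0 : Fin 3 → ℝ) ⬝ᵥ treePoint hσ p.2 0 +
      (treePoint hσ p.2 1 : Fin 3 → ℝ) ⬝ᵥ treePoint hσ p.2 1 := by
    have hj : ∀ j, ∑ k, p.2 (treeHalf hσ (Sum.inr (j, k))) ^ 2 =
        (treePoint hσ p.2 j : Fin 3 → ℝ) ⬝ᵥ treePoint hσ p.2 j := by
      intro j
      rw [← (treeCyc hσ j).symm.sum_comp]
      simp [dotProduct, treePoint, sq]
    have hl : ∀ l, p.2 (treeHalf hσ (Sum.inl l)) = treeAbscissa hσ p.2 l := fun _ => rfl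
    rw [sum_halfEdge hσ, Fin.sum_univ_two, hj, hj, Fin.sum_univ_four]
    simp only [hl, h0]
    ring
  have hsq2 : ∀ u : ℤˣ, ((u : ℤ) : ℝ) * ((u : ℤ) : ℝ) = 1 := fun u => by
    rcases Int.units_eq_one_or u with rfl | rfl <;> simp
  have hsq : (∏ k, treeSign σ k) * ∏ k, treeSign σ k = 1 := by
    rw [← sign_treeFlipPerm]
    exact hsq2 _
  rw [hsπ] at e2
  rw [hnorm, hsum]
  push_cast at e2
  rw [sign_treeFlipPerm] at e2
  have a1 := hsq2 (treeCycSign hσ)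
  have a2 := hsq2 treeOrientation
  rw [triple]
  generalize (Γ.formMatrix p).det = X at e2 ⊢
  generalize ((treeCycSign hσ : ℤ) : ℝ) = C at e2 a1 ⊢
  generalize ((treeOrientation : ℤ) : ℝ) = O at e2 a2 ⊢
  generalize (∏ k, treeSign σ k) = F at e2 hsq
  generalize (treeFrame (p.1 : Fin 3 → ℝ) (treePoint hσ p.2 0) (treePoint hσ p.2 1)).det = D at e2 ⊢
  linear_combination (-(C * O * F)) * e2 - X * O ^ 2 * F ^ 2 * a1 - X * F ^ 2 * a2 +
    (-X + C * O * (treeAbscissa hσ p.2 1 * (treeAbscissa hσ p.2 3 - treeAbscissa hσ p.2 2) *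
      D ^ 2 * ((p.1 : Fin 3 → ℝ) ⬝ᵥ (p.1 : Fin 3 → ℝ)) * (treeAbscissa hσ p.2 1 ^ 2 +
      treeAbscissa hσ p.2 2 ^ 2 + treeAbscissa hσ p.2 3 ^ 2 +
      (treePoint hσ p.2 0 : Fin 3 → ℝ) ⬝ᵥ treePoint hσ p.2 0 +
      (treePoint hσ p.2 1 : Fin 3 → ℝ) ⬝ᵥ treePoint hσ p.2 1))) * hsq

end ConnOriented

/-! ### The integral of a tree -/

/-- The integral for the trees with order `O`, up to the signs that depend on their orientation. The
factors `4 π` come from the volume forms, the factors `7 / 3` from the shells. -/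
noncomputable def treeIntegral (O : Set (ℝ × ℝ)) : ℝ :=
  ((ConnOriented.treeOrientation : ℤ) : ℝ) * (((4 * Real.pi) ^ 5)⁻¹ * ((dirVolume O).toReal / (7 / 3) ^ 5))

/-- The form on the configurations of a tree, up to its sign. -/
noncomputable def treeWeight (s p q : E3) (x : Fin 3 → ℝ) : ℝ :=
  ((4 * Real.pi) ^ 5)⁻¹ * (x 0 * (x 2 - x 1) * triple s p q ^ 2 * (‖p‖ ^ 3)⁻¹ *
    (‖x 0 • s - p‖ ^ 3)⁻¹ * (‖x 1 • s - q‖ ^ 3)⁻¹ * (‖x 2 • s - q‖ ^ 3)⁻¹ * (‖q - p‖ ^ 3)⁻¹)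

theorem ofReal_treeWeight {O : Set (ℝ × ℝ)} (hlt : ∀ u ∈ O, u.1 < u.2) (s p q : E3)
    {x : Fin 3 → ℝ} (hx : 0 < x 0 ∧ (x 1 / x 0, x 2 / x 0) ∈ O) :
    0 ≤ treeWeight s p q x ∧ ENNReal.ofReal (treeWeight s p q x) =
      ENNReal.ofReal ((4 * Real.pi) ^ 5)⁻¹ * (axisDensity O s p q x * invCube (q - p)) := by
  have h12 : 0 ≤ x 2 - x 1 := by
    have := (div_lt_div_iff_of_pos_right hx.1).1 (hlt _ hx.2)
    linarith
  have h0 : 0 ≤ x 0 * (x 2 - x 1) * triple s p q ^ 2 :=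
    mul_nonneg (mul_nonneg hx.1.le h12) (sq_nonneg _)
  have hpi := Real.pi_pos
  refine ⟨by unfold treeWeight; positivity, ?_⟩
  rw [treeWeight, axisDensity, if_pos hx]
  unfold invCube
  rw [ENNReal.ofReal_mul (by positivity), ENNReal.ofReal_mul (by positivity),
    ENNReal.ofReal_mul (by positivity), ENNReal.ofReal_mul (by positivity),
    ENNReal.ofReal_mul (by positivity), ENNReal.ofReal_mul (by positivity)]

namespace ConnOriented

theorem sum_extend_sq {n : ℕ} (Γ : ConnOriented n) (y : Γ.FreeHalfEdge → ℝ) :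
    ∑ h, Γ.extend y h ^ 2 = ∑ h, y h ^ 2 := by
  symm
  refine Fintype.sum_of_injective (fun h : Γ.FreeHalfEdge => h.1) Subtype.val_injective _ _ ?_ ?_
  · intro h hh
    have : ¬ h.1.1 ≠ Γ.base := fun hb => hh ⟨⟨h, hb⟩, rfl⟩
    simp [extend, this]
  · intro h
    have hb : h.1.1.1 ≠ Γ.base := h.2
    simp only [extend, dif_pos hb]
    rfl

theorem sum_coords_sq {n : ℕ} (Γ : ConnOriented n) (p : Γ.Normalized) :
    ∑ h, (Γ.coords p).2 h ^ 2 = 1 := by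
  rw [coords, sum_extend_sq, ← EuclideanSpace.real_norm_sq_eq]
  simp

variable {Γ : ConnOriented 3} {σ : Equiv.Perm (Fin (2 * 3))}
  (hσ : ∀ i j, Γ.graph.Adj (σ i) (σ j) ↔ treeAdj i j)

/-- The half-edge labelling a coordinate of the normalized configurations of a tree. -/
noncomputable def treeFree (x : Fin 3 ⊕ Fin 3 ⊕ Fin 3) : Fin 4 ⊕ Fin 2 × Fin 3 :=
  Sum.elim (fun i => Sum.inr (0, (treeCyc hσ 0).symm i))
    (Sum.elim (fun i => Sum.inr (1, (treeCyc hσ 1).symm i)) fun l => Sum.inl l.succ) x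

theorem treeFree_ne_base (hb : Γ.base = σ 0) (x : Fin 3 ⊕ Fin 3 ⊕ Fin 3) :
    (treeHalf hσ (treeFree hσ x)).1.1 ≠ Γ.base := by
  rw [hb]
  intro h
  have h1 : (treeHalfEnds (treeFree hσ x)).1 = 0 := σ.injective h
  have h2 : ∀ x : Fin 4 ⊕ Fin 2 × Fin 3, (treeHalfEnds x).1 = 0 → x = Sum.inl 0 := by decide
  have h3 := h2 _ h1
  rcases x with i | i | i
  · simp [treeFree] at h3
  · simp [treeFree] at h3
  · simp [treeFree] at h3

/-- The coordinates of the normalized configurations of a tree: those of the two trivalent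
vertices, and the abscissas of the last three univalent vertices. -/
noncomputable def treeFreeEquiv (hb : Γ.base = σ 0) : Fin 3 ⊕ Fin 3 ⊕ Fin 3 ≃ Γ.FreeHalfEdge :=
  Equiv.ofBijective (fun x => ⟨treeHalf hσ (treeFree hσ x), treeFree_ne_base hσ hb x⟩) (by
    constructor
    · intro x y h
      have h1 := (treeHalf_bijective hσ).1 (congrArg Subtype.val h)
      rcases x with i | i | i <;> rcases y with j | j | j <;> simp [treeFree] at h1 ⊢ <;> exact h1
    · rintro ⟨h, hh⟩
      obtain ⟨x, rfl⟩ := (treeHalf_bijective hσ).2 h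
      rcases x with l | ⟨j, k⟩
      · rcases Fin.eq_zero_or_eq_succ l with rfl | ⟨l, rfl⟩
        · exact absurd hb.symm hh
        · exact ⟨Sum.inr (Sum.inr l), rfl⟩
      · fin_cases j
        · exact ⟨Sum.inl (treeCyc hσ 0 k), Subtype.ext (by simp [treeFree])⟩
        · exact ⟨Sum.inr (Sum.inl (treeCyc hσ 1 k)), Subtype.ext (by simp [treeFree])⟩)

theorem extend_treeFree (hb : Γ.base = σ 0) (y : Γ.FreeHalfEdge → ℝ) (x : Fin 3 ⊕ Fin 3 ⊕ Fin 3) :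
    Γ.extend y (treeHalf hσ (treeFree hσ x)) = y (treeFreeEquiv hσ hb x) :=
  dif_pos (treeFree_ne_base hσ hb x)

theorem treePoint_zero_coords (hb : Γ.base = σ 0) (p : Γ.Normalized) :
    treePoint hσ (Γ.coords p).2 0 = firstCoords (treeFreeEquiv hσ hb) p.2.1 := by
  ext i
  exact extend_treeFree hσ hb _ (Sum.inl i)

theorem treePoint_one_coords (hb : Γ.base = σ 0) (p : Γ.Normalized) :
    treePoint hσ (Γ.coords p).2 1 = secondCoords (treeFreeEquiv hσ hb) p.2.1 := by
  ext i
  exact extend_treeFree hσ hb _ (Sum.inr (Sum.inl i))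

theorem treeAbscissa_succ_coords (hb : Γ.base = σ 0) (p : Γ.Normalized) (l : Fin 3) :
    treeAbscissa hσ (Γ.coords p).2 l.succ = thirdCoords (treeFreeEquiv hσ hb) p.2.1 l :=
  extend_treeFree hσ hb _ (Sum.inr (Sum.inr l))

theorem treeAbscissa_zero_coords (hb : Γ.base = σ 0) (p : Γ.Normalized) : treeAbscissa hσ (Γ.coords p).2 0 = 0 :=
  dif_neg (not_not.2 hb.symm)

/-- The lengths of the edges. -/
noncomputable def treeLength (s p q : E3) (x : Fin 3 → ℝ) : Fin 5 → ℝ :=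
  ![‖p‖, ‖x 0 • s - p‖, ‖x 1 • s - q‖, ‖x 2 • s - q‖, ‖q - p‖]

theorem norm_displacement_tree (hb : Γ.base = σ 0) (p : Γ.Normalized) (k : Fin 5) :
    ‖Γ.displacement (Γ.coords p) (treeEdgeEquiv hσ k)‖ =
      treeLength p.1 (firstCoords (treeFreeEquiv hσ hb) p.2.1)
        (secondCoords (treeFreeEquiv hσ hb) p.2.1) (thirdCoords (treeFreeEquiv hσ hb) p.2.1) k := by
  have hs : ‖treeSign σ k‖ = 1 := by
    rcases Int.units_eq_one_or (Equiv.Perm.sign (treeFlip σ k)) with h | h <;> simp [treeSign, h]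
  have h1 := treeAbscissa_succ_coords hσ hb p 0
  have h2 := treeAbscissa_succ_coords hσ hb p 1
  have h3 := treeAbscissa_succ_coords hσ hb p 2
  have e : (Γ.coords p).1 = p.1.1 := rfl
  rw [displacement_treeEdge, norm_smul, hs, one_mul, e]
  fin_cases k <;> simp [treeVertex, treeHead, treeTail, treeLength,
    treeAbscissa_zero_coords hσ hb, treePoint_zero_coords hσ hb, treePoint_one_coords hσ hb,
    ← h1, ← h2, ← h3]

/-- `r` describes the order of the univalent vertices, and `O` the same order in terms of the
abscissas of the last two when the first two are at `0` and `1`. -/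
structure TreeOrder (r : Fin 4 → ℕ) (O : Set (ℝ × ℝ)) : Prop where
  measurable : MeasurableSet O
  lt : ∀ u ∈ O, u.1 < u.2
  iff : ∀ x : Fin 4 → ℝ, x 0 = 0 →
    ((∀ l l', r l < r l' → x l < x l') ↔ 0 < x 1 ∧ (x 2 / x 1, x 3 / x 1) ∈ O)

theorem mem_W_tree (hb : Γ.base = σ 0) {r : Fin 4 → ℕ} {O : Set (ℝ × ℝ)} (hO : TreeOrder r O)
    (hr : ∀ l l' : Fin 4, Γ.lt (σ (treeHead l.castSucc)) (σ (treeHead l'.castSucc)) ↔ r l < r l')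
    (p : Γ.Normalized) : p ∈ Γ.W ↔ (0 < thirdCoords (treeFreeEquiv hσ hb) p.2.1 0 ∧
      (thirdCoords (treeFreeEquiv hσ hb) p.2.1 1 / thirdCoords (treeFreeEquiv hσ hb) p.2.1 0,
        thirdCoords (treeFreeEquiv hσ hb) p.2.1 2 / thirdCoords (treeFreeEquiv hσ hb) p.2.1 0) ∈ O) ∧
      ∀ k, treeLength p.1 (firstCoords (treeFreeEquiv hσ hb) p.2.1)
        (secondCoords (treeFreeEquiv hσ hb) p.2.1) (thirdCoords (treeFreeEquiv hσ hb) p.2.1) k ≠ 0 := by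
  have h1 := treeAbscissa_succ_coords hσ hb p 0
  have h2 := treeAbscissa_succ_coords hσ hb p 1
  have h3 := treeAbscissa_succ_coords hσ hb p 2
  have hord := hO.iff (treeAbscissa hσ (Γ.coords p).2) (treeAbscissa_zero_coords hσ hb p)
  rw [← h1, ← h2, ← h3]
  refine and_congr ((Iff.trans ?_ hord)) ?_
  · constructor
    · intro h l l' hl
      exact h _ _ ((hr l l').2 hl)
    · intro h a a' hlt
      have key : ∀ a : Γ.HalfEdge, Γ.IsUni a.1.1 → ∃ l, a = treeHalf hσ (Sum.inl l) := by
        intro a ha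
        obtain ⟨x, rfl⟩ := (treeHalf_bijective hσ).2 a
        rcases x with l | ⟨j, k⟩
        · exact ⟨l, rfl⟩
        · exact absurd ha (not_isUni_label hσ j)
      have hu := Γ.lt_univalent _ _ hlt
      obtain ⟨l, rfl⟩ := key a hu.1
      obtain ⟨l', rfl⟩ := key a' hu.2
      exact h l l' ((hr l l').1 hlt)
  · rw [← (treeEdgeEquiv hσ).forall_congr_right]
    refine forall_congr' fun k => ?_
    rw [← norm_displacement_tree hσ hb, norm_ne_zero_iff]

/-- The form has a constant sign on the configurations. -/
theorem density_tree (hb : Γ.base = σ 0) (p : Γ.Normalized)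
    (h0 : thirdCoords (treeFreeEquiv hσ hb) p.2.1 0 ≠ 0) :
    Γ.density p = ((treeCycSign hσ : ℤ) : ℝ) * ((treeOrientation : ℤ) : ℝ) *
      treeWeight p.1 (firstCoords (treeFreeEquiv hσ hb) p.2.1)
        (secondCoords (treeFreeEquiv hσ hb) p.2.1) (thirdCoords (treeFreeEquiv hσ hb) p.2.1) := by
  have h1 := treeAbscissa_succ_coords hσ hb p 0
  have h2 := treeAbscissa_succ_coords hσ hb p 1
  have h3 := treeAbscissa_succ_coords hσ hb p 2
  have e : (Γ.coords p).1 = p.1.1 := rfl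
  have es : ‖p.1.1‖ = 1 := by simp
  have hprod : ∏ e, (4 * Real.pi * ‖Γ.displacement (Γ.coords p) e‖ ^ 3) =
      ∏ k, (4 * Real.pi * treeLength p.1 (firstCoords (treeFreeEquiv hσ hb) p.2.1)
        (secondCoords (treeFreeEquiv hσ hb) p.2.1)
        (thirdCoords (treeFreeEquiv hσ hb) p.2.1) k ^ 3) := by
    rw [← (treeEdgeEquiv hσ).prod_comp]
    simp only [norm_displacement_tree hσ hb]
  rw [density, det_formMatrix_tree hσ hb _ (treeAbscissa_zero_coords hσ hb p) (h1.symm ▸ h0),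
    sum_coords_sq, e, es, hprod, treePoint_zero_coords hσ hb, treePoint_one_coords hσ hb,
    show (1 : Fin 4) = Fin.succ 0 from rfl, show (2 : Fin 4) = Fin.succ 1 from rfl,
    show (3 : Fin 4) = Fin.succ 2 from rfl, h1, h2, h3, Fin.prod_univ_five, treeWeight]
  simp only [treeLength, Matrix.cons_val_zero, Matrix.cons_val_one, Matrix.cons_val]
  rw [div_eq_mul_inv]
  simp only [mul_inv, mul_pow]
  ring

/-- The integral of a tree converges because the volume of the set of its directions is finite. -/
theorem integral_tree (hb : Γ.base = σ 0) {r : Fin 4 → ℕ} {O : Set (ℝ × ℝ)} (hO : TreeOrder r O)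
    (hr : ∀ l l' : Fin 4, Γ.lt (σ (treeHead l.castSucc)) (σ (treeHead l'.castSucc)) ↔ r l < r l') :
    Γ.Converges ∧ Γ.f = ((Γ.uniSign : ℤ) : ℝ) * ((treeCycSign hσ : ℤ) : ℝ) * treeIntegral O := by
  set φ := treeFreeEquiv hσ hb with hφ
  have hp : Measurable fun p : Γ.Normalized => firstCoords φ p.2.1 := by
    unfold firstCoords; fun_prop
  have hq : Measurable fun p : Γ.Normalized => secondCoords φ p.2.1 := by
    unfold secondCoords; fun_prop
  have hx : Measurable fun p : Γ.Normalized => thirdCoords φ p.2.1 := by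
    unfold thirdCoords; fun_prop
  have hxl : ∀ l, Measurable fun p : Γ.Normalized => thirdCoords φ p.2.1 l := fun l =>
    (measurable_pi_apply l).comp hx
  have hx0 := hxl 0
  have hx1 := hxl 1
  have hx2 := hxl 2
  have hs : Measurable fun p : Γ.Normalized => p.1.1 := by fun_prop
  have hlen : ∀ k, Measurable fun p : Γ.Normalized =>
      treeLength p.1 (firstCoords φ p.2.1) (secondCoords φ p.2.1) (thirdCoords φ p.2.1) k := by
    intro k
    fin_cases k <;> simp [treeLength] <;> fun_prop
  have hW : MeasurableSet Γ.W := by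
    have : Γ.W = {p | 0 < thirdCoords φ p.2.1 0} ∩
        {p | (thirdCoords φ p.2.1 1 / thirdCoords φ p.2.1 0,
          thirdCoords φ p.2.1 2 / thirdCoords φ p.2.1 0) ∈ O} ∩
        ⋂ k, {p | treeLength p.1 (firstCoords φ p.2.1) (secondCoords φ p.2.1)
          (thirdCoords φ p.2.1) k = 0}ᶜ := by
      ext p
      rw [mem_W_tree hσ hb hO hr p]
      simp [hφ, and_assoc]
    rw [this]
    refine ((measurableSet_lt measurable_const hx0).inter ?_).inter
      (MeasurableSet.iInter fun k => (measurableSet_eq_fun (hlen k) measurable_const).compl)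
    exact hO.measurable.preimage ((hx1.div hx0).prodMk (hx2.div hx0))
  set w : Γ.Normalized → ℝ := fun p =>
    treeWeight p.1 (firstCoords φ p.2.1) (secondCoords φ p.2.1) (thirdCoords φ p.2.1) with hw
  have hwm : Measurable w := by
    simp only [hw, treeWeight]
    fun_prop
  have hdens : EqOn Γ.density (fun p => ((treeCycSign hσ : ℤ) : ℝ) *
      ((treeOrientation : ℤ) : ℝ) * w p) Γ.W := fun p hpW =>
    density_tree hσ hb p ((mem_W_tree hσ hb hO hr p).1 hpW).1.1.ne'
  have hnn : ∀ p ∈ Γ.W, 0 ≤ w p := fun p hpW =>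
    (ofReal_treeWeight hO.lt _ _ _ ((mem_W_tree hσ hb hO hr p).1 hpW).1).1
  have hlint : ∫⁻ p in Γ.W, ENNReal.ofReal (w p) ∂Γ.normalizedMeasure =
      ENNReal.ofReal ((4 * Real.pi) ^ 5)⁻¹ * (dirVolume O / shellMass ^ 5) := by
    have hax : Measurable fun p : Γ.Normalized => axisDensity O p.1 (firstCoords φ p.2.1)
        (secondCoords φ p.2.1) (thirdCoords φ p.2.1) :=
      measurable_axisDensity hO.measurable hs hp hq hx
    have hpt : ∀ p, Γ.W.indicator (fun p => ENNReal.ofReal (w p)) p =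
        ENNReal.ofReal ((4 * Real.pi) ^ 5)⁻¹ * (axisDensity O p.1 (firstCoords φ p.2.1)
          (secondCoords φ p.2.1) (thirdCoords φ p.2.1) *
          invCube (secondCoords φ p.2.1 - firstCoords φ p.2.1)) := by
      intro p
      by_cases hpW : p ∈ Γ.W
      · rw [indicator_of_mem hpW]
        exact (ofReal_treeWeight hO.lt _ _ _ ((mem_W_tree hσ hb hO hr p).1 hpW).1).2
      · rw [indicator_of_notMem hpW]
        rw [mem_W_tree hσ hb hO hr p] at hpW
        by_cases hc : 0 < thirdCoords φ p.2.1 0 ∧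
            (thirdCoords φ p.2.1 1 / thirdCoords φ p.2.1 0,
            thirdCoords φ p.2.1 2 / thirdCoords φ p.2.1 0) ∈ O
        · -- an edge of length zero, whose inverse cube has the junk value zero
          have hk : ∃ k, treeLength p.1 (firstCoords φ p.2.1) (secondCoords φ p.2.1)
              (thirdCoords φ p.2.1) k = 0 := by
            by_contra hne
            push Not at hne
            exact hpW ⟨hc, hne⟩
          obtain ⟨k, hk⟩ := hk
          rw [axisDensity, if_pos hc]
          unfold invCube
          fin_cases k <;> simp [treeLength] at hk <;> simp [hk]
        · rw [axisDensity, if_neg hc]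
          simp
    have hK : shellMass ^ 5 ≠ 0 := pow_ne_zero _ shellMass_ne_zero
    have hK' : shellMass ^ 5 ≠ ∞ := ENNReal.pow_ne_top shellMass_ne_top
    rw [← lintegral_indicator hW, lintegral_congr hpt, lintegral_const_mul _ (by fun_prop),
      normalizedMeasure, lintegral_prod _ (by fun_prop), ← lintegral_normalized φ hO.measurable hO.lt,
      mul_comm (shellMass ^ 5), ENNReal.mul_div_cancel_right hK hK']
  have hfin : ∫⁻ p in Γ.W, ENNReal.ofReal (w p) ∂Γ.normalizedMeasure < ∞ := by
    rw [hlint]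
    refine ENNReal.mul_lt_top ENNReal.ofReal_lt_top (ENNReal.div_lt_top (dirVolume_lt_top O).ne ?_)
    exact pow_ne_zero _ shellMass_ne_zero
  have hnn' : 0 ≤ᵐ[Γ.normalizedMeasure.restrict Γ.W] w := by
    filter_upwards [ae_restrict_mem hW] with p hpW using hnn p hpW
  have hint : IntegrableOn w Γ.W Γ.normalizedMeasure :=
    ⟨hwm.aestronglyMeasurable, (hasFiniteIntegral_iff_ofReal hnn').2 hfin⟩
  refine ⟨IntegrableOn.congr_fun (hint.const_mul _) hdens.symm hW, ?_⟩
  rw [f, setIntegral_congr_fun hW hdens, integral_const_mul,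
    integral_eq_lintegral_of_nonneg_ae hnn' hwm.aestronglyMeasurable, hlint, treeIntegral,
    ENNReal.toReal_mul, ENNReal.toReal_div, ENNReal.toReal_pow, shellMass,
    ENNReal.toReal_ofReal (show (0 : ℝ) ≤ 7 / 3 by norm_num),
    ENNReal.toReal_ofReal (show (0 : ℝ) ≤ ((4 * Real.pi) ^ 5)⁻¹ by positivity)]
  ring

end ConnOriented

namespace ConnOriented

variable {n : ℕ} (Γ : ConnOriented n)

/-! ### Diagrams with a triangle -/

theorem exists_edge {v w : Fin (2 * n)} (h : Γ.graph.Adj v w) :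
    ∃ (e : Γ.Edge) (ε : ℝ), ε ≠ 0 ∧ s(e.1.1, e.1.2) = s(v, w) ∧
      ∀ g : Fin (2 * n) → E3, ε • (g e.1.2 - g e.1.1) = g w - g v := by
  rcases lt_or_gt_of_ne h.ne with hlt | hlt
  · exact ⟨⟨(v, w), hlt, h⟩, 1, one_ne_zero, rfl, fun g => one_smul _ _⟩
  · exact ⟨⟨(w, v), hlt, h.symm⟩, -1, by norm_num, Sym2.eq_swap, fun g => by simp⟩

theorem exists_orthogonal (d d' : E3) : ∃ ν : E3, ν ≠ 0 ∧ inner ℝ ν d = 0 ∧ inner ℝ ν d' = 0 := by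
  have h : LinearMap.ker ((innerₗ E3 d).prod (innerₗ E3 d')) ≠ ⊥ :=
    LinearMap.ker_ne_bot_of_finrank_lt (by simp)
  obtain ⟨ν, hν, h0⟩ := Submodule.exists_mem_ne_zero_of_ne_bot h
  have hν' : (inner ℝ d ν, inner ℝ d' ν) = ((0, 0) : ℝ × ℝ) := hν
  obtain ⟨h1, h2⟩ := Prod.mk.inj hν'
  exact ⟨ν, h0, by rw [real_inner_comm]; exact h1, by rw [real_inner_comm]; exact h2⟩

/-- The edges of a triangle are coplanar, and their sum around the triangle vanishes. So does the
form: a normal to the plane, put at the three edges, is in the kernel of the transpose of the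
matrix. -/
theorem det_formMatrix_of_triangle {x y z : Fin (2 * n)} (hxy : Γ.graph.Adj x y)
    (hyz : Γ.graph.Adj y z) (hzx : Γ.graph.Adj z x) (p : E3 × (Γ.HalfEdge → ℝ)) :
    (Γ.formMatrix p).det = 0 := by
  obtain ⟨e₁, ε₁, hε, h1, g1⟩ := Γ.exists_edge hxy
  obtain ⟨e₂, ε₂, hε₂, h2, g2⟩ := Γ.exists_edge hyz
  obtain ⟨e₃, ε₃, hε₃, h3, g3⟩ := Γ.exists_edge hzx
  have h12 : e₁ ≠ e₂ := by
    rintro rfl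
    rw [h1] at h2
    have := hxy.ne; have := hyz.ne; have := hzx.ne
    simp only [Sym2.eq_iff] at h2
    grind
  have h13 : e₁ ≠ e₃ := by
    rintro rfl
    rw [h1] at h3
    have := hxy.ne; have := hyz.ne; have := hzx.ne
    simp only [Sym2.eq_iff] at h3
    grind
  obtain ⟨ν, hν, hd, hd'⟩ := exists_orthogonal (Γ.position p.1 p.2 y - Γ.position p.1 p.2 x)
    (Γ.position p.1 p.2 z - Γ.position p.1 p.2 y)
  have hd'' : inner ℝ ν (Γ.position p.1 p.2 x - Γ.position p.1 p.2 z) = 0 := by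
    rw [← sub_add_sub_cancel (Γ.position p.1 p.2 x) (Γ.position p.1 p.2 y), inner_add_right,
      ← neg_sub, inner_neg_right, hd, ← neg_sub (Γ.position p.1 p.2 z), inner_neg_right, hd']
    simp
  have hnorm : ∀ (e : Γ.Edge) (ε : ℝ) (v w : Fin (2 * n)), ε ≠ 0 →
      (∀ g : Fin (2 * n) → E3, ε • (g e.1.2 - g e.1.1) = g w - g v) →
      inner ℝ ν (Γ.position p.1 p.2 w - Γ.position p.1 p.2 v) = 0 →
      ∀ k, ε * ∑ i, ν i * Γ.formMatrix p (Sum.inl (e, i)) k =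
        inner ℝ ν (Γ.velocity p (Γ.basisVec k) w - Γ.velocity p (Γ.basisVec k) v) := by
    intro e ε v w hε hg h0 k
    have hdisp : inner ℝ ν (Γ.displacement p e) = 0 := by
      have h := hg (Γ.position p.1 p.2)
      rw [← h, inner_smul_right] at h0
      exact (mul_eq_zero.1 h0).resolve_left hε
    have hin : ∀ u : E3, inner ℝ ν u = ∑ i, ν i * u i := fun u => by
      simp [PiLp.inner_apply, mul_comm]
    rw [← hg (Γ.velocity p (Γ.basisVec k)), ← fderiv_displacement, inner_smul_right]
    congr 1
    rw [hin]
    simp only [formMatrix, mul_add, Finset.sum_add_distrib]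
    split_ifs
    · rw [← hin, hdisp, zero_add]
    · simp
  set v : Γ.Index → ℝ := Sum.elim (fun r => ((if r.1 = e₁ then ε₁ else 0) +
    (if r.1 = e₂ then ε₂ else 0) + (if r.1 = e₃ then ε₃ else 0)) * ν r.2) 0 with hv
  refine Matrix.exists_vecMul_eq_zero_iff.1 ⟨v, ?_, ?_⟩
  · obtain ⟨i, hi⟩ : ∃ i, ν i ≠ 0 := by
      by_contra hne
      push Not at hne
      exact hν (by ext i; exact hne i)
    intro h0
    have := congrFun h0 (Sum.inl (e₁, i))
    simp [hv, h12, h13, hε, hi] at this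
  · ext k
    have hk : Matrix.vecMul v (Γ.formMatrix p) k =
        ε₁ * ∑ i, ν i * Γ.formMatrix p (Sum.inl (e₁, i)) k +
        ε₂ * ∑ i, ν i * Γ.formMatrix p (Sum.inl (e₂, i)) k +
        ε₃ * ∑ i, ν i * Γ.formMatrix p (Sum.inl (e₃, i)) k := by
      simp only [Matrix.vecMul, dotProduct, Fintype.sum_sum_type, Fintype.sum_prod_type, hv,
        Sum.elim_inl, Sum.elim_inr, Pi.zero_apply, zero_mul, Finset.sum_const_zero, add_zero,
        add_mul, Finset.sum_add_distrib, Finset.mul_sum, mul_assoc]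
      simp [ite_mul]
    rw [hk, hnorm e₁ ε₁ x y hε g1 hd, hnorm e₂ ε₂ y z hε₂ g2 hd', hnorm e₃ ε₃ z x hε₃ g3 hd'',
      ← inner_add_right, ← inner_add_right]
    simp

theorem integral_of_triangle {x y z : Fin (2 * n)} (hxy : Γ.graph.Adj x y)
    (hyz : Γ.graph.Adj y z) (hzx : Γ.graph.Adj z x) : Γ.Converges ∧ Γ.f = 0 := by
  have h : Γ.density = 0 := by
    ext p
    simp [density, Γ.det_formMatrix_of_triangle hxy hyz hzx]
  rw [Converges, f, h]
  exact ⟨integrableOn_zero, by simp⟩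

end ConnOriented

/-! ### The connected diagrams of degree three without triangles -/

/-- A set of vertices that contains the neighbours of its elements is everything. -/
theorem mem_of_connected {V : Type*} {G : SimpleGraph V} (hG : G.Connected) {S : Set V} {v : V}
    (hv : v ∈ S) (hS : ∀ a ∈ S, ∀ b, G.Adj a b → b ∈ S) (w : V) : w ∈ S := by
  have h := (G.reachable_iff_reflTransGen v w).1 (hG.preconnected v w)
  induction h with
  | refl => exact hv
  | tail _ hab ih => exact hS _ ih _ hab

namespace Diagram

theorem exists_neighbors (D : Diagram 3) (hD : D.graph.Connected) {u : Fin (2 * 3)}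
    (hu : D.IsUni u) : ∃ t y z, y ≠ z ∧ u ≠ y ∧ u ≠ z ∧ (∀ w, D.graph.Adj u w ↔ w = t) ∧
      ∀ w, D.graph.Adj t w ↔ w = u ∨ w = y ∨ w = z := by
  obtain ⟨t, ht⟩ := ncard_eq_one.1 hu
  have hut : ∀ w, D.graph.Adj u w ↔ w = t := fun w => by
    rw [← SimpleGraph.mem_neighborSet, ht, mem_singleton_iff]
  have htu : u ∈ D.graph.neighborSet t := ((hut t).2 rfl).symm
  rcases D.valency t with h | h
  · obtain ⟨u', h'⟩ := ncard_eq_one.1 h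
    have hu' : u = u' := by rwa [h'] at htu
    have hall := mem_of_connected hD (S := {u, t}) (v := u) (by simp) (by
      rintro a (rfl | rfl) b hab
      · exact Or.inr ((hut b).1 hab)
      · left
        have : b ∈ D.graph.neighborSet a := hab
        rw [h'] at this
        rw [hu']
        exact this)
    have hcard : (univ : Set (Fin (2 * 3))).ncard ≤ ({u, t} : Set (Fin (2 * 3))).ncard :=
      ncard_le_ncard (fun w _ => hall w) (toFinite _)
    have := ncard_insert_le u {t}
    rw [ncard_univ, Nat.card_eq_fintype_card, Fintype.card_fin] at hcard
    rw [ncard_singleton] at this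
    omega
  · obtain ⟨a, b, c, hab, hac, hbc, hs⟩ := ncard_eq_three.1 h
    have hadj : ∀ w, D.graph.Adj t w ↔ w = a ∨ w = b ∨ w = c := fun w => by
      rw [← SimpleGraph.mem_neighborSet, hs]
      rfl
    rw [hs] at htu
    rcases htu with rfl | rfl | rfl
    · exact ⟨t, b, c, hbc, hab, hac, hut, hadj⟩
    · exact ⟨t, a, c, hac, hab.symm, hbc, hut, fun w => (hadj w).trans (by tauto)⟩
    · exact ⟨t, a, b, hab, hac.symm, hbc.symm, hut, fun w => (hadj w).trans (by tauto)⟩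

/-- The number of neighbours of a vertex, for a list of all vertices. -/
theorem valency_sum (D : Diagram 3) {a b c d e f : Fin (2 * 3)}
    (h : Function.Injective (![a, b, c, d, e, f] : Fin (2 * 3) → Fin (2 * 3))) (v : Fin (2 * 3))
    (g : Fin (2 * 3) → ℕ) (hg : ∀ w, D.graph.Adj v w ∧ g w = 1 ∨ ¬ D.graph.Adj v w ∧ g w = 0) :
    g a + g b + g c + g d + g e + g f = 1 ∨ g a + g b + g c + g d + g e + g f = 3 := by
  classical
  have hn : (D.graph.neighborSet v).ncard = ∑ w, g w := by
    have : D.graph.neighborSet v =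
        (Finset.univ.filter fun w => D.graph.Adj v w : Finset (Fin (2 * 3))) := by
      ext w
      simp
    rw [this, ncard_coe_finset, Finset.card_filter]
    refine Finset.sum_congr rfl fun w _ => ?_
    rcases hg w with ⟨h1, h2⟩ | ⟨h1, h2⟩ <;> simp [h1, h2]
  have hs : ∑ w, g w = g a + g b + g c + g d + g e + g f := by
    rw [← (Equiv.ofBijective _ (Finite.injective_iff_bijective.1 h)).sum_comp]
    exact Fin.sum_univ_six _
  rw [← hs, ← hn]
  exact D.valency v

theorem treeLabel_of_lt {D : Diagram 3} {σ : Equiv.Perm (Fin (2 * 3))}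
    (h : ∀ i j, i < j → (D.graph.Adj (σ i) (σ j) ↔ treeAdj i j)) (i j : Fin (2 * 3)) :
    D.graph.Adj (σ i) (σ j) ↔ treeAdj i j := by
  rcases lt_trichotomy i j with hij | rfl | hij
  · exact h i j hij
  · have : ¬ treeAdj i i := by revert i; decide
    simp [this]
  · rw [D.graph.adj_comm, h j i hij]
    exact ⟨treeAdj_symm, treeAdj_symm⟩

theorem treeLabel_of_adj {D : Diagram 3} {σ : Equiv.Perm (Fin (2 * 3))}
    (h0 : ∀ j, D.graph.Adj (σ 0) (σ j) ↔ j = 4)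
    (h4 : ∀ j, D.graph.Adj (σ 4) (σ j) ↔ j = 0 ∨ j = 1 ∨ j = 5)
    (h12 : ¬ D.graph.Adj (σ 1) (σ 2)) (h13 : ¬ D.graph.Adj (σ 1) (σ 3))
    (h15 : ¬ D.graph.Adj (σ 1) (σ 5))
    (h23 : ¬ D.graph.Adj (σ 2) (σ 3)) (h25 : D.graph.Adj (σ 2) (σ 5))
    (h35 : D.graph.Adj (σ 3) (σ 5)) (i j : Fin (2 * 3)) :
    D.graph.Adj (σ i) (σ j) ↔ treeAdj i j := by
  refine treeLabel_of_lt (fun i j hij => ?_) i j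
  have h01 : ¬ D.graph.Adj (σ 0) (σ 1) := fun h => absurd ((h0 1).1 h) (by decide)
  have h02 : ¬ D.graph.Adj (σ 0) (σ 2) := fun h => absurd ((h0 2).1 h) (by decide)
  have h03 : ¬ D.graph.Adj (σ 0) (σ 3) := fun h => absurd ((h0 3).1 h) (by decide)
  have h05 : ¬ D.graph.Adj (σ 0) (σ 5) := fun h => absurd ((h0 5).1 h) (by decide)
  have h04 : D.graph.Adj (σ 0) (σ 4) := (h0 4).2 rfl
  have h14 : D.graph.Adj (σ 1) (σ 4) := ((h4 1).2 (by decide)).symm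
  have h45 : D.graph.Adj (σ 4) (σ 5) := (h4 5).2 (by decide)
  have h24 : ¬ D.graph.Adj (σ 2) (σ 4) := fun h => absurd ((h4 2).1 h.symm) (by decide)
  have h34 : ¬ D.graph.Adj (σ 3) (σ 4) := fun h => absurd ((h4 3).1 h.symm) (by decide)
  fin_cases i <;> fin_cases j <;> first
    | exact absurd hij (by decide)
    | exact iff_of_true h04 (by decide) | exact iff_of_true h14 (by decide)
    | exact iff_of_true h45 (by decide) | exact iff_of_true h25 (by decide)
    | exact iff_of_true h35 (by decide) | exact iff_of_false h01 (by decide)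
    | exact iff_of_false h02 (by decide) | exact iff_of_false h03 (by decide)
    | exact iff_of_false h05 (by decide) | exact iff_of_false h12 (by decide)
    | exact iff_of_false h13 (by decide) | exact iff_of_false h15 (by decide)
    | exact iff_of_false h23 (by decide) | exact iff_of_false h24 (by decide)
    | exact iff_of_false h34 (by decide)

/-- A connected diagram without triangles is a tree with four legs, any of which can be given the
label `0`. -/
theorem exists_treeLabel (D : Diagram 3) (hD : D.graph.Connected)
    (hT : ∀ x y z, D.graph.Adj x y → D.graph.Adj y z → ¬ D.graph.Adj z x) {u : Fin (2 * 3)}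
    (hu : D.IsUni u) :
    ∃ σ : Equiv.Perm (Fin (2 * 3)), σ 0 = u ∧ ∀ i j, D.graph.Adj (σ i) (σ j) ↔ treeAdj i j := by
  obtain ⟨t, y, z, hyz, huy, huz, hut, ht⟩ := D.exists_neighbors hD hu
  have htu : t ≠ u := fun h => D.graph.irrefl ((hut u).2 h.symm)
  have hty : t ≠ y := fun h => D.graph.irrefl ((ht t).2 (Or.inr (Or.inl h)))
  have htz : t ≠ z := fun h => D.graph.irrefl ((ht t).2 (Or.inr (Or.inr h)))
  obtain ⟨v, w, hvw, hS⟩ : ∃ v w, v ≠ w ∧ ({u, t, y, z} : Finset (Fin (2 * 3)))ᶜ = {v, w} := by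
    rw [← Finset.card_eq_two, Finset.card_compl, Fintype.card_fin]
    rw [Finset.card_insert_of_notMem (by simp; tauto), Finset.card_insert_of_notMem (by simp; tauto),
      Finset.card_insert_of_notMem (by simpa), Finset.card_singleton]
  have hv : v ∈ ({u, t, y, z} : Finset (Fin (2 * 3)))ᶜ := by rw [hS]; simp
  have hw : w ∈ ({u, t, y, z} : Finset (Fin (2 * 3)))ᶜ := by rw [hS]; simp
  simp only [Finset.mem_compl, Finset.mem_insert, Finset.mem_singleton, not_or] at hv hw
  have hinj : ∀ y z, y ≠ z → u ≠ y → u ≠ z → t ≠ y → t ≠ z → v ≠ y → v ≠ z → w ≠ y → w ≠ z →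
      Function.Injective (![u, y, v, w, t, z] : Fin (2 * 3) → Fin (2 * 3)) := by
    intro y z h1 h2 h3 h4 h5 h6 h7 h8 h9 i j hij
    fin_cases i <;> fin_cases j <;> simp at hij ⊢ <;> grind
  set τ : Equiv.Perm (Fin (2 * 3)) := Equiv.ofBijective _ (Finite.injective_iff_bijective.1
    (hinj y z hyz huy huz hty htz hv.2.2.1 hv.2.2.2 hw.2.2.1 hw.2.2.2)) with hτ
  set τ' : Equiv.Perm (Fin (2 * 3)) := Equiv.ofBijective _ (Finite.injective_iff_bijective.1
    (hinj z y hyz.symm huz huy htz hty hv.2.2.2 hv.2.2.1 hw.2.2.2 hw.2.2.1)) with hτ'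
  have h0 : ∀ ρ : Equiv.Perm (Fin (2 * 3)), ρ 0 = u → ρ 4 = t →
      ∀ j, D.graph.Adj (ρ 0) (ρ j) ↔ j = 4 := by
    intro ρ h0 h4 j
    rw [h0, hut, ← h4, ρ.injective.eq_iff]
  have h4 : ∀ ρ : Equiv.Perm (Fin (2 * 3)), ρ 0 = u → ρ 4 = t →
      (ρ 1 = y ∧ ρ 5 = z ∨ ρ 1 = z ∧ ρ 5 = y) →
      ∀ j, D.graph.Adj (ρ 4) (ρ j) ↔ j = 0 ∨ j = 1 ∨ j = 5 := by
    rintro ρ h0 h4 h15 j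
    rw [h4, ht, ← h0]
    rcases h15 with ⟨rfl, rfl⟩ | ⟨rfl, rfl⟩
    · simp only [ρ.injective.eq_iff]
    · simp only [ρ.injective.eq_iff]
      tauto
  have hyz' : ¬ D.graph.Adj y z := fun h =>
    hT t y z ((ht y).2 (by simp)) h ((ht z).2 (by simp)).symm
  have hzy' : ¬ D.graph.Adj z y := fun h => hyz' h.symm
  have hty' : D.graph.Adj t y := (ht y).2 (by simp)
  have htz' : D.graph.Adj t z := (ht z).2 (by simp)
  have htv' : ¬ D.graph.Adj t v := fun h => by have := (ht v).1 h; tauto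
  have htw' : ¬ D.graph.Adj t w := fun h => by have := (ht w).1 h; tauto
  have hu' : ∀ x, x ≠ t → ¬ D.graph.Adj u x := fun x hx h => hx ((hut x).1 h)
  have huy' := hu' y hty.symm
  have huz' := hu' z htz.symm
  have huv' := hu' v hv.2.1
  have huw' := hu' w hw.2.1
  have hc := D.graph.adj_comm
  have hall := mem_of_connected hD (S := {v, w}) (v := v) (by simp)
  classical
  have hval := fun x => D.valency_sum (hinj y z hyz huy huz hty htz hv.2.2.1 hv.2.2.2 hw.2.2.1
    hw.2.2.2) x (fun w => if D.graph.Adj x w then 1 else 0) (fun w => by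
      by_cases h : D.graph.Adj x w <;> simp [h])
  have k1 := hval y
  have k2 := hval v
  have k3 := hval w
  have k5 := hval z
  simp only [SimpleGraph.irrefl,
    hyz', hzy', hc y u, hc z u, hc v u, hc w u, hc y t, hc z t, hc v t, hc w t, hc v y, hc w y,
    hc v z, hc w z, hc w v, hty', htz', htv', htw', huy', huz', huv', huw', if_true, if_false,
    zero_add, add_zero] at k1 k2 k3 k5
  by_cases a1 : D.graph.Adj y v <;> by_cases a2 : D.graph.Adj y w <;>
    by_cases a3 : D.graph.Adj z v <;> by_cases a4 : D.graph.Adj z w <;>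
    by_cases a5 : D.graph.Adj v w <;> simp only [a1, a2, a3, a4, a5, if_true, if_false] at k1 k2 k3 k5 <;>
    first | (exfalso; omega) | skip
  · exact absurd a2.symm (hT y v w a1 a5)
  · exact ⟨τ', rfl, treeLabel_of_adj (h0 τ' rfl rfl) (h4 τ' rfl rfl (Or.inr ⟨rfl, rfl⟩)) a3 a4 hzy'
      a5 a1.symm a2.symm⟩
  · exact ⟨τ, rfl, treeLabel_of_adj (h0 τ rfl rfl) (h4 τ rfl rfl (Or.inl ⟨rfl, rfl⟩)) a1 a2 hyz'
      a5 a3.symm a4.symm⟩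
  · -- the vertices `v` and `w` form a component
    have := hall (by
      rintro a (rfl | rfl) b hab
      · obtain ⟨i, rfl⟩ := τ.surjective b
        have ha := (hc a (τ i)).1 hab
        fin_cases i
        exacts [absurd ha huv', absurd ha a1, absurd ha (D.graph.irrefl), Or.inr rfl,
          absurd ha htv', absurd ha a3]
      · obtain ⟨i, rfl⟩ := τ.surjective b
        have ha := (hc a (τ i)).1 hab
        fin_cases i
        exacts [absurd ha huw', absurd ha a2, Or.inl rfl, absurd ha (D.graph.irrefl),
          absurd ha htw', absurd ha a4]) u
    rcases this with h | h
    · exact absurd h.symm hv.1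
    · exact absurd h.symm hw.1

/-- The labelling can be chosen so that the two univalent vertices of the second pair are in
order. -/
theorem exists_treeLabel_lt (D : Diagram 3) (hD : D.graph.Connected)
    (hT : ∀ x y z, D.graph.Adj x y → D.graph.Adj y z → ¬ D.graph.Adj z x) {u : Fin (2 * 3)}
    (hu : D.IsUni u) :
    ∃ σ : Equiv.Perm (Fin (2 * 3)), σ 0 = u ∧ (∀ i j, D.graph.Adj (σ i) (σ j) ↔ treeAdj i j) ∧
      D.lt (σ 2) (σ 3) := by
  obtain ⟨σ, h0, hσ⟩ := D.exists_treeLabel hD hT hu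
  have huni : ∀ l : Fin 4, D.IsUni (σ (treeHead l.castSucc)) := by
    intro l
    have : D.graph.neighborSet (σ (treeHead l.castSucc)) = {σ (treeTail l.castSucc)} := by
      ext w
      obtain ⟨w, rfl⟩ := σ.surjective w
      rw [SimpleGraph.mem_neighborSet, hσ, mem_singleton_iff, σ.injective.eq_iff]
      revert l w
      decide
    rw [IsUni, this, ncard_singleton]
  rcases D.lt_total (σ 2) (σ 3) (huni 2) (huni 3) (by simp) with h | h
  · exact ⟨σ, h0, hσ, h⟩
  · refine ⟨(Equiv.swap 2 3).trans σ, by simpa [Equiv.swap_apply_of_ne_of_ne] using h0,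
      fun i j => ?_, by simpa using h⟩
    rw [Equiv.trans_apply, Equiv.trans_apply, hσ]
    revert i j
    decide

end Diagram

/-- The ranks of the univalent vertices `a`, `b`, `c`, `d` of a tree in the order `a < b < c < d`. -/
def rankSeparated : Fin 4 → ℕ := ![0, 1, 2, 3]

/-- The ranks of the univalent vertices `a`, `b`, `c`, `d` of a tree in the order `a < c < b < d`. -/
def rankCrossed : Fin 4 → ℕ := ![0, 2, 1, 3]

/-- The ranks of the univalent vertices `a`, `b`, `c`, `d` of a tree in the order `a < c < d < b`. -/
def rankNested : Fin 4 → ℕ := ![0, 3, 1, 2]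

/-- The order on the line of the univalent vertices of a labelled tree. -/
theorem exists_rank {L : Fin 4 → Fin 4 → Prop} (hirr : ∀ l, ¬ L l l)
    (htrans : ∀ l m k, L l m → L m k → L l k) (htot : ∀ l m, l ≠ m → L l m ∨ L m l)
    (h0 : ∀ l, ¬ L l 0) (h23 : L 2 3) :
    (∀ l m, L l m ↔ rankSeparated l < rankSeparated m) ∨
      (∀ l m, L l m ↔ rankCrossed l < rankCrossed m) ∨
      (∀ l m, L l m ↔ rankNested l < rankNested m) := by
  have key : ∀ r : Fin 4 → ℕ, Function.Injective r → (∀ l m, r l < r m → L l m) →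
      ∀ l m, L l m ↔ r l < r m := by
    intro r hr h l m
    refine ⟨fun hl => ?_, h l m⟩
    rcases lt_trichotomy (r l) (r m) with h1 | h1 | h1
    · exact h1
    · rw [hr h1] at hl
      exact absurd hl (hirr m)
    · exact absurd (htrans _ _ _ hl (h m l h1)) (hirr l)
  have h01 : L 0 1 := (htot 0 1 (by decide)).resolve_right (h0 1)
  have h02 : L 0 2 := (htot 0 2 (by decide)).resolve_right (h0 2)
  have h03 : L 0 3 := (htot 0 3 (by decide)).resolve_right (h0 3)
  rcases htot 1 2 (by decide) with h12 | h21
  · have h13 := htrans _ _ _ h12 h23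
    refine Or.inl (key _ (by decide) fun l m h => ?_)
    fin_cases l <;> fin_cases m <;> first | assumption | exact absurd h (by decide)
  · rcases htot 1 3 (by decide) with h13 | h31
    · refine Or.inr (Or.inl (key _ (by decide) fun l m h => ?_))
      fin_cases l <;> fin_cases m <;> first | assumption | exact absurd h (by decide)
    · refine Or.inr (Or.inr (key _ (by decide) fun l m h => ?_))
      fin_cases l <;> fin_cases m <;> first | assumption | exact absurd h (by decide)

theorem treeOrder_separated : ConnOriented.TreeOrder rankSeparated separated where
  measurable := measurableSet_separated
  lt := lt_of_mem_separated
  iff x h0 := by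
    constructor
    · intro h
      have h1 : x 0 < x 1 := h 0 1 (by decide)
      have h2 : x 1 < x 2 := h 1 2 (by decide)
      have h3 : x 2 < x 3 := h 2 3 (by decide)
      rw [h0] at h1
      exact ⟨h1, (one_lt_div h1).2 h2, div_lt_div_of_pos_right h3 h1⟩
    · rintro ⟨h1, h2, h3⟩
      have h2' := (one_lt_div h1).1 h2
      have h3' := (div_lt_div_iff_of_pos_right h1).1 h3
      intro l m hlm
      fin_cases l <;> fin_cases m <;> first | exact absurd hlm (by decide) | (simp [h0]; linarith)

theorem treeOrder_crossed : ConnOriented.TreeOrder rankCrossed crossed where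
  measurable := measurableSet_crossed
  lt := lt_of_mem_crossed
  iff x h0 := by
    constructor
    · intro h
      have h1 : x 0 < x 2 := h 0 2 (by decide)
      have h2 : x 2 < x 1 := h 2 1 (by decide)
      have h3 : x 1 < x 3 := h 1 3 (by decide)
      rw [h0] at h1
      have h4 := h1.trans h2
      exact ⟨h4, div_pos h1 h4, (div_lt_one h4).2 h2, (one_lt_div h4).2 h3⟩
    · rintro ⟨h1, h2, h3, h4⟩
      have h2' := (div_pos_iff_of_pos_right h1).1 h2
      have h3' := (div_lt_one h1).1 h3
      have h4' := (one_lt_div h1).1 h4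
      intro l m hlm
      fin_cases l <;> fin_cases m <;> first | exact absurd hlm (by decide) | (simp [h0]; linarith)

theorem treeOrder_nested : ConnOriented.TreeOrder rankNested nested where
  measurable := measurableSet_nested
  lt := lt_of_mem_nested
  iff x h0 := by
    constructor
    · intro h
      have h1 : x 0 < x 2 := h 0 2 (by decide)
      have h2 : x 2 < x 3 := h 2 3 (by decide)
      have h3 : x 3 < x 1 := h 3 1 (by decide)
      rw [h0] at h1
      have h4 := (h1.trans h2).trans h3
      exact ⟨h4, div_pos h1 h4, div_lt_div_of_pos_right h2 h4, (div_lt_one h4).2 h3⟩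
    · rintro ⟨h1, h2, h3, h4⟩
      have h2' := (div_pos_iff_of_pos_right h1).1 h2
      have h3' := (div_lt_div_iff_of_pos_right h1).1 h3
      have h4' := (div_lt_one h1).1 h4
      intro l m hlm
      fin_cases l <;> fin_cases m <;> first | exact absurd hlm (by decide) | (simp [h0]; linarith)

/-! ### Diagrams described by tables -/

/-- A table describing an oriented diagram of degree three: the adjacency, the ranks of the
univalent vertices on the line, and the cyclic orders. The univalent vertices get the standard
orientation of the line. -/
structure DiagramTable where
  adj : Fin (2 * 3) → Fin (2 * 3) → Bool
  rank : Fin (2 * 3) → ℕ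
  cyc : Fin (2 * 3) → Fin (2 * 3) → Fin 3

namespace DiagramTable

/-- The number of neighbours. -/
def deg (d : DiagramTable) (v : Fin (2 * 3)) : ℕ := (Finset.univ.filter fun w => d.adj v w).card

/-- The conditions for a table to describe a diagram. The condition that every component
contains a univalent vertex is replaced by a stronger one. -/
def Valid (d : DiagramTable) : Prop :=
  (∀ i j, d.adj i j → d.adj j i) ∧ (∀ i, ¬ d.adj i i) ∧ (∀ i, d.deg i = 1 ∨ d.deg i = 3) ∧
  (∀ i, d.deg i = 1 ∨ ∃ j, d.adj i j ∧ d.deg j = 1) ∧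
  (∀ i j, d.deg i = 1 → d.deg j = 1 → d.rank i = d.rank j → i = j) ∧
  ∀ t, d.deg t = 3 → ∀ x y, d.adj t x → d.adj t y → d.cyc t x = d.cyc t y → x = y

instance (d : DiagramTable) : Decidable d.Valid := by unfold Valid; infer_instance

theorem ncard_eq_deg (d : DiagramTable) (v : Fin (2 * 3)) :
    {w | d.adj v w = true}.ncard = d.deg v := by
  rw [deg, ← ncard_coe_finset]
  congr 1
  ext w
  simp

/-- The oriented diagram described by a table. -/
def toOriented (d : DiagramTable) (h : d.Valid) : OrientedDiagram 3 where
  graph := { Adj := fun i j => d.adj i j, symm := ⟨h.1⟩, loopless := ⟨h.2.1⟩ }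
  valency v := by
    have := h.2.2.1 v
    rwa [← ncard_eq_deg] at this
  meets v := by
    rcases h.2.2.2.1 v with h1 | ⟨u, hu, h1⟩
    · rw [← ncard_eq_deg] at h1
      exact ⟨v, SimpleGraph.Reachable.refl v, h1⟩
    · rw [← ncard_eq_deg] at h1
      exact ⟨u, SimpleGraph.Adj.reachable hu, h1⟩
  lt i j := d.deg i = 1 ∧ d.deg j = 1 ∧ d.rank i < d.rank j
  lt_univalent a b hab := by
    have := hab.1
    have := hab.2.1
    rw [← ncard_eq_deg] at *
    exact ⟨by assumption, by assumption⟩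
  lt_irrefl a ha := lt_irrefl _ ha.2.2
  lt_trans a b c hab hbc := ⟨hab.1, hbc.2.1, hab.2.2.trans hbc.2.2⟩
  lt_total a b ha hb hab := by
    change {w | d.adj a w = true}.ncard = 1 at ha
    change {w | d.adj b w = true}.ncard = 1 at hb
    rw [ncard_eq_deg] at ha hb
    rcases lt_trichotomy (d.rank a) (d.rank b) with h1 | h1 | h1
    · exact Or.inl ⟨ha, hb, h1⟩
    · exact absurd (h.2.2.2.2.1 a b ha hb h1) hab
    · exact Or.inr ⟨hb, ha, h1⟩
  cyc := d.cyc
  cyc_injOn t ht x hx y hy hxy := by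
    change {w | d.adj t w = true}.ncard = 3 at ht
    rw [ncard_eq_deg] at ht
    exact h.2.2.2.2.2 t ht x y hx hy hxy
  sgn _ := 1

theorem isUni_toOriented {d : DiagramTable} (h : d.Valid) (v : Fin (2 * 3)) :
    (d.toOriented h).IsUni v ↔ d.deg v = 1 := by
  rw [← ncard_eq_deg]
  rfl

theorem isTri_toOriented {d : DiagramTable} (h : d.Valid) (v : Fin (2 * 3)) :
    (d.toOriented h).IsTri v ↔ d.deg v = 3 := by
  rw [← ncard_eq_deg]
  rfl

variable {d d' : DiagramTable} (h : d.Valid) (h' : d'.Valid)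

instance : DecidableRel (d.toOriented h).graph.Adj := fun i j =>
  inferInstanceAs (Decidable (d.adj i j = true))

instance : DecidableRel (d.toOriented h).lt := fun i j =>
  inferInstanceAs (Decidable (d.deg i = 1 ∧ d.deg j = 1 ∧ d.rank i < d.rank j))

instance : DecidablePred (d.toOriented h).IsUni := fun v =>
  decidable_of_iff _ (isUni_toOriented h v).symm

instance : DecidablePred (d.toOriented h).IsTri := fun v =>
  decidable_of_iff _ (isTri_toOriented h v).symm

instance (v v' : Fin (2 * 3)) (ρ : Equiv.Perm (Fin (2 * 3))) :
    Decidable ((d.toOriented h).SameOr (d'.toOriented h') v v' ρ) := by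
  unfold OrientedDiagram.SameOr; infer_instance

instance (t p q r : Fin (2 * 3)) : Decidable ((d.toOriented h).CycAt t p q r) := by
  unfold OrientedDiagram.CycAt; infer_instance

instance (σ : Equiv.Perm (Fin (2 * 3))) :
    Decidable ((d.toOriented h).IsIso (d'.toOriented h').toDiagram σ) := by
  unfold Diagram.IsIso; infer_instance

instance (u t p : Fin (2 * 3)) :
    Decidable ((d.toOriented h).Resolves (d'.toOriented h') u t p) := by
  unfold OrientedDiagram.Resolves; infer_instance

end DiagramTable

/-- The table of `stdTree r`. -/
def treeTable (r : Fin 4 → ℕ) : DiagramTable where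
  adj i j := decide (treeAdj i j)
  rank := ![r 0, r 1, r 2, r 3, 0, 0]
  cyc := ![0, 0, 0, 0, ![1, 2, 0, 0, 0, 0], ![0, 0, 1, 2, 0, 0]]

theorem treeTable_valid {r : Fin 4 → ℕ} (hr : Function.Injective r) : (treeTable r).Valid := by
  have hdeg : ∀ i : Fin (2 * 3), (treeTable r).deg i = ![1, 1, 1, 1, 3, 3] i := by
    have : (treeTable r).deg = (treeTable 0).deg := rfl
    rw [this]
    decide
  refine ⟨?_, ?_, ?_, ?_, ?_, ?_⟩
  · exact (by decide : ∀ i j, (treeTable 0).adj i j → (treeTable 0).adj j i)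
  · exact (by decide : ∀ i, ¬ (treeTable 0).adj i i)
  · exact (by decide : ∀ i, (treeTable 0).deg i = 1 ∨ (treeTable 0).deg i = 3)
  · exact (by decide : ∀ i, (treeTable 0).deg i = 1 ∨
      ∃ j, (treeTable 0).adj i j ∧ (treeTable 0).deg j = 1)
  · simp only [hdeg]
    intro i j hi hj hij
    fin_cases i <;> fin_cases j <;> first
      | rfl | exact absurd hi (by decide) | exact absurd hj (by decide)
      | exact absurd (hr hij) (by decide)
  · exact (by decide : ∀ t, (treeTable 0).deg t = 3 → ∀ x y, (treeTable 0).adj t x →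
      (treeTable 0).adj t y → (treeTable 0).cyc t x = (treeTable 0).cyc t y → x = y)

/-- The tree with univalent vertices `0`, `1`, `2`, `3` in the order given by `r`, joined to the
trivalent vertices `4`, `4`, `5`, `5`. -/
def stdTree (r : Fin 4 → ℕ) (hr : Function.Injective r) : OrientedDiagram 3 :=
  (treeTable r).toOriented (treeTable_valid hr)

theorem rankSeparated_injective : Function.Injective rankSeparated := by decide

theorem rankCrossed_injective : Function.Injective rankCrossed := by decide

theorem rankNested_injective : Function.Injective rankNested := by decide

/-! ### Relations between the classes of the trees -/

namespace OrientedDiagram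

variable {n : ℕ} {Γ Γ' ΓI ΓH ΓX ΓT ΓU ΓS : OrientedDiagram n}

theorem cls_eq_of_isomorphic (h : Γ.Isomorphic Γ') : Γ'.cls = Γ.cls := by
  rw [← sub_eq_zero, cls, cls, ← map_sub, Submodule.mkQ_apply, Submodule.Quotient.mk_eq_zero]
  exact Submodule.subset_span (Or.inl (Or.inl (Or.inl ⟨Γ, Γ', h, rfl⟩)))

theorem cls_eq_neg_of_as (h : Γ.AS Γ') : Γ'.cls = -Γ.cls := by
  rw [eq_neg_iff_add_eq_zero, cls, cls, ← map_add, Submodule.mkQ_apply,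
    Submodule.Quotient.mk_eq_zero]
  exact Submodule.subset_span (Or.inl (Or.inl (Or.inr ⟨Γ, Γ', h, rfl⟩)))

theorem cls_eq_of_ihx (h : ΓI.IHX ΓH ΓX) : ΓI.cls = ΓH.cls - ΓX.cls := by
  rw [← sub_eq_zero, cls, cls, cls, ← map_sub, ← map_sub, Submodule.mkQ_apply,
    Submodule.Quotient.mk_eq_zero]
  exact Submodule.subset_span (Or.inl (Or.inr ⟨ΓI, ΓH, ΓX, h, rfl⟩))

theorem cls_eq_of_stu (h : ΓT.STU ΓU ΓS) : ΓT.cls = ΓU.cls - ΓS.cls := by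
  rw [← sub_eq_zero, cls, cls, cls, ← map_sub, ← map_sub, Submodule.mkQ_apply,
    Submodule.Quotient.mk_eq_zero]
  exact Submodule.subset_span (Or.inr ⟨ΓT, ΓU, ΓS, h, rfl⟩)

end OrientedDiagram

namespace DiagramTable

/-- The table of a diagram with given edges. -/
def ofEdges (edges : List (Fin (2 * 3) × Fin (2 * 3))) (rank : Fin (2 * 3) → ℕ)
    (cyc : Fin (2 * 3) → Fin (2 * 3) → Fin 3) : DiagramTable where
  adj i j := decide ((i, j) ∈ edges ∨ (j, i) ∈ edges)
  rank := rank
  cyc := cyc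

/-- A table with the cyclic order at `v` reversed. -/
def reverse (d : DiagramTable) (v : Fin (2 * 3)) : DiagramTable where
  adj := d.adj
  rank := d.rank
  cyc t x := if t = v then -d.cyc t x else d.cyc t x

theorem Valid.reverse {d : DiagramTable} (h : d.Valid) (v : Fin (2 * 3)) : (d.reverse v).Valid := by
  refine ⟨h.1, h.2.1, h.2.2.1, h.2.2.2.1, h.2.2.2.2.1, fun t ht x y hx hy hxy =>
    h.2.2.2.2.2 t ht x y hx hy ?_⟩
  simp only [DiagramTable.reverse] at hxy
  split_ifs at hxy
  · exact neg_injective hxy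
  · exact hxy

theorem cls_reverse {d : DiagramTable} (h : d.Valid) {v : Fin (2 * 3)} (hv : d.deg v = 3) :
    ((d.reverse v).toOriented (h.reverse v)).cls = -(d.toOriented h).cls := by
  refine OrientedDiagram.cls_eq_neg_of_as ⟨rfl, v, ⟨fun hu => ?_, fun _ => ⟨0, fun x _ => ?_⟩⟩,
    fun w hw => ⟨fun _ => rfl, fun _ => ⟨0, fun x _ => ?_⟩⟩⟩
  · rw [isUni_toOriented, hv] at hu
    norm_num at hu
  · simp [toOriented, DiagramTable.reverse]
  · simp [toOriented, DiagramTable.reverse, hw]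

end DiagramTable

open DiagramTable

/-- A triangle with three legs, with the cyclic orders used to resolve its leg at the vertex `2`
of the triangle. The order of the legs on the line is that of the vertices
`4`, `2`, `5` of the triangle. -/
def wheelTable : DiagramTable :=
  ofEdges [(0, 4), (3, 5), (4, 5), (1, 2), (2, 4), (2, 5)] ![0, 1, 0, 2, 0, 0]
    ![0, 0, ![0, 0, 0, 0, 2, 1], 0, ![1, 0, 2, 0, 0, 0], ![0, 0, 1, 2, 0, 0]]

/-- The same triangle with three legs, labelled to resolve its leg at the vertex `3` of the
triangle; the cyclic orders are opposite to those of `wheelTable` at two vertices. -/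
def wheelTable' : DiagramTable :=
  ofEdges [(0, 4), (2, 5), (4, 5), (1, 3), (3, 4), (3, 5)] ![0, 2, 1, 0, 0, 0]
    ![0, 0, 0, ![0, 0, 0, 0, 2, 1], ![1, 0, 0, 2, 0, 0], ![0, 0, 1, 2, 0, 0]]

/-- The tree with the vertices `1` and `2` of `treeTable rankCrossed` exchanged. -/
def crossedTable : DiagramTable :=
  ofEdges [(0, 4), (2, 4), (4, 5), (1, 5), (3, 5)] ![0, 1, 2, 3, 0, 0]
    ![0, 0, 0, 0, ![1, 0, 2, 0, 0, 0], ![0, 1, 0, 2, 0, 0]]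

/-- The tree with the vertices `1` and `3` of `treeTable rankNested` exchanged. -/
def nestedTable : DiagramTable :=
  ofEdges [(0, 4), (3, 4), (4, 5), (2, 5), (1, 5)] ![0, 2, 1, 3, 0, 0]
    ![0, 0, 0, 0, ![1, 0, 0, 2, 0, 0], ![0, 2, 1, 0, 0, 0]]

/-- The diagram `H` of the IHX relation for the interior edge of `treeTable rankSeparated`. -/
def horizontalTable : DiagramTable :=
  ofEdges [(1, 4), (2, 4), (4, 5), (0, 5), (3, 5)] ![0, 1, 2, 3, 0, 0]
    ![0, 0, 0, 0, ![0, 1, 2, 0, 0, 0], ![2, 0, 0, 1, 0, 0]]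

/-- The diagram `X` of the IHX relation for the interior edge of `treeTable rankSeparated`. -/
def diagonalTable : DiagramTable :=
  ofEdges [(1, 4), (3, 4), (4, 5), (0, 5), (2, 5)] ![0, 1, 2, 3, 0, 0]
    ![0, 0, 0, 0, ![0, 1, 0, 2, 0, 0], ![2, 0, 1, 0, 0, 0]]

theorem wheelTable_valid : wheelTable.Valid := by decide

theorem wheelTable'_valid : wheelTable'.Valid := by decide

theorem crossedTable_valid : crossedTable.Valid := by decide

theorem nestedTable_valid : nestedTable.Valid := by decide

theorem horizontalTable_valid : horizontalTable.Valid := by decide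

theorem diagonalTable_valid : diagonalTable.Valid := by decide

theorem cls_separated_sub_crossed :
    (wheelTable.toOriented wheelTable_valid).cls =
      (stdTree rankSeparated rankSeparated_injective).cls -
        (crossedTable.toOriented crossedTable_valid).cls := by
  refine OrientedDiagram.cls_eq_of_stu ⟨1, 2, 4, 5, by decide, ?_⟩
  unfold stdTree
  decide

theorem cls_crossed_sub_nested :
    (wheelTable'.toOriented wheelTable'_valid).cls =
      (stdTree rankCrossed rankCrossed_injective).cls -
        (nestedTable.toOriented nestedTable_valid).cls := by
  refine OrientedDiagram.cls_eq_of_stu ⟨1, 3, 4, 5, by decide, ?_⟩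
  unfold stdTree
  decide

theorem cls_crossedTable : (crossedTable.toOriented crossedTable_valid).cls =
    (stdTree rankCrossed rankCrossed_injective).cls := by
  refine OrientedDiagram.cls_eq_of_isomorphic ⟨Equiv.swap 1 2, ?_⟩
  unfold stdTree
  decide

theorem cls_nestedTable : (nestedTable.toOriented nestedTable_valid).cls =
    (stdTree rankNested rankNested_injective).cls := by
  refine OrientedDiagram.cls_eq_of_isomorphic ⟨Equiv.swap 1 3, ?_⟩
  unfold stdTree
  decide

theorem cls_wheelTable' : (wheelTable'.toOriented wheelTable'_valid).cls =
    (wheelTable.toOriented wheelTable_valid).cls := by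
  have h := cls_reverse (wheelTable'_valid.reverse 4) (v := 3) (by decide)
  rw [cls_reverse wheelTable'_valid (v := 4) (by decide), neg_neg] at h
  rw [← h]
  refine OrientedDiagram.cls_eq_of_isomorphic ⟨Equiv.ofBijective ![0, 2, 5, 1, 4, 3]
    (Finite.injective_iff_bijective.1 (by decide)), ?_⟩
  decide

theorem cls_separated_ihx : (stdTree rankSeparated rankSeparated_injective).cls =
    (horizontalTable.toOriented horizontalTable_valid).cls -
      (diagonalTable.toOriented diagonalTable_valid).cls := by
  refine OrientedDiagram.cls_eq_of_ihx ⟨4, 5, 1, 0, 2, 3, ?_⟩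
  unfold stdTree
  have h : ∀ {d d' : DiagramTable} (h : d.Valid) (h' : d'.Valid),
    (∀ i j, (d.toOriented h).lt i j ↔ (d'.toOriented h').lt i j) →
    (d.toOriented h).lt = (d'.toOriented h').lt := fun h h' k => by
      ext i j; exact k i j
  refine ⟨by decide, by decide, by decide, by decide, by decide, by decide, by decide, by decide,
    by decide, by decide, h _ _ (by decide), h _ _ (by decide), ?_⟩
  decide

theorem cls_horizontalTable : (horizontalTable.toOriented horizontalTable_valid).cls =
    -(stdTree rankNested rankNested_injective).cls := by
  have h := cls_reverse (treeTable_valid rankNested_injective) (v := 4) (by decide)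
  rw [stdTree, ← h]
  refine OrientedDiagram.cls_eq_of_isomorphic ⟨Equiv.ofBijective ![0, 3, 1, 2, 5, 4]
    (Finite.injective_iff_bijective.1 (by decide)), ?_⟩
  decide

theorem cls_diagonalTable : (diagonalTable.toOriented diagonalTable_valid).cls =
    -(stdTree rankCrossed rankCrossed_injective).cls := by
  have h := cls_reverse (treeTable_valid rankCrossed_injective) (v := 4) (by decide)
  rw [stdTree, ← h]
  refine OrientedDiagram.cls_eq_of_isomorphic ⟨Equiv.ofBijective ![0, 2, 1, 3, 5, 4]
    (Finite.injective_iff_bijective.1 (by decide)), ?_⟩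
  decide

/-- The two resolutions of the triangle with three legs give `[separated] - [crossed] =
[crossed] - [nested]`, and IHX gives `[separated] = [crossed] - [nested]`. -/
theorem cls_crossed : (stdTree rankCrossed rankCrossed_injective).cls = 0 := by
  have h1 := cls_separated_sub_crossed
  have h2 := cls_crossed_sub_nested
  have h3 := cls_separated_ihx
  rw [cls_crossedTable] at h1
  rw [cls_nestedTable, cls_wheelTable', h1] at h2
  rw [cls_horizontalTable, cls_diagonalTable] at h3
  linear_combination (norm := module) h3 - h2

theorem cls_separated : (stdTree rankSeparated rankSeparated_injective).cls =
    -(stdTree rankNested rankNested_injective).cls := by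
  have h3 := cls_separated_ihx
  rw [cls_horizontalTable, cls_diagonalTable, cls_crossed] at h3
  simpa using h3

/-! ### Orientations and automorphisms of the trees -/

namespace OrientedDiagram

variable {n : ℕ}

/-- The oriented diagram with the orientations changed at the vertices where `ε` is `-1`. -/
def twist (ε : Fin (2 * n) → ℤˣ) (Γ : OrientedDiagram n) : OrientedDiagram n where
  toDiagram := Γ.toDiagram
  cyc t x := if ε t = 1 then Γ.cyc t x else -Γ.cyc t x
  cyc_injOn t ht x hx y hy hxy := by
    refine Γ.cyc_injOn t ht hx hy ?_
    dsimp only at hxy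
    split_ifs at hxy
    · exact hxy
    · exact neg_injective hxy
  sgn v := ε v * Γ.sgn v

theorem cls_twist (ε : Fin (2 * n) → ℤˣ) (Γ : OrientedDiagram n) :
    (Γ.twist ε).cls = (((∏ v, ε v : ℤˣ) : ℤ) : ℝ) • Γ.cls := by
  classical
  have key : ∀ s : Finset (Fin (2 * n)), (Γ.twist fun v => if v ∈ s then ε v else 1).cls =
      (((∏ v ∈ s, ε v : ℤˣ) : ℤ) : ℝ) • Γ.cls := by
    intro s
    induction s using Finset.induction_on with
    | empty =>
      have : Γ.twist (fun v => if v ∈ (∅ : Finset (Fin (2 * n))) then ε v else 1) = Γ := by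
        simp [twist]
      rw [this]
      simp
    | insert v s hv ih =>
      rw [Finset.prod_insert hv]
      rcases Int.units_eq_one_or (ε v) with h | h
      · rw [h, one_mul, ← ih]
        congr 2
        ext w
        by_cases hw : w = v
        · subst hw; simp [hv, h]
        · simp [hw]
      · rw [h]
        have : (((-1 * ∏ w ∈ s, ε w : ℤˣ) : ℤ) : ℝ) = -(((∏ w ∈ s, ε w : ℤˣ) : ℤ) : ℝ) := by
          simp
        rw [this, neg_smul, ← ih]
        refine cls_eq_neg_of_as ⟨rfl, v, ⟨fun _ => ?_, fun _ => ⟨0, fun x _ => ?_⟩⟩,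
          fun w hw => ⟨fun _ => ?_, fun _ => ⟨0, fun x _ => ?_⟩⟩⟩
        · simp [twist, hv, h]
        · simp [twist, hv, h]
        · simp [twist, hw]
        · simp [twist, hw]
  simpa using key Finset.univ

end OrientedDiagram

theorem eq_treeHead_or_eq_treeCenter (v : Fin (2 * 3)) :
    (∃ l : Fin 4, v = treeHead l.castSucc) ∨ ∃ j, v = treeCenter j := by
  revert v; decide

section StdTree

variable {r : Fin 4 → ℕ} (hr : Function.Injective r)

theorem deg_treeTable_leaf (r : Fin 4 → ℕ) (l : Fin 4) :
    (treeTable r).deg (treeHead l.castSucc) = 1 :=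
  (by decide : ∀ l : Fin 4, (treeTable 0).deg (treeHead l.castSucc) = 1) l

theorem deg_treeTable_center (r : Fin 4 → ℕ) (j : Fin 2) :
    (treeTable r).deg (treeCenter j) = 3 :=
  (by decide : ∀ j, (treeTable 0).deg (treeCenter j) = 3) j

theorem rank_treeTable (r : Fin 4 → ℕ) (l : Fin 4) :
    (treeTable r).rank (treeHead l.castSucc) = r l := by
  fin_cases l <;> rfl

theorem stdTree_adj {i j : Fin (2 * 3)} : (stdTree r hr).graph.Adj i j ↔ treeAdj i j :=
  decide_eq_true_iff

theorem stdTree_lt (l m : Fin 4) :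
    (stdTree r hr).lt (treeHead l.castSucc) (treeHead m.castSucc) ↔ r l < r m := by
  change _ ∧ _ ∧ _ < _ ↔ _
  rw [deg_treeTable_leaf, deg_treeTable_leaf, rank_treeTable, rank_treeTable]
  simp

theorem isTri_stdTree (j : Fin 2) : (stdTree r hr).IsTri (treeCenter j) :=
  (DiagramTable.isTri_toOriented _ _).2 (deg_treeTable_center r j)

theorem isUni_stdTree (l : Fin 4) : (stdTree r hr).IsUni (treeHead l.castSucc) :=
  (DiagramTable.isUni_toOriented _ _).2 (deg_treeTable_leaf r l)

theorem not_isUni_stdTree (j : Fin 2) : ¬ (stdTree r hr).IsUni (treeCenter j) := by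
  have h := isTri_stdTree hr j
  rw [Diagram.IsTri] at h
  rw [Diagram.IsUni, h]
  norm_num

theorem not_isTri_stdTree (l : Fin 4) : ¬ (stdTree r hr).IsTri (treeHead l.castSucc) := by
  have h := isUni_stdTree hr l
  rw [Diagram.IsUni] at h
  rw [Diagram.IsTri, h]
  norm_num

theorem stdTree_connected : (stdTree r hr).graph.Connected := by
  have h54 : (stdTree r hr).graph.Reachable 5 4 :=
    SimpleGraph.Adj.reachable ((stdTree_adj hr).2 (by decide))
  have h : ∀ v, (stdTree r hr).graph.Reachable v 4 := by
    intro v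
    have hv : v = 4 ∨ treeAdj v 4 ∨ treeAdj v 5 := by revert v; decide
    rcases hv with rfl | hv | hv
    · exact SimpleGraph.Reachable.refl _
    · exact SimpleGraph.Adj.reachable ((stdTree_adj hr).2 hv)
    · exact (SimpleGraph.Adj.reachable ((stdTree_adj hr).2 hv)).trans h54
  exact ⟨fun v w => (h v).trans (h w).symm⟩

end StdTree

namespace ConnOriented

variable {Γ : ConnOriented 3} {σ : Equiv.Perm (Fin (2 * 3))} {r : Fin 4 → ℕ}

/-- The isomorphisms from a standard tree are the labellings by it that have the right order on
the line. -/
theorem isIso_stdTree_iff (hr : Function.Injective r) :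
    (stdTree r hr).IsIso Γ.toDiagram σ ↔ (∀ i j, Γ.graph.Adj (σ i) (σ j) ↔ treeAdj i j) ∧
      ∀ l m : Fin 4, Γ.lt (σ (treeHead l.castSucc)) (σ (treeHead m.castSucc)) ↔ r l < r m := by
  constructor
  · rintro ⟨h1, h2⟩
    exact ⟨fun i j => (h1 i j).trans (stdTree_adj hr), fun l m => (h2 _ _).trans (stdTree_lt hr l m)⟩
  · rintro ⟨h1, h2⟩
    refine ⟨fun i j => (h1 i j).trans (stdTree_adj hr).symm, fun i j => ?_⟩
    rcases eq_treeHead_or_eq_treeCenter i with ⟨l, rfl⟩ | ⟨l, rfl⟩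
    · rcases eq_treeHead_or_eq_treeCenter j with ⟨m, rfl⟩ | ⟨m, rfl⟩
      · exact (h2 l m).trans (stdTree_lt hr l m).symm
      · exact iff_of_false (fun h => not_isUni_label h1 m (Γ.lt_univalent _ _ h).2)
          fun h => not_isUni_stdTree hr m ((stdTree r hr).lt_univalent _ _ h).2
    · exact iff_of_false (fun h => not_isUni_label h1 l (Γ.lt_univalent _ _ h).1)
          fun h => not_isUni_stdTree hr l ((stdTree r hr).lt_univalent _ _ h).1

/-- `Γ.base` is a choice of a first univalent vertex, which is unique. -/
theorem base_label (hσ : ∀ i j, Γ.graph.Adj (σ i) (σ j) ↔ treeAdj i j) (h0 : ∀ l, r 0 ≤ r l)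
    (hr : ∀ l m : Fin 4, Γ.lt (σ (treeHead l.castSucc)) (σ (treeHead m.castSucc)) ↔ r l < r m) :
    Γ.base = σ 0 := by
  obtain ⟨hu, hmin⟩ := (Γ.toDiagram.exists_first Γ.connected).choose_spec
  change Γ.IsUni Γ.base at hu
  by_contra hne
  rcases Γ.lt_total _ _ hu (isUni_label hσ 0) hne with h | h
  · obtain ⟨v, hv⟩ := σ.surjective Γ.base
    rw [← hv] at h hu
    rcases eq_treeHead_or_eq_treeCenter v with ⟨l, rfl⟩ | ⟨j, rfl⟩
    · exact absurd ((hr l 0).1 h) (not_lt.2 (h0 l))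
    · exact not_isUni_label hσ j hu
  · exact hmin _ h

theorem uniSign_label (hσ : ∀ i j, Γ.graph.Adj (σ i) (σ j) ↔ treeAdj i j) :
    Γ.uniSign = Γ.sgn (σ 0) * Γ.sgn (σ 1) * Γ.sgn (σ 2) * Γ.sgn (σ 3) := by
  have h0 : Γ.IsUni (σ 0) := isUni_label hσ 0
  have h1 : Γ.IsUni (σ 1) := isUni_label hσ 1
  have h2 : Γ.IsUni (σ 2) := isUni_label hσ 2
  have h3 : Γ.IsUni (σ 3) := isUni_label hσ 3
  have h4 : ¬ Γ.IsUni (σ 4) := not_isUni_label hσ 0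
  have h5 : ¬ Γ.IsUni (σ 5) := not_isUni_label hσ 1
  rw [uniSign, ← Equiv.prod_comp σ]
  refine (Fin.prod_univ_six _).trans ?_
  rw [if_pos h0, if_pos h1, if_pos h2, if_pos h3, if_neg h4, if_neg h5, mul_one, mul_one]

/-- The class of a tree is that of the standard tree, up to the same signs as for its integral. -/
theorem cls_label (hσ : ∀ i j, Γ.graph.Adj (σ i) (σ j) ↔ treeAdj i j)
    (hinj : Function.Injective r)
    (hr : ∀ l m : Fin 4, Γ.lt (σ (treeHead l.castSucc)) (σ (treeHead m.castSucc)) ↔ r l < r m) :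
    Γ.cls = ((Γ.uniSign : ℤ) : ℝ) • ((treeCycSign hσ : ℤ) : ℝ) • (stdTree r hinj).cls := by
  set ε : Fin (2 * 3) → ℤˣ := treeVertex (fun l => Γ.sgn (σ (treeHead l.castSucc)))
    fun j => Equiv.Perm.sign (treeCyc hσ j) with hε
  have hprod : ∏ v, ε v = Γ.uniSign * treeCycSign hσ := by
    rw [uniSign_label hσ, treeCycSign]
    refine (Fin.prod_univ_six _).trans ?_
    rw [← mul_assoc]
    rfl
  have hcyc : ∀ π : Equiv.Perm (Fin 3), ∃ k, ∀ m,
      π m = (if Equiv.Perm.sign π = 1 then m + 1 else -(m + 1)) + k := by decide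
  have hstd : ∀ j m, (stdTree r hinj).cyc (treeCenter j) (treeNbr j m) = m + 1 := by
    intro j m
    exact (by decide : ∀ j m, (treeTable 0).cyc (treeCenter j) (treeNbr j m) = m + 1) j m
  have hiso : ((stdTree r hinj).twist ε).Isomorphic Γ.toOrientedDiagram := by
    refine ⟨σ, (isIso_stdTree_iff hinj).2 ⟨hσ, hr⟩, fun v => ?_⟩
    rcases eq_treeHead_or_eq_treeCenter v with ⟨l, rfl⟩ | ⟨j, rfl⟩
    · refine ⟨fun _ => ?_, fun h => absurd h (not_isTri_stdTree hinj l)⟩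
      change _ = ε _ * 1
      rw [mul_one, hε]
      fin_cases l <;> rfl
    · refine ⟨fun h => absurd h (not_isUni_stdTree hinj j), fun _ => ?_⟩
      obtain ⟨k, hk⟩ := hcyc (treeCyc hσ j)
      refine ⟨k, fun x hx => ?_⟩
      have hnbr : ∀ j x, treeAdj (treeCenter j) x → ∃ m, x = treeNbr j m := by decide
      obtain ⟨m, rfl⟩ := hnbr j x ((stdTree_adj hinj).1 hx)
      have hεj : ε (treeCenter j) = Equiv.Perm.sign (treeCyc hσ j) := by
        fin_cases j <;> rfl
      refine (hk m).trans ?_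
      simp only [OrientedDiagram.twist, hεj, hstd]
  rw [OrientedDiagram.cls_eq_of_isomorphic hiso, OrientedDiagram.cls_twist, hprod, smul_smul]
  push_cast
  rfl

end ConnOriented

/-- An automorphism preserves a strict total order of the univalent vertices, so it fixes them. -/
theorem Diagram.IsIso.apply_univalent {n : ℕ} {D : Diagram n} {ρ : Equiv.Perm (Fin (2 * n))}
    (h : D.IsIso D ρ) {u : Fin (2 * n)} (hu : D.IsUni u) : ρ u = u := by
  have : IsTrans (Fin (2 * n)) D.lt := ⟨D.lt_trans⟩
  have : Std.Irrefl D.lt := ⟨D.lt_irrefl⟩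
  induction u using (Finite.wellFounded_of_trans_of_irrefl D.lt).induction with
  | _ u ih =>
    by_contra hne
    have hρ : D.IsUni (ρ u) := by
      have : D.graph.neighborSet (ρ u) = ρ '' D.graph.neighborSet u := by
        ext w
        obtain ⟨w, rfl⟩ := ρ.surjective w
        simp [h.1]
      rw [Diagram.IsUni, this, ncard_image_of_injective _ ρ.injective]
      exact hu
    rcases D.lt_total _ _ hρ hu hne with h1 | h1
    · exact hne (ρ.injective (ih _ h1 hρ))
    · obtain ⟨w, hw⟩ := ρ.surjective u
      rw [← hw, h.2, hw] at h1
      have := ih w h1 (D.lt_univalent _ _ h1).1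
      rw [← hw, this, this] at hne
      exact hne rfl

namespace ConnOriented

variable {Γ : ConnOriented 3} {σ : Equiv.Perm (Fin (2 * 3))}

theorem numAut_label (hσ : ∀ i j, Γ.graph.Adj (σ i) (σ j) ↔ treeAdj i j) : Γ.numAut = 1 := by
  have key : ∀ ρ, Γ.IsIso Γ.toDiagram ρ → ρ = 1 := by
    intro ρ hρ
    ext1 v
    obtain ⟨v, rfl⟩ := σ.surjective v
    rcases eq_treeHead_or_eq_treeCenter v with ⟨l, rfl⟩ | ⟨j, rfl⟩
    · exact hρ.apply_univalent (isUni_label hσ l)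
    · -- a trivalent vertex is the only neighbour of a univalent one
      have hleaf : ∀ j, ∃ l : Fin 4, ∀ x, treeAdj (treeHead l.castSucc) x ↔ x = treeCenter j := by
        decide
      obtain ⟨l, hl⟩ := hleaf j
      have h1 : Γ.graph.Adj (ρ (σ (treeHead l.castSucc))) (ρ (σ (treeCenter j))) :=
        (hρ.1 _ _).2 ((hσ _ _).2 ((hl _).2 rfl))
      rw [hρ.apply_univalent (isUni_label hσ l)] at h1
      obtain ⟨x, hx⟩ := σ.surjective (ρ (σ (treeCenter j)))
      rw [← hx, hσ, hl] at h1
      rw [← hx, h1]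
      rfl
  rw [Diagram.numAut, Nat.card_eq_one_iff_unique]
  exact ⟨⟨fun a b => Subtype.ext ((key _ a.2).trans (key _ b.2).symm)⟩,
    ⟨⟨1, fun _ _ => Iff.rfl, fun _ _ => Iff.rfl⟩⟩⟩

end ConnOriented

/-! ### The anomaly in degree three -/

namespace ConnOriented

variable {Γ : ConnOriented 3} {σ : Equiv.Perm (Fin (2 * 3))} {r : Fin 4 → ℕ} {O : Set (ℝ × ℝ)}

/-- There are three trees: one may label the first univalent vertex by `0`, and the two univalent
vertices at the other trivalent vertex by `2` and `3` in their order. -/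
theorem isIso_of_not_triangle (Γ : ConnOriented 3)
    (hT : ∀ x y z, Γ.graph.Adj x y → Γ.graph.Adj y z → ¬ Γ.graph.Adj z x) :
    ∃ σ, (stdTree rankSeparated rankSeparated_injective).IsIso Γ.toDiagram σ ∨
      (stdTree rankCrossed rankCrossed_injective).IsIso Γ.toDiagram σ ∨
      (stdTree rankNested rankNested_injective).IsIso Γ.toDiagram σ := by
  obtain ⟨u, hu, hmin⟩ := Γ.toDiagram.exists_first Γ.connected
  obtain ⟨σ, h0, hσ, h23⟩ := Γ.toDiagram.exists_treeLabel_lt Γ.connected hT hu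
  refine ⟨σ, ?_⟩
  simp only [isIso_stdTree_iff]
  have := exists_rank (L := fun l m => Γ.lt (σ (treeHead l.castSucc)) (σ (treeHead m.castSucc)))
    (fun l => Γ.lt_irrefl _) (fun l m k => Γ.lt_trans _ _ _)
    (fun l m hlm => Γ.lt_total _ _ (isUni_label hσ l) (isUni_label hσ m)
      fun h => hlm (treeHead_castSucc_injective (σ.injective h)))
    (fun l => by
      change ¬ Γ.lt _ (σ 0)
      rw [h0]
      exact hmin _) h23
  exact this.imp (fun h => ⟨hσ, h⟩) (Or.imp (fun h => ⟨hσ, h⟩) fun h => ⟨hσ, h⟩)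

theorem converges_of_isIso (hr : Function.Injective r) (h0 : ∀ l, r 0 ≤ r l) (hO : TreeOrder r O)
    (h : (stdTree r hr).IsIso Γ.toDiagram σ) : Γ.Converges := by
  obtain ⟨hσ, hlt⟩ := (isIso_stdTree_iff hr).1 h
  exact (integral_tree hσ (base_label hσ h0 hlt) hO hlt).1

/-- The contribution of a tree to the anomaly: the signs of its orientation cancel, and it has no
automorphism but the identity. -/
theorem smul_cls_of_isIso (hr : Function.Injective r) (h0 : ∀ l, r 0 ≤ r l) (hO : TreeOrder r O)
    (h : (stdTree r hr).IsIso Γ.toDiagram σ) :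
    (Γ.f / (2 * (Γ.numAut : ℝ))) • Γ.cls = (treeIntegral O / 2) • (stdTree r hr).cls := by
  obtain ⟨hσ, hlt⟩ := (isIso_stdTree_iff hr).1 h
  rw [(integral_tree hσ (base_label hσ h0 hlt) hO hlt).2, numAut_label hσ, cls_label hσ hr hlt,
    smul_smul, smul_smul]
  have hsq : ∀ ε : ℤˣ, ((ε : ℤ) : ℝ) * ((ε : ℤ) : ℝ) = 1 := by
    intro ε
    rcases Int.units_eq_one_or ε with rfl | rfl <;> simp
  congr 1
  have h1 := hsq Γ.uniSign
  have h2 := hsq (treeCycSign hσ)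
  push_cast
  linear_combination (treeIntegral O / 2) * ((treeCycSign hσ : ℤ) : ℝ) * ((treeCycSign hσ : ℤ) : ℝ) * h1 +
    (treeIntegral O / 2) * h2

end ConnOriented

theorem converges_three (Γ : ConnOriented 3) : Γ.Converges := by
  by_cases hT : ∀ x y z, Γ.graph.Adj x y → Γ.graph.Adj y z → ¬ Γ.graph.Adj z x
  · obtain ⟨σ, h | h | h⟩ := Γ.isIso_of_not_triangle hT
    · exact ConnOriented.converges_of_isIso _ (by decide) treeOrder_separated h
    · exact ConnOriented.converges_of_isIso _ (by decide) treeOrder_crossed h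
    · exact ConnOriented.converges_of_isIso _ (by decide) treeOrder_nested h
  · push Not at hT
    obtain ⟨x, y, z, hxy, hyz, hzx⟩ := hT
    exact (Γ.integral_of_triangle hxy hyz hzx).1

/-- The isomorphism class of a standard tree. -/
def stdTreeClass (r : Fin 4 → ℕ) (hr : Function.Injective r) : DW 3 :=
  Quotient.mk _ ⟨(stdTree r hr).toDiagram, stdTree_connected hr⟩

theorem isoClass_eq_stdTreeClass_iff {r : Fin 4 → ℕ} (hr : Function.Injective r)
    {Γ : ConnOriented 3} : Γ.isoClass = stdTreeClass r hr ↔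
      ∃ σ, (stdTree r hr).IsIso Γ.toDiagram σ := by
  rw [eq_comm]
  exact Quotient.eq

theorem treeIntegral_nested : treeIntegral nested = treeIntegral separated := by
  rw [treeIntegral, treeIntegral, dirVolume_nested]

theorem anomaly_three (r : Choice) : anomaly r 3 = 0 := by
  set t : DW 3 → DiagramSpace 3 := fun c =>
    ((r.rep 3 c).f / (2 * ((r.rep 3 c).numAut : ℝ))) • (r.rep 3 c).cls with ht
  set S := stdTreeClass rankSeparated rankSeparated_injective with hS
  set N := stdTreeClass rankNested rankNested_injective with hN
  have hS' : t S = (treeIntegral separated / 2) •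
      (stdTree rankSeparated rankSeparated_injective).cls := by
    obtain ⟨σ, h⟩ := (isoClass_eq_stdTreeClass_iff _).1 (r.isoClass_rep 3 S)
    exact ConnOriented.smul_cls_of_isIso _ (by decide) treeOrder_separated h
  have hN' : t N = (treeIntegral nested / 2) • (stdTree rankNested rankNested_injective).cls := by
    obtain ⟨σ, h⟩ := (isoClass_eq_stdTreeClass_iff _).1 (r.isoClass_rep 3 N)
    exact ConnOriented.smul_cls_of_isIso _ (by decide) treeOrder_nested h
  have hSN : t S + t N = 0 := by
    rw [hS', hN', treeIntegral_nested, cls_separated, smul_neg, neg_add_cancel]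
  have h0 : ∀ c, c ≠ S → c ≠ N → t c = 0 := by
    intro c hcS hcN
    by_cases hT : ∀ x y z, (r.rep 3 c).graph.Adj x y → (r.rep 3 c).graph.Adj y z →
        ¬ (r.rep 3 c).graph.Adj z x
    · obtain ⟨σ, h | h | h⟩ := (r.rep 3 c).isIso_of_not_triangle hT
      · exact absurd ((r.isoClass_rep 3 c).symm.trans ((isoClass_eq_stdTreeClass_iff _).2 ⟨σ, h⟩))
          hcS
      · refine (ConnOriented.smul_cls_of_isIso _ (by decide) treeOrder_crossed h).trans ?_
        rw [cls_crossed, smul_zero]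
      · exact absurd ((r.isoClass_rep 3 c).symm.trans ((isoClass_eq_stdTreeClass_iff _).2 ⟨σ, h⟩))
          hcN
    · push Not at hT
      obtain ⟨x, y, z, hxy, hyz, hzx⟩ := hT
      rw [ht]
      dsimp only
      rw [((r.rep 3 c).integral_of_triangle hxy hyz hzx).2, zero_div, zero_smul]
  change ∑ c, t c = 0
  by_cases hne : S = N
  · -- this does not happen, but then the term would be its own opposite
    rw [← hne, ← two_smul ℝ] at hSN
    refine Finset.sum_eq_zero fun c _ => ?_
    by_cases hc : c = S
    · rw [hc]
      exact (smul_eq_zero.1 hSN).resolve_left two_ne_zero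
    · exact h0 c hc (hne ▸ hc)
  · rw [Finset.sum_eq_add S N hne (fun c _ hc => h0 c hc.1 hc.2) (by simp) (by simp), hSN]

end ConfInt

theorem proposition4 (r : ConfInt.Choice) :
    (∀ Γ : ConfInt.ConnOriented 3, Γ.Converges) ∧ ConfInt.anomaly r 3 = 0 :=
  ⟨ConfInt.converges_three, ConfInt.anomaly_three r⟩
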